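/- We work over $\mathbb{C}$. For an integral plane curve $C\subset\mathbb{P}^2$ let $\nu_C:C^\nu\to C$ be its normalization. For a reduced plane curve $B\subset\mathbb{P}^2$ let $\operatorname{Hyp}(B,2)$ be the set of integral plane curves $C$ that are hyper-bitangent to $B$, i.e. such that $|\nu_C^{-1}(C\cap B)|\le 2$, and let $\operatorname{Hyp}_d(B,2)\subset\operatorname{Hyp}(B,2)$ be the subset of curves of degree $d$. Let $B$ be a reduced plane curve of degree $b$ with $c\ge 4$ irreducible components, such that every point in the intersection of two components is a node of $B$. Then: (a) If $c\ge 5$, then $\operatorname{Hyp}(B,2)=\emptyset$. (b) $\operatorname{Hyp}_1(B,2)$ is finite. Moreover: (i) if $b=4$, then $|\operatorname{Hyp}_1(B,2)|=3$; (ii) if $B$ does not contain two lines (i.e. fewer than two components of $B$ have degree $1$), then $\operatorname{Hyp}_1(B,2)=\emptyset$; (iii) if $b\ge 5$ and $B$ is general, then $\operatorname{Hyp}_1(B,2)=\emptyset$. That is: for all integers $c\ge 4$ and $b_1,\dots,b_c\ge 1$ with $b_1+\dots+b_c\ge 5$ there is a nonempty Zariski open subset $U$ of the product $\prod_{i=1}^c\mathbb{P}^{b_i(b_i+3)/2}$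 of the spaces of plane curves of degrees $b_1,\dots,b_c$ such that, for every $(B_1,\dots,B_c)\in U$, the curve $B=B_1\cup\dots\cup B_c$ is reduced with the $c$ distinct irreducible components $B_i$, every point in the intersection of two of them is a node of $B$, and $\operatorname{Hyp}_1(B,2)=\emptyset$. (c) If $d\ge 2$, then $\operatorname{Hyp}_d(B,2)=\emptyset$. -/

import Mathlib

open MvPolynomial

namespace PlaneCurve

/-- Points of the complex projective plane. -/
abbrev Plane : Type := Projectivization ℂ (Fin 3 → ℂ)

/-- Polynomials in three variables; plane curves are given by homogeneous ones. -/
abbrev Poly : Type := MvPolynomial (Fin 3) ℂ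

/-- The zero locus in the plane of a homogeneous polynomial. For homogeneous `P` the condition does
not depend on the chosen representative of the point. -/
def zeroLocus (P : Poly) : Set Plane := {p | eval p.rep P = 0}

/-- The homogeneous coordinate ring of the curve `P = 0`. -/
abbrev CoordRing (P : Poly) : Type := Poly ⧸ Ideal.span {P}

/-- The class of a polynomial in the total fraction ring of the homogeneous coordinate ring (a field
if `P` is irreducible). -/
noncomputable def toFrac (P : Poly) (g : Poly) : FractionRing (CoordRing P) :=
  algebraMap (CoordRing P) (FractionRing (CoordRing P)) (Ideal.Quotient.mk (Ideal.span {P}) g)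

theorem toFrac_mul (P g h : Poly) : toFrac P (g * h) = toFrac P g * toFrac P h := by
  simp [toFrac]

theorem toFrac_add (P g h : Poly) : toFrac P (g + h) = toFrac P g + toFrac P h := by
  simp [toFrac]

theorem toFrac_one (P : Poly) : toFrac P 1 = 1 := by
  simp [toFrac]

theorem toFrac_C (P : Poly) (r : ℂ) :
    toFrac P (C r) = algebraMap ℂ (FractionRing (CoordRing P)) r := by
  rw [IsScalarTower.algebraMap_apply ℂ (CoordRing P) (FractionRing (CoordRing P))]
  rfl

/-- The function field of the integral curve `P = 0`: all quotients `g / h` of homogeneous elements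
of the same degree of its homogeneous coordinate ring, `h` not a zero divisor
(that is, `h` not divisible by `P`, when `P` is irreducible). -/
noncomputable def functionField (P : Poly) : Subalgebra ℂ (FractionRing (CoordRing P)) where
  carrier := {z | ∃ (n : ℕ) (g h : Poly), g.IsHomogeneous n ∧ h.IsHomogeneous n ∧
    toFrac P h ∈ nonZeroDivisors (FractionRing (CoordRing P)) ∧ z * toFrac P h = toFrac P g}
  mul_mem' := by
    rintro z w ⟨n, g, h, hg, hh, h0, hz⟩ ⟨n', g', h', hg', hh', h0', hw⟩
    refine ⟨n + n', g * g', h * h', hg.mul hg', hh.mul hh', ?_, ?_⟩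
    · rw [toFrac_mul]
      exact mul_mem h0 h0'
    · rw [toFrac_mul, toFrac_mul, ← hz, ← hw]
      ring
  add_mem' := by
    rintro z w ⟨n, g, h, hg, hh, h0, hz⟩ ⟨n', g', h', hg', hh', h0', hw⟩
    refine ⟨n + n', g * h' + h * g', h * h', (hg.mul hh').add (hh.mul hg'), hh.mul hh', ?_, ?_⟩
    · rw [toFrac_mul]
      exact mul_mem h0 h0'
    · rw [toFrac_add, toFrac_mul, toFrac_mul, toFrac_mul, ← hz, ← hw]
      ring
  algebraMap_mem' := by
    intro r
    refine ⟨0, C r, 1, isHomogeneous_C _ _, isHomogeneous_one _ _, ?_, ?_⟩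
    · rw [toFrac_one]
      exact one_mem _
    · rw [toFrac_one, toFrac_C, mul_one]

/-- The local ring at `p` of the integral curve `P = 0`: all quotients `g / h` of homogeneous
elements of the same degree of its homogeneous coordinate ring with `h(p) ≠ 0`. It is only used for
`P` irreducible and `p` on the curve. -/
noncomputable def localRing (P : Poly) (p : Plane) :
    Subalgebra ℂ (FractionRing (CoordRing P)) where
  carrier := {z | ∃ (n : ℕ) (g h : Poly), g.IsHomogeneous n ∧ h.IsHomogeneous n ∧
    eval p.rep h ≠ 0 ∧ z * toFrac P h = toFrac P g}
  mul_mem' := by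
    rintro z w ⟨n, g, h, hg, hh, h0, hz⟩ ⟨n', g', h', hg', hh', h0', hw⟩
    refine ⟨n + n', g * g', h * h', hg.mul hg', hh.mul hh', ?_, ?_⟩
    · rw [map_mul]
      exact mul_ne_zero h0 h0'
    · rw [toFrac_mul, toFrac_mul, ← hz, ← hw]
      ring
  add_mem' := by
    rintro z w ⟨n, g, h, hg, hh, h0, hz⟩ ⟨n', g', h', hg', hh', h0', hw⟩
    refine ⟨n + n', g * h' + h * g', h * h', (hg.mul hh').add (hh.mul hg'), hh.mul hh', ?_, ?_⟩
    · rw [map_mul]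
      exact mul_ne_zero h0 h0'
    · rw [toFrac_add, toFrac_mul, toFrac_mul, toFrac_mul, ← hz, ← hw]
      ring
  algebraMap_mem' := by
    intro r
    refine ⟨0, C r, 1, isHomogeneous_C _ _, isHomogeneous_one _ _, ?_, ?_⟩
    · simp
    · rw [toFrac_one, toFrac_C, mul_one]

/-- The integral closure, in the function field, of the local ring at `p` of the integral curve
`P = 0`. -/
noncomputable def normalizedLocalRing (P : Poly) (p : Plane) :
    Subalgebra ℂ (FractionRing (CoordRing P)) :=
  ((integralClosure (localRing P p) (FractionRing (CoordRing P))).restrictScalars ℂ) ⊓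
    functionField P

/-- The (closed) points of the normalization of the integral curve `P = 0`. The points above `p` are
the maximal ideals of the integral closure of the local ring at `p` in the function field; the
normalization map is `x ↦ x.1`. -/
def NormalizationPoint (P : Poly) : Type :=
  Σ p : zeroLocus P, MaximalSpectrum (normalizedLocalRing P p)

/-- The set of integral plane curves `C` of degree `d` that are hyper-bitangent to `B`: at most two
points of the normalization of `C` lie above `C ∩ B`. A curve is recorded as its set of points (which
determines the irreducible equation `P` up to a nonzero constant). -/
def hypDeg (B : Set Plane) (d : ℕ) : Set (Set Plane) :=
  {C | ∃ P : Poly, Irreducible P ∧ P.IsHomogeneous d ∧ C = zeroLocus P ∧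
    ENat.card {x : NormalizationPoint P // (x.1 : Plane) ∈ B} ≤ 2}

/-- The set of all integral plane curves hyper-bitangent to `B`. -/
def hyp (B : Set Plane) : Set (Set Plane) := {C | ∃ d, C ∈ hypDeg B d}

/-- `p` is a node (ordinary double point) of the curve `G = 0`, for `G` homogeneous of positive degree:
all first derivatives of `G` vanish at `p` and the Hessian matrix has rank two. In affine coordinates
centred at `p` this says that the equation starts with a nondegenerate quadratic form, that is, with
a product of two non-proportional linear forms. -/
def IsNode (G : Poly) (p : Plane) : Prop :=
  (∀ i, eval p.rep (pderiv i G) = 0) ∧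
    (Matrix.of fun i j : Fin 3 => eval p.rep (pderiv i (pderiv j G))).rank = 2

/-- The union `B` of the curves `F i = 0`. -/
def union {c : ℕ} (F : Fin c → Poly) : Set Plane := ⋃ i, zeroLocus (F i)

/-- The equations `F i`, `i < c`, define the `c` distinct irreducible components, of degrees `b i`, of a
reduced plane curve `B` with equation `∏ i, F i`, such that every point lying on two components is a
node of `B`. -/
structure IsNodalUnion {c : ℕ} (b : Fin c → ℕ) (F : Fin c → Poly) : Prop where
  irreducible : ∀ i, Irreducible (F i)
  homogeneous : ∀ i, (F i).IsHomogeneous (b i)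
  distinct : ∀ i j, i ≠ j → ¬ Associated (F i) (F j)
  node : ∀ i j, i ≠ j → ∀ p ∈ zeroLocus (F i) ∩ zeroLocus (F j), IsNode (∏ k, F k) p

/-- `Q` holds for a general choice of `c` plane curves of degrees `b i`: there is a polynomial `Φ` in
the coefficients of the equations which is not identically zero on the space of all tuples of forms
of degrees `b i`, such that `Q` holds wherever `Φ ≠ 0`. For a property `Q` which is invariant under
rescaling the equations, this says that `Q` holds on a nonempty Zariski open subset of the product
of the projective spaces that parametrize curves of degrees `b i`. -/
def ForGeneral {c : ℕ} (b : Fin c → ℕ) (Q : (Fin c → Poly) → Prop) : Prop :=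
  ∃ Φ : MvPolynomial (Fin c × (Fin 3 →₀ ℕ)) ℂ,
    (∃ F : Fin c → Poly, (∀ i, (F i).IsHomogeneous (b i)) ∧
      eval (fun k => coeff k.2 (F k.1)) Φ ≠ 0) ∧
    ∀ F : Fin c → Poly, (∀ i, (F i).IsHomogeneous (b i)) →
      eval (fun k => coeff k.2 (F k.1)) Φ ≠ 0 → Q F

end PlaneCurve

/-! ### Homogeneous forms: existence of intersection points, the ideal of a point -/

namespace PlaneCurve

/-! Every component of `B` meets `C`, while `C ∩ B` has at most two points and, by the node
condition, no point lies on three components. Hence `c = 4`, which gives (a). Moreover the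
components split into two pairs, one through each of two points `p ≠ q` and meeting `C` only there,
and `C` has a single branch at `p` (`exists_contact`).

Let `F`, `G` be the pair at `p`. They are transversal, so they serve as local coordinates. By Bézout
the branch at `p` meets each of them with multiplicity at least `d`, so `C` has multiplicity at
least `d` at `p`, which forces a line. The proof uses valuations instead of multiplicities. Suppose
that `C` is not the line `L = 0` joining `p` and `q`, and let `b` be the degree of `F`. Then `L ^ b
/ F` is regular on `C` away from `p`, nonzero, and zero at `q`, so it is not integral at `p`
(`exists_eq_algebraMap_of_forall_isIntegral`). As `C` is unibranch at `p`, the normalized local ring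
is a valuation ring (`mem_or_mem_of_isLocalRing`), so `F / L ^ b` lies in its maximal ideal;
likewise for `G`. But near `p` the form `L` is a combination of `F` and `G`, and dividing by `L`
puts a unit into the maximal ideal (`dvd_of_unibranch`). This proves (c).

A curve of degree at least two meeting a line in one point is tangent to it there. Transversal
curves have no common tangent, so each pair contains a line. This gives (ii), and finiteness too,
since `C` joins two of the finitely many points where a line of `B` meets another component. For
four lines, the hyper-bitangent lines correspond to the three partitions into pairs.

For (iii) some component has degree at least two and is tangent to the line joining `p` and `q`.
This imposes five conditions on a configuration with four parameters. `ForGeneral.not_of_solvable`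
turns such a count into a nonzero polynomial in the coefficients; similar counts show that a general
union is nodal with irreducible components. -/

theorem aeval_mul_algebraMap_of_isHomogeneous {S : Type*} [CommRing S] [Algebra ℂ S] {F : Poly}
    {n : ℕ} (hF : F.IsHomogeneous n) (a : S) (v : Fin 3 → ℂ) :
    aeval (fun i => a * algebraMap ℂ S (v i)) F = a ^ n * algebraMap ℂ S (eval v F) := by
  rw [aeval_eq_eval₂Hom, coe_eval₂Hom, eval₂_eq, eval_eq, map_sum, Finset.mul_sum]
  refine Finset.sum_congr rfl fun m hm => ?_
  have h : ∑ i, m i = n := by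
    rw [← hF (mem_support_iff.mp hm), Finsupp.weight_apply, Finsupp.sum_fintype _ _ (by simp)]
    simp
  simp only [mul_pow, Finset.prod_mul_distrib, map_mul, map_prod, map_pow]
  rw [Finset.prod_pow_eq_pow_sum, Finset.sum_subset (Finset.subset_univ _)
    (fun i _ hi => by simpa using hi), h]
  ring

theorem eval_smul_of_isHomogeneous {F : Poly} {n : ℕ} (hF : F.IsHomogeneous n) (a : ℂ)
    (v : Fin 3 → ℂ) : eval (a • v) F = a ^ n * eval v F := by
  have := aeval_mul_algebraMap_of_isHomogeneous hF a v
  simpa [MvPolynomial.aeval_eq_eval, Pi.smul_def] using this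

theorem mk_mem_zeroLocus_iff {F : Poly} {n : ℕ} (hF : F.IsHomogeneous n) {v : Fin 3 → ℂ}
    (hv : v ≠ 0) : Projectivization.mk ℂ v hv ∈ zeroLocus F ↔ eval v F = 0 := by
  obtain ⟨a, ha⟩ := Projectivization.exists_smul_eq_mk_rep ℂ v hv
  rw [zeroLocus, Set.mem_ofPred_eq, ← ha, Units.smul_def, eval_smul_of_isHomogeneous hF]
  simp

theorem exists_C_of_isHomogeneous_zero {F : Poly} (hF : F.IsHomogeneous 0) : ∃ r, F = C r := by
  refine ⟨coeff 0 F, ?_⟩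
  rw [← totalDegree_eq_zero_iff_eq_C]
  simpa using hF.totalDegree_le

theorem one_le_of_irreducible {F : Poly} {n : ℕ} (hF : F.IsHomogeneous n) (h : Irreducible F) :
    1 ≤ n := by
  rcases Nat.eq_zero_or_pos n with rfl | hn
  · obtain ⟨r, rfl⟩ := exists_C_of_isHomogeneous_zero hF
    exact absurd (by simpa using h.ne_zero)
      (fun hr : r ≠ 0 => h.not_isUnit ((IsUnit.mk0 r hr).map C))
  · exact hn

theorem eval_zero_of_isHomogeneous {F : Poly} {n : ℕ} (hF : F.IsHomogeneous n) (hn : 1 ≤ n) :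
    eval (0 : Fin 3 → ℂ) F = 0 := by
  have := eval_smul_of_isHomogeneous hF 0 0
  simpa [zero_pow (by omega : n ≠ 0)] using this

/-- The ideal of the coordinate subspace where the coordinates outside `s` vanish. -/
noncomputable def coordIdeal (s : Finset (Fin 3)) : Ideal Poly :=
  RingHom.ker (aeval (fun i => if i ∈ s then X i else 0 : Fin 3 → Poly))

instance (s : Finset (Fin 3)) : (coordIdeal s).IsPrime := RingHom.ker_isPrime _

theorem coordIdeal_lt {s t : Finset (Fin 3)} (h : t ⊂ s) : coordIdeal s < coordIdeal t := by
  refine lt_of_le_of_ne (fun f hf => ?_) (fun he => ?_)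
  · have hc : (aeval (fun i => if i ∈ t then X i else 0 : Fin 3 → Poly)) =
        (aeval (fun i => if i ∈ t then X i else 0 : Fin 3 → Poly)).comp
        (aeval (fun i => if i ∈ s then X i else 0 : Fin 3 → Poly)) := by
      ext i : 1
      by_cases hi : i ∈ s
      · simp [hi]
      · have hi' : i ∉ t := fun hh => hi (h.1 hh)
        simp [hi, hi']
    rw [coordIdeal, RingHom.mem_ker] at hf ⊢
    rw [hc, AlgHom.comp_apply, hf, map_zero]
  · obtain ⟨i, hi, hi'⟩ := Finset.exists_of_ssubset h
    have h1 : (X i : Poly) ∈ coordIdeal t := by simp [coordIdeal, RingHom.mem_ker, hi']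
    rw [← he] at h1
    simp [coordIdeal, RingHom.mem_ker, hi] at h1

/-- Letting the coordinates vanish one after another gives a chain of primes with three strict
inclusions. -/
theorem three_le_height_coordIdeal_empty : 3 ≤ (coordIdeal ∅).height := by
  have h1 := Ideal.height_add_one_le_of_lt_of_isPrime
    (coordIdeal_lt (s := {0}) (t := ∅) (by decide))
  have h2 := Ideal.height_add_one_le_of_lt_of_isPrime
    (coordIdeal_lt (s := {0, 1}) (t := {0}) (by decide))
  have h3 := Ideal.height_add_one_le_of_lt_of_isPrime
    (coordIdeal_lt (s := {0, 1, 2}) (t := {0, 1}) (by decide))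
  calc (3 : ℕ∞) = 0 + 1 + 1 + 1 := by norm_num
    _ ≤ (coordIdeal {0, 1, 2}).height + 1 + 1 + 1 := by gcongr; exact zero_le
    _ ≤ _ := by
      refine le_trans ?_ h1
      gcongr
      refine le_trans ?_ h2
      gcongr

theorem coordIdeal_empty : coordIdeal ∅ = vanishingIdeal ℂ {(0 : Fin 3 → ℂ)} := by
  ext f
  rw [coordIdeal, RingHom.mem_ker, mem_vanishingIdeal_singleton_iff]
  simp only [Finset.notMem_empty, if_false]
  have h : ∀ f : Poly, aeval (fun _ => 0 : Fin 3 → Poly) f = C (aeval (0 : Fin 3 → ℂ) f) := by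
    intro f
    induction f using MvPolynomial.induction_on <;> simp_all
  rw [h]
  simp

/-- Two plane curves of positive degrees meet. -/
theorem exists_common_zero {F G : Poly} {m n : ℕ} (hF : F.IsHomogeneous m) (hm : 1 ≤ m)
    (hG : G.IsHomogeneous n) (hn : 1 ≤ n) : ∃ v : Fin 3 → ℂ, v ≠ 0 ∧ eval v F = 0 ∧ eval v G = 0 := by
  -- Otherwise the radical of `(F, G)` is the ideal of the origin. That ideal is then a minimal
  -- prime over two generators, so Krull bounds its height by two, but its height is at least three.
  by_contra! hcon
  set I : Ideal Poly := Ideal.span {F, G} with hI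
  have hzero : MvPolynomial.zeroLocus ℂ I = {0} := by
    rw [hI, zeroLocus_span]
    ext v
    simp only [Set.mem_ofPred_eq, Set.mem_insert_iff, Set.mem_singleton_iff, forall_eq_or_imp,
      forall_eq]
    constructor
    · intro h
      by_contra hv
      exact hcon v hv h.1 h.2
    · rintro rfl
      exact ⟨eval_zero_of_isHomogeneous hF hm, eval_zero_of_isHomogeneous hG hn⟩
  have hrad := vanishingIdeal_zeroLocus_eq_radical (k := ℂ) (K := ℂ) I
  rw [hzero, ← coordIdeal_empty] at hrad
  have hmin : coordIdeal ∅ ∈ I.minimalPrimes := by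
    rw [← Ideal.radical_minimalPrimes, ← hrad, Ideal.minimalPrimes_eq_subsingleton_self]
    rfl
  have h2 : (coordIdeal ∅).height ≤ 2 := by
    refine (Ideal.height_le_card_of_mem_minimalPrimes_span (s := {F, G}) (by simp) hmin).trans ?_
    have := Set.ncard_insert_le F {G}
    rw [Set.ncard_singleton] at this
    exact_mod_cast this
  exact absurd (three_le_height_coordIdeal_empty.trans h2) (by decide)

theorem exists_mem_zeroLocus_inter {F G : Poly} {m n : ℕ} (hF : F.IsHomogeneous m) (hm : 1 ≤ m)
    (hG : G.IsHomogeneous n) (hn : 1 ≤ n) : ∃ p : Plane, p ∈ zeroLocus F ∧ p ∈ zeroLocus G := by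
  obtain ⟨v, hv, h1, h2⟩ := exists_common_zero hF hm hG hn
  exact ⟨.mk ℂ v hv, (mk_mem_zeroLocus_iff hF hv).mpr h1, (mk_mem_zeroLocus_iff hG hv).mpr h2⟩

section
attribute [local instance] MvPolynomial.gradedAlgebra

theorem homogeneousComponent_add_mul {M : Poly} {d : ℕ} (hM : M.IsHomogeneous d) (n : ℕ)
    (A : Poly) : homogeneousComponent (n + d) (A * M) = homogeneousComponent n A * M := by
  have h := DirectSum.coe_decompose_mul_add_of_right_mem (homogeneousSubmodule (Fin 3) ℂ)
    (i := n) (a := A) hM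
  simpa only [← decomposition.decompose'_apply] using! h

theorem homogeneousComponent_mul_of_lt {M : Poly} {d n : ℕ} (hM : M.IsHomogeneous d) (h : n < d)
    (A : Poly) : homogeneousComponent n (A * M) = 0 := by
  have h := DirectSum.coe_decompose_mul_of_right_mem_of_not_le (homogeneousSubmodule (Fin 3) ℂ)
    (n := n) (a := A) hM (by omega)
  simpa only [← decomposition.decompose'_apply] using! h

end

/-- Replacing arbitrary coefficients by their components of degree `n` makes them forms. -/
theorem exists_homogeneous_of_mem_span {ι : Type*} [Fintype ι] {M : ι → Poly} {d n : ℕ}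
    (hM : ∀ i, (M i).IsHomogeneous d) {g : Poly} (hg : g.IsHomogeneous (n + d))
    (h : g ∈ Ideal.span (Set.range M)) :
    ∃ A : ι → Poly, (∀ i, (A i).IsHomogeneous n) ∧ g = ∑ i, A i * M i := by
  obtain ⟨c, hc⟩ := Ideal.mem_span_range_iff_exists_fun.mp h
  refine ⟨fun i => homogeneousComponent n (c i), fun i => homogeneousComponent_isHomogeneous _ _, ?_⟩
  rw [← homogeneousComponent_eq_self hg, ← hc, map_sum]
  exact Finset.sum_congr rfl fun i _ => homogeneousComponent_add_mul (hM i) n (c i)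

/-- The ideal of a point is generated by two linear forms. -/
theorem exists_linear_forms {v : Fin 3 → ℂ} (hv : v ≠ 0) :
    ∃ M : Fin 2 → Poly, (∀ i, (M i).IsHomogeneous 1) ∧ (∀ i, eval v (M i) = 0) ∧
      ∀ (n : ℕ) (g : Poly), g.IsHomogeneous (n + 1) → eval v g = 0 →
        ∃ A : Fin 2 → Poly, (∀ i, (A i).IsHomogeneous n) ∧ g = ∑ i, A i * M i := by
  obtain ⟨k, hk⟩ := Function.ne_iff.mp hv
  rw [Pi.zero_apply] at hk
  have hM : ∀ i, (C (v k) * X (k.succAbove i) - C (v (k.succAbove i)) * X k : Poly).IsHomogeneous 1 :=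
    fun i => (isHomogeneous_C_mul_X _ _).sub (isHomogeneous_C_mul_X _ _)
  refine ⟨fun i => C (v k) * X (k.succAbove i) - C (v (k.succAbove i)) * X k, hM,
    fun i => by simp [mul_comm], fun n g hg hgv => exists_homogeneous_of_mem_span hM hg ?_⟩
  set I := Ideal.span (Set.range fun i => (C (v k) * X (k.succAbove i)
    - C (v (k.succAbove i)) * X k : Poly)) with hI
  -- Modulo `I` the coordinate vector is `X k / v k` times the constant vector `v`, so a form `g`
  -- becomes a power of `X k / v k` times `g(v) = 0`.
  have hx : ∀ i, Ideal.Quotient.mk I (X i) =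
      Ideal.Quotient.mk I (C (v k)⁻¹ * X k) * algebraMap ℂ (Poly ⧸ I) (v i) := by
    intro i
    have hC : algebraMap ℂ (Poly ⧸ I) (v i) = Ideal.Quotient.mk I (C (v i)) := rfl
    rw [hC, ← map_mul, Ideal.Quotient.eq]
    rcases Fin.eq_self_or_eq_succAbove k i with rfl | ⟨j, rfl⟩
    · have : (C (v i)⁻¹ * X i * C (v i) : Poly) = X i := by
        rw [mul_right_comm, ← C_mul, inv_mul_cancel₀ hk, C_1, one_mul]
      rw [this, sub_self]
      exact zero_mem _
    · have : (X (k.succAbove j) - C (v k)⁻¹ * X k * C (v (k.succAbove j)) : Poly) =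
          C (v k)⁻¹ * (C (v k) * X (k.succAbove j) - C (v (k.succAbove j)) * X k) := by
        rw [mul_sub, ← mul_assoc, ← C_mul, inv_mul_cancel₀ hk, C_1]
        ring
      rw [this]
      exact I.mul_mem_left _ (Ideal.subset_span ⟨j, rfl⟩)
  rw [← Ideal.Quotient.eq_zero_iff_mem]
  have h1 : Ideal.Quotient.mk I g = aeval (fun i => Ideal.Quotient.mk I (X i)) g := by
    have : (Ideal.Quotient.mkₐ ℂ I) = aeval (fun i => Ideal.Quotient.mk I (X i)) := by
      ext i : 1
      simp
    rw [← this]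
    rfl
  rw [h1, funext hx, aeval_mul_algebraMap_of_isHomogeneous hg, hgv, map_zero, mul_zero]

end PlaneCurve
-- Lines, tangency and finiteness of intersections
namespace PlaneCurve

/-- The linear form with coefficients `a`. -/
noncomputable def linForm (a : Fin 3 → ℂ) : Poly := ∑ i, C (a i) * X i

theorem linForm_isHomogeneous (a : Fin 3 → ℂ) : (linForm a).IsHomogeneous 1 :=
  IsHomogeneous.sum _ _ _ fun _ _ => isHomogeneous_C_mul_X _ _

theorem eval_linForm (a v : Fin 3 → ℂ) : eval v (linForm a) = a ⬝ᵥ v := by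
  simp [linForm, dotProduct]

theorem linForm_smul (r : ℂ) (a : Fin 3 → ℂ) : linForm (r • a) = C r * linForm a := by
  simp [linForm, Finset.mul_sum, mul_assoc]

theorem pderiv_linForm (a : Fin 3 → ℂ) (i : Fin 3) : pderiv i (linForm a) = C (a i) := by
  simp [linForm, pderiv_X, Pi.single_apply]

theorem exists_linForm {F : Poly} (hF : F.IsHomogeneous 1) : ∃ a, F = linForm a := by
  rw [← mem_homogeneousSubmodule, homogeneousSubmodule_one_eq_span_X,
    Submodule.mem_span_range_iff_exists_fun] at hF
  obtain ⟨a, rfl⟩ := hF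
  exact ⟨a, by simp [linForm, smul_eq_C_mul]⟩

/-- Representatives of distinct points are not proportional. -/
theorem cross_ne_zero {p q : Plane} (h : p ≠ q) : crossProduct p.rep q.rep ≠ 0 := by
  rw [crossProduct_ne_zero_iff_linearIndependent, LinearIndependent.pair_iff]
  intro s t hst
  have hs : s = 0 := by
    by_contra hs
    refine h ?_
    rw [← p.mk_rep, ← q.mk_rep, Projectivization.mk_eq_mk_iff']
    refine ⟨-(s⁻¹ * t), ?_⟩
    have h1 : s • p.rep = -(t • q.rep) := eq_neg_of_add_eq_zero_left hst
    rw [neg_smul, mul_smul, ← smul_neg, ← h1, smul_smul, inv_mul_cancel₀ hs, one_smul]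
  subst hs
  refine ⟨rfl, ?_⟩
  rw [zero_smul, zero_add] at hst
  exact (smul_eq_zero.mp hst).resolve_right q.rep_nonzero

theorem eq_smul_cross {u v : Fin 3 → ℂ} (h : crossProduct u v ≠ 0) {a : Fin 3 → ℂ}
    (hp : a ⬝ᵥ u = 0) (hq : a ⬝ᵥ v = 0) : ∃ r : ℂ, a = r • crossProduct u v := by
  -- The triple product expansion; a vanishing cross product means that the two vectors are
  -- dependent.
  have h0 : crossProduct a (crossProduct u v) = 0 := by
    rw [cross_cross_eq_smul_sub_smul', dotProduct_comm u, hq, hp]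
    simp
  by_contra! hcon
  refine absurd h0 (crossProduct_ne_zero_iff_linearIndependent.mpr ?_)
  rw [LinearIndependent.pair_iff]
  intro s t hst
  have hs : s = 0 := by
    by_contra hs
    refine hcon (-(s⁻¹ * t)) ?_
    have h1 : s • a = -(t • crossProduct u v) := eq_neg_of_add_eq_zero_left hst
    rw [neg_smul, mul_smul, ← smul_neg, ← h1, smul_smul, inv_mul_cancel₀ hs, one_smul]
  subst hs
  refine ⟨rfl, ?_⟩
  rw [zero_smul, zero_add] at hst
  exact (smul_eq_zero.mp hst).resolve_right h

/-- The equation of the line through two points. -/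
noncomputable def lineThrough (p q : Plane) : Poly := linForm (crossProduct p.rep q.rep)

theorem lineThrough_isHomogeneous (p q : Plane) : (lineThrough p q).IsHomogeneous 1 :=
  linForm_isHomogeneous _

theorem left_mem_lineThrough (p q : Plane) : p ∈ zeroLocus (lineThrough p q) := by
  rw [zeroLocus, Set.mem_ofPred_eq, lineThrough, eval_linForm, dotProduct_comm]
  exact dot_self_cross _ _

theorem right_mem_lineThrough (p q : Plane) : q ∈ zeroLocus (lineThrough p q) := by
  rw [zeroLocus, Set.mem_ofPred_eq, lineThrough, eval_linForm, dotProduct_comm]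
  exact dot_cross_self _ _

theorem eq_C_mul_lineThrough {p q : Plane} (h : p ≠ q) {F : Poly} (hF : F.IsHomogeneous 1)
    (hp : p ∈ zeroLocus F) (hq : q ∈ zeroLocus F) : ∃ r : ℂ, F = C r * lineThrough p q := by
  obtain ⟨a, rfl⟩ := exists_linForm hF
  rw [zeroLocus, Set.mem_ofPred_eq, eval_linForm] at hp hq
  obtain ⟨r, rfl⟩ := eq_smul_cross (cross_ne_zero h) hp hq
  exact ⟨r, linForm_smul _ _⟩

theorem zeroLocus_C_mul {r : ℂ} (hr : r ≠ 0) (F : Poly) : zeroLocus (C r * F) = zeroLocus F := by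
  ext p
  simp [zeroLocus, hr]

theorem zeroLocus_eq_of_linear {p q : Plane} (h : p ≠ q) {F : Poly} (hF : F.IsHomogeneous 1)
    (hF0 : F ≠ 0) (hp : p ∈ zeroLocus F) (hq : q ∈ zeroLocus F) :
    zeroLocus F = zeroLocus (lineThrough p q) := by
  obtain ⟨r, rfl⟩ := eq_C_mul_lineThrough h hF hp hq
  refine zeroLocus_C_mul ?_ _
  rintro rfl
  simp at hF0

theorem irreducible_of_isHomogeneous_one {F : Poly} (hF : F.IsHomogeneous 1) (hF0 : F ≠ 0) :
    Irreducible F := by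
  refine irreducible_iff.mpr ⟨fun hu => ?_, fun {a b} hab => ?_⟩
  · have h1 := hF.totalDegree hF0
    obtain ⟨r, -, rfl⟩ := isUnit_iff_eq_C_of_isReduced.mp hu
    simp at h1
  · have ha : a ≠ 0 := by rintro rfl; simp [hab] at hF0
    have hb : b ≠ 0 := by rintro rfl; simp [hab] at hF0
    have h1 := hF.totalDegree hF0
    rw [hab, totalDegree_mul_of_isDomain ha hb] at h1
    have key : ∀ a : Poly, a ≠ 0 → a.totalDegree = 0 → IsUnit a := by
      intro a ha h
      rw [totalDegree_eq_zero_iff_eq_C] at h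
      rw [h] at ha ⊢
      exact (IsUnit.mk0 _ (by simpa using ha)).map C
    rcases Nat.eq_zero_or_pos a.totalDegree with h | h
    · exact Or.inl (key a ha h)
    · exact Or.inr (key b hb (by omega))

theorem lineThrough_ne_zero {p q : Plane} (h : p ≠ q) : lineThrough p q ≠ 0 := by
  intro h0
  refine cross_ne_zero h (funext fun i => ?_)
  have := pderiv_linForm (crossProduct p.rep q.rep) i
  rw [← lineThrough, h0, map_zero] at this
  exact (C_eq_zero.mp this.symm)

/-- On the line `P = 0`, forms vanishing at the point `v` are divisible by a linear form. -/
theorem exists_local_parameter {P : Poly} (hP : P.IsHomogeneous 1) (hP0 : P ≠ 0) {v : Fin 3 → ℂ}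
    (hv : v ≠ 0) (hPv : eval v P = 0) :
    ∃ M : Poly, M.IsHomogeneous 1 ∧ eval v M = 0 ∧
      ∀ (n : ℕ) (g : Poly), g.IsHomogeneous (n + 1) → eval v g = 0 →
        ∃ g' B : Poly, g'.IsHomogeneous n ∧ B.IsHomogeneous n ∧ g = g' * M + B * P := by
  obtain ⟨M, hM, hMv, hgen⟩ := exists_linear_forms hv
  obtain ⟨c, hc, hPc⟩ := hgen 0 P hP hPv
  choose r hr using fun i => exists_C_of_isHomogeneous_zero (hc i)
  rw [Fin.sum_univ_two, hr 0, hr 1] at hPc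
  -- Where `P` has a nonzero coefficient, the generator `M i` can be eliminated in favour of `P`;
  -- the other one, `M j`, is the parameter on the line.
  have key : ∀ i j : Fin 2, P = C (r i) * M i + C (r j) * M j → r i ≠ 0 →
      (∀ A : Fin 2 → Poly, ∑ k, A k * M k = A i * M i + A j * M j) →
      ∃ M : Poly, M.IsHomogeneous 1 ∧ eval v M = 0 ∧
      ∀ (n : ℕ) (g : Poly), g.IsHomogeneous (n + 1) → eval v g = 0 →
        ∃ g' B : Poly, g'.IsHomogeneous n ∧ B.IsHomogeneous n ∧ g = g' * M + B * P := by
    intro i j hP hi hs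
    refine ⟨M j, hM j, hMv j, fun n g hg hgv => ?_⟩
    obtain ⟨A, hA, rfl⟩ := hgen n g hg hgv
    refine ⟨A j - C ((r i)⁻¹ * r j) * A i, C (r i)⁻¹ * A i, (hA j).sub ((hA i).C_mul _),
      (hA i).C_mul _, ?_⟩
    rw [hs, hP]
    have h1 : (C (r i)⁻¹ * C (r i) : Poly) = 1 := by rw [← C_mul, inv_mul_cancel₀ hi, C_1]
    rw [C_mul]
    linear_combination (-(A i) * M i) * h1
  by_cases h0 : r 0 = 0
  · have h1 : r 1 ≠ 0 := by
      intro h1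
      simp [h0, h1] at hPc
      exact hP0 hPc
    exact key 1 0 (by rw [hPc, add_comm]) h1 fun A => by rw [Fin.sum_univ_two, add_comm]
  · exact key 0 1 hPc h0 fun A => by rw [Fin.sum_univ_two]

/-- The gradient of a form at a point. -/
noncomputable def grad (F : Poly) (v : Fin 3 → ℂ) : Fin 3 → ℂ := fun i => eval v (pderiv i F)

theorem grad_mul_of_eval_eq_zero {F G : Poly} {v : Fin 3 → ℂ} (h : eval v G = 0) :
    grad (F * G) v = eval v F • grad G v := by
  ext i
  simp [grad, h]

theorem grad_add (F G : Poly) (v : Fin 3 → ℂ) : grad (F + G) v = grad F v + grad G v := by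
  ext i
  simp [grad]

/-- A curve of degree at least two meeting a line in one point only is tangent to it there. -/
theorem grad_eq_smul_of_forall_eq {P F : Poly} (hP : P.IsHomogeneous 1) (hP0 : P ≠ 0) {n : ℕ}
    (hF : F.IsHomogeneous n) (hn : 2 ≤ n) {p : Plane} (hpP : p ∈ zeroLocus P)
    (hpF : p ∈ zeroLocus F) (h : ∀ q, q ∈ zeroLocus P → q ∈ zeroLocus F → q = p) :
    ∃ r : ℂ, grad F p.rep = r • grad P p.rep := by
  obtain ⟨M, hM, hMv, hgen⟩ := exists_local_parameter hP hP0 p.rep_nonzero hpP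
  obtain ⟨m, rfl⟩ : ∃ m, n = m + 1 := ⟨n - 1, by omega⟩
  obtain ⟨g, B, hg, hB, rfl⟩ := hgen m F hF hpF
  -- The cofactor `g` has degree `m ≥ 1`, so it vanishes somewhere on the line. That point lies on
  -- the curve too, hence is `p`, and `g * M` contributes nothing to the gradient at `p`.
  obtain ⟨q, hq1, hq2⟩ := exists_mem_zeroLocus_inter hP le_rfl hg (by omega)
  have hqp : q = p := by
    refine h q hq1 ?_
    rw [zeroLocus, Set.mem_ofPred_eq] at *
    simp [hq1, hq2]
  subst hqp
  refine ⟨eval q.rep B, ?_⟩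
  rw [grad_add, grad_mul_of_eval_eq_zero hMv, grad_mul_of_eval_eq_zero hpP, hq2, zero_smul, zero_add]

/-- A line meets a curve not containing it in finitely many points. -/
theorem finite_inter_of_not_dvd {P : Poly} (hP : P.IsHomogeneous 1) (hP0 : P ≠ 0) :
    ∀ (n : ℕ) (F : Poly), F.IsHomogeneous n → ¬ P ∣ F → (zeroLocus P ∩ zeroLocus F).Finite := by
  intro n
  induction n with
  | zero =>
    intro F hF hPF
    obtain ⟨r, rfl⟩ := exists_C_of_isHomogeneous_zero hF
    have hr : r ≠ 0 := by rintro rfl; simp at hPF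
    convert Set.finite_empty
    ext q
    simp [zeroLocus, hr]
  | succ n ih =>
    intro F hF hPF
    by_cases hne : (zeroLocus P ∩ zeroLocus F).Nonempty
    · obtain ⟨p, hpP, hpF⟩ := hne
      obtain ⟨M, hM, hMv, hgen⟩ := exists_local_parameter hP hP0 p.rep_nonzero hpP
      obtain ⟨g, B, hg, hB, rfl⟩ := hgen n F hF hpF
      -- Apart from `p`, the intersection consists of zeros of `g`, of smaller degree: a second zero
      -- of `M` on the line would make `P` divide `M`.
      have hPg : ¬ P ∣ g := fun hd => hPF (dvd_add (hd.mul_right M) (dvd_mul_left P B))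
      refine ((ih g hg hPg).union (Set.finite_singleton p)).subset ?_
      rintro q ⟨hq, hqF⟩
      by_contra hcon
      simp only [Set.mem_union, Set.mem_inter_iff, hq, true_and, Set.mem_singleton_iff,
        not_or] at hcon
      obtain ⟨hqg, hqp⟩ := hcon
      have hqM : q ∈ zeroLocus M := by
        rw [zeroLocus, Set.mem_ofPred_eq] at *
        simpa [hq, hqg] using hqF
      obtain ⟨r, hr⟩ := eq_C_mul_lineThrough hqp hP hq hpP
      obtain ⟨s, hs⟩ := eq_C_mul_lineThrough hqp hM hqM hMv
      refine hPF (dvd_add (Dvd.dvd.mul_left ?_ g) (dvd_mul_left P B))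
      have hr0 : r ≠ 0 := by rintro rfl; simp at hr; exact hP0 hr
      refine ⟨C (r⁻¹ * s), ?_⟩
      have h1 : (C r⁻¹ * C r : Poly) = 1 := by rw [← C_mul, inv_mul_cancel₀ hr0, C_1]
      rw [hs, hr, C_mul]
      linear_combination (-C s * lineThrough q p) * h1
    · rw [Set.not_nonempty_iff_eq_empty.mp hne]
      exact Set.finite_empty

end PlaneCurve
-- Functions integral at all points of the curve are constant
namespace PlaneCurve

instance isDomain_coordRing (P : Poly) [h : Fact (Irreducible P)] : IsDomain (CoordRing P) := by
  have : (Ideal.span {P}).IsPrime :=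
    (Ideal.span_singleton_prime h.out.ne_zero).mpr h.out.prime
  infer_instance

/-- `toFrac` as an algebra homomorphism. -/
noncomputable def toFracHom (P : Poly) : Poly →ₐ[ℂ] FractionRing (CoordRing P) :=
  (IsScalarTower.toAlgHom ℂ (CoordRing P) (FractionRing (CoordRing P))).comp
    (Ideal.Quotient.mkₐ ℂ (Ideal.span {P}))

theorem toFracHom_apply (P g : Poly) : toFracHom P g = toFrac P g := rfl

theorem toFrac_sum (P : Poly) {ι : Type*} (s : Finset ι) (f : ι → Poly) :
    toFrac P (∑ i ∈ s, f i) = ∑ i ∈ s, toFrac P (f i) := map_sum (toFracHom P) f s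

theorem toFrac_pow (P g : Poly) (n : ℕ) : toFrac P (g ^ n) = toFrac P g ^ n :=
  map_pow (toFracHom P) g n

theorem toFrac_zero (P : Poly) : toFrac P 0 = 0 := map_zero (toFracHom P)

theorem toFrac_eq_zero_iff {P g : Poly} : toFrac P g = 0 ↔ P ∣ g := by
  rw [toFrac, map_eq_zero_iff _ (IsFractionRing.injective _ _), Ideal.Quotient.eq_zero_iff_mem,
    Ideal.mem_span_singleton]

theorem toFrac_ne_zero_of_eval_ne_zero {P g : Poly} {v : Fin 3 → ℂ} (hv : eval v P = 0)
    (hg : eval v g ≠ 0) : toFrac P g ≠ 0 := by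
  rw [Ne, toFrac_eq_zero_iff]
  rintro ⟨k, rfl⟩
  simp [hv] at hg

theorem eval_eq_of_toFrac_eq {P g h : Poly} {v : Fin 3 → ℂ} (hv : eval v P = 0)
    (hgh : toFrac P g = toFrac P h) : eval v g = eval v h := by
  have : toFrac P (g - h) = 0 := by
    rw [← toFracHom_apply, map_sub, toFracHom_apply, toFracHom_apply, hgh, sub_self]
  obtain ⟨k, hk⟩ := toFrac_eq_zero_iff.mp this
  have := congrArg (eval v) hk
  simpa [hv, sub_eq_zero] using this

/-- Finitely many elements of the local ring have a common denominator. -/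
theorem exists_common_denominator {P : Poly} {p : Plane} {ι : Type*} (s : Finset ι)
    (z : ι → FractionRing (CoordRing P)) (hz : ∀ i ∈ s, z i ∈ localRing P p) :
    ∃ (n : ℕ) (H : Poly), H.IsHomogeneous n ∧ eval p.rep H ≠ 0 ∧
      ∀ i ∈ s, ∃ g : Poly, g.IsHomogeneous n ∧ z i * toFrac P H = toFrac P g := by
  classical
  induction s using Finset.induction_on with
  | empty => exact ⟨0, 1, isHomogeneous_one _ _, by simp, by simp⟩
  | insert a s ha ih =>
    obtain ⟨n, H, hH, hH0, hs⟩ := ih fun i hi => hz i (Finset.mem_insert_of_mem hi)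
    obtain ⟨m, g, h, hg, hh, hh0, hgh⟩ := hz a (Finset.mem_insert_self a s)
    refine ⟨n + m, H * h, hH.mul hh, by simp [hH0, hh0], fun i hi => ?_⟩
    rcases Finset.mem_insert.mp hi with rfl | hi
    · exact ⟨H * g, hH.mul hg, by rw [toFrac_mul, toFrac_mul, ← hgh]; ring⟩
    · obtain ⟨g', hg', hz'⟩ := hs i hi
      exact ⟨g' * h, hg'.mul hh, by rw [toFrac_mul, toFrac_mul, ← hz']; ring⟩

/-- The span of all `s φ ^ j` with `s` homogeneous of degree `n` and `j < k`. -/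
noncomputable def powerSpan (P : Poly) (φ : FractionRing (CoordRing P)) (k n : ℕ) :
    Submodule ℂ (FractionRing (CoordRing P)) :=
  ⨆ j ∈ Finset.range k, (homogeneousSubmodule (Fin 3) ℂ n).map
    ((LinearMap.mulLeft ℂ (φ ^ j)).comp (toFracHom P).toLinearMap)

theorem powerSpan_fg (P : Poly) (φ : FractionRing (CoordRing P)) (k n : ℕ) :
    (powerSpan P φ k n).FG :=
  Submodule.fg_biSup _ _ fun _ _ => (homogeneousSubmodule_fg (Fin 3) ℂ n).map _

theorem mul_mem_powerSpan {P : Poly} (φ : FractionRing (CoordRing P)) {k n j : ℕ} (hj : j < k)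
    {s : Poly} (hs : s.IsHomogeneous n) : φ ^ j * toFrac P s ∈ powerSpan P φ k n :=
  (le_iSup₂_of_le (f := fun j (_ : j ∈ Finset.range k) => (homogeneousSubmodule (Fin 3) ℂ n).map
    ((LinearMap.mulLeft ℂ (φ ^ j)).comp (toFracHom P).toLinearMap)) j (Finset.mem_range.mpr hj)
      le_rfl) ⟨s, hs, rfl⟩

theorem powerSpan_le {P : Poly} {φ : FractionRing (CoordRing P)} {k n : ℕ}
    {W : Submodule ℂ (FractionRing (CoordRing P))}
    (h : ∀ j < k, ∀ s : Poly, s.IsHomogeneous n → φ ^ j * toFrac P s ∈ W) :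
    powerSpan P φ k n ≤ W := by
  refine iSup₂_le fun j hj => ?_
  rintro _ ⟨s, hs, rfl⟩
  exact h j (Finset.mem_range.mp hj) s hs

theorem powerSpan_mul {P : Poly} {φ : FractionRing (CoordRing P)} {k n m : ℕ} {r : Poly}
    (hr : r.IsHomogeneous m) {x : FractionRing (CoordRing P)} (hx : x ∈ powerSpan P φ k n) :
    toFrac P r * x ∈ powerSpan P φ k (n + m) := by
  refine (powerSpan_le (W := (powerSpan P φ k (n + m)).comap (LinearMap.mulLeft ℂ (toFrac P r)))
    fun j hj s hs => ?_) hx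
  have := mul_mem_powerSpan φ hj (hs.mul hr)
  rw [toFrac_mul] at this
  rw [Submodule.mem_comap, LinearMap.mulLeft_apply]
  convert this using 1
  ring

theorem powerSpan_succ {P : Poly} {φ : FractionRing (CoordRing P)} {k n : ℕ}
    {x : FractionRing (CoordRing P)} (hx : x ∈ powerSpan P φ k n) :
    φ * x ∈ powerSpan P φ (k + 1) n := by
  refine (powerSpan_le (W := (powerSpan P φ (k + 1) n).comap (LinearMap.mulLeft ℂ φ))
    fun j hj s hs => ?_) hx
  have := mul_mem_powerSpan φ (Nat.succ_lt_succ hj) hs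
  rw [pow_succ] at this
  rw [Submodule.mem_comap, LinearMap.mulLeft_apply]
  convert this using 1
  ring

/-- The form `s` of degree `n` clears denominators in an integral equation of degree `k`. -/
def Clears (P : Poly) (φ : FractionRing (CoordRing P)) (n : ℕ) (s : Poly) : Prop :=
  ∃ k0, ∀ k, k0 ≤ k → φ ^ k * toFrac P s ∈ powerSpan P φ k n

/-- Multiplication by `φ` turns a relation for `l` into one for `l + 1`. Finitely many clearing
forms can therefore share one exponent. -/
theorem Clears.of_mem {P : Poly} {φ : FractionRing (CoordRing P)} {n k : ℕ} {s : Poly}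
    (h : φ ^ k * toFrac P s ∈ powerSpan P φ k n) : Clears P φ n s := by
  refine ⟨k, fun l hl => ?_⟩
  induction l, hl using Nat.le_induction with
  | base => exact h
  | succ l hl ih =>
    have := powerSpan_succ ih
    rwa [← mul_assoc, ← pow_succ'] at this

theorem Clears.add {P : Poly} {φ : FractionRing (CoordRing P)} {n : ℕ} {s t : Poly}
    (hs : Clears P φ n s) (ht : Clears P φ n t) : Clears P φ n (s + t) := by
  obtain ⟨k, hk⟩ := hs
  obtain ⟨l, hl⟩ := ht
  refine ⟨max k l, fun m hm => ?_⟩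
  rw [toFrac_add, mul_add]
  exact add_mem (hk m (le_of_max_le_left hm)) (hl m (le_of_max_le_right hm))

theorem Clears.zero (P : Poly) (φ : FractionRing (CoordRing P)) (n : ℕ) : Clears P φ n 0 :=
  ⟨0, fun k _ => by rw [toFrac_zero, mul_zero]; exact zero_mem _⟩

theorem Clears.mul {P : Poly} {φ : FractionRing (CoordRing P)} {n m : ℕ} {s r : Poly}
    (hs : Clears P φ n s) (hr : r.IsHomogeneous m) : Clears P φ (n + m) (r * s) := by
  obtain ⟨k, hk⟩ := hs
  refine ⟨k, fun l hl => ?_⟩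
  have := powerSpan_mul hr (hk l hl)
  rw [toFrac_mul]
  convert this using 1
  ring

/-- If denominators can be cleared by forms without common zero on the curve, then by all forms of
large degree. -/
theorem exists_clears_X_pow {P : Poly} {φ : FractionRing (CoordRing P)} {d : ℕ}
    (hPd : P.IsHomogeneous d)
    (h : ∀ p ∈ zeroLocus P, ∃ (n : ℕ) (s : Poly), s.IsHomogeneous n ∧ eval p.rep s ≠ 0 ∧
      Clears P φ n s) (i : Fin 3) : ∃ N, Clears P φ N (X i ^ N) := by
  set S : Set Poly := {s | ∃ n, s.IsHomogeneous n ∧ Clears P φ n s} with hS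
  -- The class of `P` is zero, so `P` clears trivially. This puts the common zeros of `S` on the
  -- curve, where the hypothesis leaves only the origin, as the Nullstellensatz requires.
  have hPS : P ∈ S := by
    refine ⟨d, hPd, 0, fun k _ => ?_⟩
    rw [toFrac_eq_zero_iff.mpr dvd_rfl, mul_zero]
    exact zero_mem _
  have hzero : (X i : Poly) ∈ (Ideal.span S).radical := by
    rw [← vanishingIdeal_zeroLocus_eq_radical (k := ℂ) (K := ℂ), zeroLocus_span,
      mem_vanishingIdeal_iff]
    intro v hv
    have hv' : ∀ s ∈ S, eval v s = 0 := hv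
    by_cases hv0 : v = 0
    · simp [hv0]
    · exfalso
      obtain ⟨n, s, hs, hs0, hsc⟩ := h (.mk ℂ v hv0)
        ((mk_mem_zeroLocus_iff hPd hv0).mpr (hv' P hPS))
      exact hs0 ((mk_mem_zeroLocus_iff hs hv0).mpr (hv' s ⟨n, hs, hsc⟩))
  obtain ⟨N, hN⟩ := hzero
  refine ⟨N, ?_⟩
  -- Clearing is stable under sums within a degree and under multiplication by forms, so it passes
  -- to the components of every element of the ideal.
  have key : ∀ x ∈ Ideal.span S, ∀ N, Clears P φ N (homogeneousComponent N x) := by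
    intro x hx
    induction hx using Submodule.span_induction with
    | mem x hx =>
      intro N
      obtain ⟨n, hn, hc⟩ := hx
      by_cases hNn : N = n
      · subst hNn
        rwa [homogeneousComponent_eq_self hn]
      · rw [homogeneousComponent_of_mem hn, if_neg hNn]
        exact Clears.zero _ _ _
    | zero => intro N; rw [map_zero]; exact Clears.zero _ _ _
    | add x y _ _ hx hy => intro N; rw [map_add]; exact (hx N).add (hy N)
    | smul a x _ hx =>
      intro N
      induction a using MvPolynomial.induction_on' with
      | monomial m r =>
        have hm : (monomial m r : Poly).IsHomogeneous m.degree := isHomogeneous_monomial r rfl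
        rw [smul_eq_mul, mul_comm]
        by_cases hle : m.degree ≤ N
        · obtain ⟨l, rfl⟩ := Nat.exists_eq_add_of_le' hle
          rw [homogeneousComponent_add_mul hm, mul_comm]
          exact (hx l).mul hm
        · rw [homogeneousComponent_mul_of_lt hm (by omega)]
          exact Clears.zero _ _ _
      | add a b ha hb => rw [add_smul, map_add]; exact ha.add hb
  have := key _ hN N
  rwa [homogeneousComponent_eq_self (isHomogeneous_X_pow i N)] at this

/-- A rational function on an integral projective curve which is integral over all local rings is
constant. -/
theorem exists_eq_algebraMap_of_forall_isIntegral {P : Poly} [hP : Fact (Irreducible P)] {d : ℕ}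
    (hPd : P.IsHomogeneous d) {φ : FractionRing (CoordRing P)}
    (h : ∀ p ∈ zeroLocus P, IsIntegral (localRing P p) φ) :
    ∃ r : ℂ, φ = algebraMap ℂ _ r := by
  have h1 : ∀ p ∈ zeroLocus P, ∃ (n : ℕ) (s : Poly), s.IsHomogeneous n ∧ eval p.rep s ≠ 0 ∧
      Clears P φ n s := by
    intro p hp
    obtain ⟨f, hf, hf0⟩ := h p hp
    obtain ⟨n, H, hH, hH0, hg⟩ := exists_common_denominator (P := P) (p := p)
      (Finset.range f.natDegree) (fun j => (f.coeff j : FractionRing (CoordRing P)))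
      fun j _ => (f.coeff j).2
    refine ⟨n, H, hH, hH0, Clears.of_mem (k := f.natDegree) ?_⟩
    -- Multiplied by the common denominator `H`, the monic equation expresses `φ ^ f.natDegree * H`
    -- by lower powers of `φ` whose coefficients are forms of degree `n`.
    have h2 : φ ^ f.natDegree =
        - ∑ j ∈ Finset.range f.natDegree, (f.coeff j : FractionRing (CoordRing P)) * φ ^ j := by
      rw [Polynomial.eval₂_eq_sum_range, Finset.sum_range_succ, hf.coeff_natDegree, map_one,
        one_mul] at hf0
      exact eq_neg_of_add_eq_zero_right hf0
    rw [h2, neg_mul, Finset.sum_mul]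
    refine neg_mem (sum_mem fun j hj => ?_)
    obtain ⟨g, hg, hgz⟩ := hg j hj
    have := mul_mem_powerSpan φ (Finset.mem_range.mp hj) hg
    rw [← hgz] at this
    convert this using 1
    ring
  have hd := one_le_of_irreducible hPd hP.out
  choose N hN using exists_clears_X_pow hPd h1
  choose K hK using hN
  -- Pigeonhole: a monomial of this degree has some exponent at least `N i`, hence is a multiple of
  -- the clearing form `X i ^ N i`.
  set n := ∑ i, N i with hn
  -- The sum dominates each `K i`; the extra one admits the power `φ ^ 0`, which makes the span
  -- nonzero.
  set k := (∑ i, K i) + 1 with hk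
  have h3 : ∀ s : Poly, s.IsHomogeneous n → φ ^ k * toFrac P s ∈ powerSpan P φ k n := by
    intro s hs
    rw [s.as_sum, toFrac_sum, Finset.mul_sum]
    refine sum_mem fun m hm => ?_
    have hmn : m.degree = n := by
      by_contra hne
      exact mem_support_iff.mp hm (hs.coeff_eq_zero hne)
    obtain ⟨i, hi⟩ : ∃ i, N i ≤ m i := by
      by_contra! hcon
      have : ∑ i, m i < ∑ i, N i := Finset.sum_lt_sum_of_nonempty Finset.univ_nonempty
        fun i _ => hcon i
      rw [← Finsupp.degree_eq_sum] at this
      omega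
    have hle : Finsupp.single i (N i) ≤ m := by simpa using hi
    have hfac : (monomial m (coeff m s) : Poly) =
        monomial (m - Finsupp.single i (N i)) (coeff m s) * X i ^ N i := by
      rw [X_pow_eq_monomial, monomial_mul, mul_one, tsub_add_cancel_of_le hle]
    have hdeg : (m - Finsupp.single i (N i)).degree + N i = n := by
      have := congrArg Finsupp.degree (tsub_add_cancel_of_le hle)
      simpa [hmn] using this
    have hki : K i ≤ k := by
      have := Finset.single_le_sum (f := K) (fun j _ => Nat.zero_le _) (Finset.mem_univ i)
      omega
    have := powerSpan_mul (isHomogeneous_monomial (coeff m s) rfl :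
      (monomial (m - Finsupp.single i (N i)) (coeff m s) : Poly).IsHomogeneous _) (hK i k hki)
    rw [show N i + (m - Finsupp.single i (N i)).degree = n by omega] at this
    rw [hfac, toFrac_mul]
    convert this using 1
    ring
  -- Multiplication by `φ` preserves the nonzero finite-dimensional space `powerSpan P φ k n`, since
  -- `h3` brings the power `φ ^ k` back into it.
  have hint : IsIntegral ℂ φ := by
    refine isIntegral_of_smul_mem_submodule (powerSpan P φ k n) ?_ (powerSpan_fg P φ k n) φ ?_
    · obtain ⟨i, hi⟩ : ∃ i : Fin 3, ¬ P ∣ X i := by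
        by_contra! hcon
        obtain ⟨p, hp, -⟩ := exists_mem_zeroLocus_inter hPd hd hPd hd
        refine p.rep_nonzero (funext fun i => ?_)
        obtain ⟨g, hg⟩ := hcon i
        have := congrArg (eval p.rep) hg
        rw [map_mul, show eval p.rep P = 0 from hp] at this
        simpa using this
      intro hbot
      have hmem := mul_mem_powerSpan φ (k := k) (n := n) (j := 0) (by omega) (isHomogeneous_X_pow i n)
      rw [hbot, Submodule.mem_bot, pow_zero, one_mul, toFrac_eq_zero_iff] at hmem
      exact hi (hP.out.prime.dvd_of_dvd_pow hmem)
    · intro x hx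
      rw [smul_eq_mul]
      refine (powerSpan_le (W := (powerSpan P φ k n).comap (LinearMap.mulLeft ℂ φ))
        fun j hj s hs => ?_) hx
      rw [Submodule.mem_comap, LinearMap.mulLeft_apply, ← mul_assoc, ← pow_succ']
      rcases Nat.lt_or_ge (j + 1) k with hjk | hjk
      · exact mul_mem_powerSpan φ hjk hs
      · rw [show j + 1 = k by omega]
        exact h3 s hs
  have hdeg := IsAlgClosed.degree_eq_one_of_irreducible ℂ (minpoly.irreducible hint)
  obtain ⟨r, hr⟩ := minpoly.mem_range_of_degree_eq_one ℂ φ hdeg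
  exact ⟨r, hr.symm⟩

end PlaneCurve
-- Algebraic dependence of rational functions, and a valuation criterion
namespace PlaneCurve

/-- The exponents of degree `n`. -/
noncomputable def expts (n : ℕ) : Finset (Fin 3 →₀ ℕ) := Finset.univ.finsuppAntidiag n

theorem mem_expts {n : ℕ} {m : Fin 3 →₀ ℕ} : m ∈ expts n ↔ m.degree = n := by
  simp [expts, Finset.mem_finsuppAntidiag, Finsupp.degree_eq_sum]

theorem two_mul_card_expts (n : ℕ) : 2 * (expts n).card = (n + 2) * (n + 1) := by
  rw [expts, Finset.card_finsuppAntidiag_nat_eq_choose, Finset.card_univ, Fintype.card_fin,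
    show 3 + n - 1 = n + 2 by omega, Nat.choose_symm_add, Nat.choose_two_right,
    Nat.mul_div_cancel' (Nat.even_mul_pred_self _).two_dvd]
  rfl

theorem finrank_homogeneousSubmodule (n : ℕ) :
    Module.finrank ℂ (homogeneousSubmodule (Fin 3) ℂ n) = (expts n).card := by
  have h : {m : Fin 3 →₀ ℕ | m.degree = n} = (expts n : Set (Fin 3 →₀ ℕ)) := by
    ext m
    simp [mem_expts]
  rw [homogeneousSubmodule_eq_finsupp_supported, h]
  exact (Module.finrank_eq_nat_card_basis (basisRestrictSupport ℂ _)).trans (by simp)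

instance (n : ℕ) : Module.Finite ℂ (homogeneousSubmodule (Fin 3) ℂ n) :=
  Module.Finite.iff_fg.mpr (homogeneousSubmodule_fg _ _ n)

/-- The multiples of `P` lie in the kernel of `f`. For `n ≥ d` this leaves at most the difference of
the dimensions of the forms of degrees `n` and `n - d`, which grows only linearly in `n`. -/
theorem finrank_map_le {E : Type*} [AddCommGroup E] [Module ℂ E] (f : Poly →ₗ[ℂ] E) {P : Poly}
    {d : ℕ} (hPd : P.IsHomogeneous d) (hP0 : P ≠ 0) (hd : 1 ≤ d) (hf : ∀ g, f (P * g) = 0) (n : ℕ) :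
    Module.finrank ℂ ((homogeneousSubmodule (Fin 3) ℂ n).map f) ≤ d * (n + 2) := by
  have hrn := LinearMap.finrank_range_add_finrank_ker (f.domRestrict (homogeneousSubmodule (Fin 3) ℂ n))
  rw [LinearMap.range_domRestrict, finrank_homogeneousSubmodule] at hrn
  have h2 := two_mul_card_expts n
  rcases Nat.lt_or_ge n d with hnd | hnd
  · nlinarith
  · obtain ⟨k, rfl⟩ := Nat.exists_eq_add_of_le' hnd
    let g : homogeneousSubmodule (Fin 3) ℂ k →ₗ[ℂ]
        LinearMap.ker (f.domRestrict (homogeneousSubmodule (Fin 3) ℂ (k + d))) :=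
      LinearMap.codRestrict _ (LinearMap.codRestrict _
        ((LinearMap.mulRight ℂ P).domRestrict _) (fun x => x.2.mul hPd))
        (fun x => by
          rw [LinearMap.mem_ker]
          change f (x * P) = 0
          rw [mul_comm, hf])
    have hg : Function.Injective g := by
      intro x y hxy
      have : (x : Poly) * P = y * P := congrArg (fun z : LinearMap.ker (f.domRestrict
        (homogeneousSubmodule (Fin 3) ℂ (k + d))) => (z.1 : Poly)) hxy
      exact Subtype.ext (mul_right_cancel₀ hP0 this)
    have h3 := LinearMap.finrank_le_finrank_of_injective hg
    rw [finrank_homogeneousSubmodule] at h3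
    have h4 := two_mul_card_expts k
    nlinarith

/-- Two rational functions on a plane curve are algebraically dependent. -/
theorem exists_algebraic_relation {P : Poly} [hP : Fact (Irreducible P)] {d : ℕ}
    (hPd : P.IsHomogeneous d) {t u : FractionRing (CoordRing P)} (ht : t ∈ functionField P)
    (hu : u ∈ functionField P) : ∃ (n : ℕ) (c : Fin (n + 1) × Fin (n + 1) → ℂ), c ≠ 0 ∧
      ∑ k, c k • (t ^ (k.1 : ℕ) * u ^ (k.2 : ℕ)) = 0 := by
  have hd := one_le_of_irreducible hPd hP.out
  obtain ⟨e₁, g₁, h₁, hg₁, hh₁, hn₁, ht⟩ := ht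
  obtain ⟨e₂, g₂, h₂, hg₂, hh₂, hn₂, hu⟩ := hu
  set e := e₁ + e₂ with he
  -- With this choice the `(n + 1) ^ 2` products `t ^ i * u ^ j` outnumber the dimension of the
  -- forms of degree `2 * n * e` on the curve, among which they lie after multiplication by `(h₁ *
  -- h₂) ^ (2 * n)`.
  set n := 2 * d * e + 2 * d with hn
  have hle : d * ((e * (2 * n)) + 2) < (n + 1) * (n + 1) := by
    have : 2 * d ≤ n := by omega
    nlinarith
  have hh0 : toFrac P (h₁ * h₂) ^ (2 * n) ≠ 0 := by
    rw [toFrac_mul]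
    exact pow_ne_zero _ (mul_ne_zero (nonZeroDivisors.ne_zero hn₁) (nonZeroDivisors.ne_zero hn₂))
  set W := (homogeneousSubmodule (Fin 3) ℂ (e * (2 * n))).map (toFracHom P).toLinearMap with hW
  have hWd : Module.finrank ℂ W ≤ d * ((e * (2 * n)) + 2) :=
    finrank_map_le _ hPd hP.out.ne_zero hd
      (fun g => by
        rw [AlgHom.toLinearMap_apply, toFracHom_apply, toFrac_eq_zero_iff]
        exact dvd_mul_right _ _) _
  have hmem : ∀ k : Fin (n + 1) × Fin (n + 1),
      toFrac P (h₁ * h₂) ^ (2 * n) * (t ^ (k.1 : ℕ) * u ^ (k.2 : ℕ)) ∈ W := by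
    rintro ⟨⟨i, hi⟩, ⟨j, hj⟩⟩
    have hT : t * toFrac P (h₁ * h₂) = toFrac P (g₁ * h₂) := by
      rw [toFrac_mul, toFrac_mul, ← ht]; ring
    have hU : u * toFrac P (h₁ * h₂) = toFrac P (h₁ * g₂) := by
      rw [toFrac_mul, toFrac_mul, ← hu]; ring
    refine ⟨(h₁ * h₂) ^ (2 * n - i - j) * ((g₁ * h₂) ^ i * (h₁ * g₂) ^ j), ?_, ?_⟩
    · have := ((hh₁.mul hh₂).pow (2 * n - i - j)).mul
        (((hg₁.mul hh₂).pow i).mul ((hh₁.mul hg₂).pow j))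
      rw [← mul_add, ← mul_add, ← he] at this
      rwa [show 2 * n - i - j + (i + j) = 2 * n by omega] at this
    · change toFrac P _ = _
      rw [toFrac_mul, toFrac_mul P (_ ^ i), toFrac_pow, toFrac_pow, toFrac_pow, ← hT, ← hU,
        mul_pow, mul_pow]
      have hsplit : toFrac P (h₁ * h₂) ^ (2 * n) =
          toFrac P (h₁ * h₂) ^ (2 * n - i - j) * toFrac P (h₁ * h₂) ^ i * toFrac P (h₁ * h₂) ^ j := by
        rw [← pow_add, ← pow_add]
        congr 1
        omega
      rw [hsplit]
      ring
  have hdep : ¬ LinearIndependent ℂ fun k : Fin (n + 1) × Fin (n + 1) => (⟨_, hmem k⟩ : W) := by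
    intro hli
    have := hli.fintype_card_le_finrank
    simp only [Fintype.card_prod, Fintype.card_fin] at this
    omega
  obtain ⟨c, hc, i, hi⟩ := Fintype.not_linearIndependent_iff.mp hdep
  refine ⟨n, c, fun h0 => hi (congrFun h0 i), ?_⟩
  have h1 := congrArg (fun x : W => (x : FractionRing (CoordRing P))) hc
  simp only [AddSubmonoidClass.coe_finsetSum, SetLike.val_smul, ZeroMemClass.coe_zero] at h1
  refine (mul_eq_zero.mp ?_).resolve_left hh0
  rw [Finset.mul_sum, ← h1]
  exact Finset.sum_congr rfl fun k _ => by rw [mul_smul_comm]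

/-- A unit of a quotient field satisfying an equation with a unit coefficient over a local
integrally closed ring lies in the ring or has its inverse there. -/
theorem mem_or_mem_of_unit_coeff {k E : Type*} [Field k] [CommRing E] [Algebra k E]
    (A : Subalgebra k E) [IsLocalRing A] {u w : E} (huw : u * w = 1)
    (hA : ∀ a ∈ A, IsIntegral A (a * u) → a * u ∈ A) (n : ℕ) :
    ∀ a : ℕ → A, ∑ i ∈ Finset.range (n + 1), (a i : E) * u ^ i = 0 → (∃ i ≤ n, IsUnit (a i)) →
      u ∈ A ∨ w ∈ A := by
  induction n with
  | zero =>
    rintro a ha ⟨i, hi, hu⟩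
    obtain rfl : i = 0 := by omega
    have : a 0 = 0 := by
      ext
      simpa using ha
    rw [this] at hu
    exact absurd hu not_isUnit_zero
  | succ n ih =>
    rintro a ha ⟨i, hi, hu⟩
    -- The leading coefficient times a root is integral, hence in `A`. If this product is a unit, it
    -- yields `w`; otherwise it is absorbed into the next coefficient, which lowers the degree.
    have hb : (a (n + 1) : E) * u ∈ A := by
      refine hA _ (a (n + 1)).2 ?_
      by_cases h0 : a (n + 1) = 0
      · rw [h0, ZeroMemClass.coe_zero, zero_mul]
        exact isIntegral_zero
      · set p : Polynomial A := ∑ i ∈ Finset.range (n + 2), Polynomial.C (a i) * Polynomial.X ^ i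
          with hp
        have hcoeff : ∀ j, p.coeff j = if j < n + 2 then a j else 0 := by
          intro j
          simp [hp, Polynomial.finsetSum_coeff, Polynomial.coeff_X_pow]
        have hlead : p.leadingCoeff = a (n + 1) := by
          have hdeg : p.natDegree = n + 1 := by
            refine Polynomial.natDegree_eq_of_le_of_coeff_ne_zero ?_ ?_
            · refine Polynomial.natDegree_le_iff_coeff_eq_zero.mpr fun N hN => ?_
              rw [hcoeff, if_neg (by omega)]
            · rw [hcoeff, if_pos (by omega)]
              exact h0
          rw [Polynomial.leadingCoeff, hdeg, hcoeff, if_pos (by omega)]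
        have := isIntegral_leadingCoeff_smul p u (by
          rw [hp, map_sum, ← ha]
          refine Finset.sum_congr rfl fun i _ => ?_
          rw [map_mul, Polynomial.aeval_C, map_pow, Polynomial.aeval_X]
          rfl)
        rw [hlead] at this
        exact this
    by_cases hbu : IsUnit (⟨_, hb⟩ : A)
    · right
      obtain ⟨b', hb'⟩ := hbu.exists_right_inv
      have h1 : (a (n + 1) : E) * u * b' = 1 := congrArg Subtype.val hb'
      have h2 : w = a (n + 1) * b' := by
        linear_combination (-w) * h1 + (a (n + 1) * b' : E) * huw
      rw [h2]
      exact mul_mem (a (n + 1)).2 b'.2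
    · rcases Nat.lt_or_ge i (n + 1) with hin | hin
      -- Only a nonunit is added, so the unit coefficient remains a unit because `A` is local.
      · refine ih (fun j => if j = n then a n + ⟨_, hb⟩ else a j) ?_ ⟨i, by omega, ?_⟩
        · rw [Finset.sum_range_succ, Finset.sum_range_succ] at ha
          rw [Finset.sum_range_succ, if_pos rfl, ← ha, add_assoc]
          congr 1
          · refine Finset.sum_congr rfl fun j hj => ?_
            rw [if_neg (Finset.mem_range.mp hj).ne]
          · push_cast
            ring
        · by_cases hi' : i = n
          · subst hi'
            rw [if_pos rfl]
            by_contra hcon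
            refine IsLocalRing.nonunits_add (mem_nonunits_iff.mpr hcon)
              (mem_nonunits_iff.mpr ((IsUnit.neg_iff _).not.mpr hbu)) ?_
            simpa using hu
          · rwa [if_neg hi']
      · obtain rfl : i = n + 1 := by omega
        left
        obtain ⟨b', hb'⟩ := hu.exists_right_inv
        have h1 : (a (n + 1) : E) * b' = 1 := congrArg Subtype.val hb'
        have h2 : u = (a (n + 1) * u) * b' := by
          linear_combination (-u) * h1
        rw [h2]
        exact mul_mem hb b'.2

end PlaneCurve
-- Unibranch points: the valuation ring and the transversality argument
namespace PlaneCurve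

section
variable {k E : Type*} [Field k] [CommRing E] [Algebra k E]

theorem isIntegral_of_isIntegral_subalgebra {R A : Subalgebra k E} (hA : ∀ a ∈ A, IsIntegral R a)
    {z : E} (hz : IsIntegral A z) : IsIntegral R z := by
  refine isIntegral_trans (A := integralClosure R E) z ?_
  obtain ⟨f, hf, hfz⟩ := hz
  let ι : A →+* integralClosure R E :=
    { toFun := fun x => ⟨x, hA x x.2⟩
      map_one' := rfl
      map_mul' := fun _ _ => rfl
      map_zero' := rfl
      map_add' := fun _ _ => rfl }
  refine ⟨f.map ι, hf.map ι, ?_⟩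
  rw [Polynomial.eval₂_map]
  exact hfz

/-- Integral extensions reflect units, so an inverse that is integral over `R` is already found in
`R`. -/
theorem exists_mem_mul_eq_one_of_isIntegral {R : Subalgebra k E} {t s : E} (ht : t ∈ R)
    (hs : IsIntegral R s) (hts : t * s = 1) : ∃ z ∈ R, t * z = 1 := by
  have hu : IsUnit (algebraMap R (integralClosure R E) ⟨t, ht⟩) :=
    IsUnit.of_mul_eq_one ⟨s, hs⟩ (Subtype.ext hts)
  have : IsLocalHom (algebraMap R (integralClosure R E)) :=
    RingHom.IsIntegral.isLocalHom (fun x => Algebra.IsIntegral.isIntegral x) fun x y hxy =>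
      Subtype.ext (congrArg (fun x : integralClosure R E => (x : E)) hxy)
  obtain ⟨z, hz⟩ := (isUnit_of_map_unit _ _ hu).exists_right_inv
  exact ⟨z, z.2, congrArg Subtype.val hz⟩

theorem isUnit_algebraMap_add_mul {A : Type*} [CommRing A] [IsLocalRing A] [Algebra k A] {c : k}
    (hc : c ≠ 0) {t : A} (ht : ¬ IsUnit t) (x : A) : IsUnit (algebraMap k A c + t * x) := by
  by_contra hcon
  have h3 : ¬ IsUnit (-(t * x)) := by
    rw [IsUnit.neg_iff]
    exact fun h => ht (isUnit_of_mul_isUnit_left h)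
  refine IsLocalRing.nonunits_add (mem_nonunits_iff.mpr hcon) (mem_nonunits_iff.mpr h3) ?_
  rw [add_neg_cancel_right]
  exact (IsUnit.mk0 _ hc).map _

end

theorem mem_normalizedLocalRing_iff {P : Poly} {p : Plane} {z : FractionRing (CoordRing P)} :
    z ∈ normalizedLocalRing P p ↔ IsIntegral (localRing P p) z ∧ z ∈ functionField P := by
  rw [normalizedLocalRing, Algebra.mem_inf, Subalgebra.mem_restrictScalars,
    mem_integralClosure_iff]

theorem exists_toFrac_mul_eq_one {P h : Poly} [Fact (Irreducible P)] (hh : toFrac P h ≠ 0) :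
    ∃ w, toFrac P h * w = 1 := by
  have h0 : Ideal.Quotient.mk (Ideal.span {P}) h ≠ 0 := fun h0 => hh (by rw [toFrac, h0, map_zero])
  exact (IsLocalization.map_units (FractionRing (CoordRing P))
    ⟨_, mem_nonZeroDivisors_of_ne_zero h0⟩).exists_right_inv

theorem localRing_le {P : Poly} [Fact (Irreducible P)] {p : Plane} (hp : p ∈ zeroLocus P) :
    localRing P p ≤ normalizedLocalRing P p := by
  intro z hz
  refine mem_normalizedLocalRing_iff.mpr ⟨isIntegral_algebraMap (x := (⟨z, hz⟩ : localRing P p)), ?_⟩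
  obtain ⟨n, g, h, hg, hh, h0, hz⟩ := hz
  exact ⟨n, g, h, hg, hh,
    mem_nonZeroDivisors_of_ne_zero (toFrac_ne_zero_of_eval_ne_zero hp h0), hz⟩

theorem mem_of_isIntegral {P : Poly} {p : Plane} {z : FractionRing (CoordRing P)}
    (hz : z ∈ functionField P) (h : IsIntegral (normalizedLocalRing P p) z) :
    z ∈ normalizedLocalRing P p := by
  exact mem_normalizedLocalRing_iff.mpr ⟨isIntegral_of_isIntegral_subalgebra
    (fun _ ha => (mem_normalizedLocalRing_iff.mp ha).1) h, hz⟩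

/-- A function vanishing at `p` is not invertible in the normalized local ring. -/
theorem not_isUnit_of_vanishing {P : Poly} {p : Plane} (hp : p ∈ zeroLocus P)
    {g h : Poly} (hgp : eval p.rep g = 0) (hhp : eval p.rep h ≠ 0)
    {t : FractionRing (CoordRing P)} (htR : t ∈ localRing P p) (ht : t * toFrac P h = toFrac P g)
    (htA : t ∈ normalizedLocalRing P p) : ¬ IsUnit (⟨t, htA⟩ : normalizedLocalRing P p) := by
  intro hu
  obtain ⟨s, hs⟩ := hu.exists_right_inv
  have hs' : t * s = 1 := congrArg Subtype.val hs
  -- The inverse, being integral, can be taken in the local ring as `g' / h'`. Evaluating `g * g' =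
  -- h * h'` at `p` then gives the contradiction.
  obtain ⟨z, ⟨n, g', h', hg', hh', hh0', hz⟩, hzt⟩ :=
    exists_mem_mul_eq_one_of_isIntegral htR (mem_normalizedLocalRing_iff.mp s.2).1 hs'
  have h1 : toFrac P (g * g') = toFrac P (h * h') := by
    rw [toFrac_mul, toFrac_mul, ← ht, ← hz]
    linear_combination (toFrac P h * toFrac P h') * hzt
  have h2 := eval_eq_of_toFrac_eq hp h1
  rw [map_mul, map_mul, hgp, zero_mul] at h2
  exact mul_ne_zero hhp hh0' h2.symm

/-- If the normalization has one point above `p` only, the normalized local ring at `p` is a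
valuation ring. -/
theorem mem_or_mem_of_isLocalRing {P : Poly} [hP : Fact (Irreducible P)] {d : ℕ}
    (hPd : P.IsHomogeneous d) {p : Plane} (hp : p ∈ zeroLocus P)
    [IsLocalRing (normalizedLocalRing P p)] {F : Poly} {b : ℕ} (hF : F.IsHomogeneous b)
    (hpF : p ∈ zeroLocus F) (hPF : ¬ P ∣ F)
    {u w : FractionRing (CoordRing P)} (hu : u ∈ functionField P) (huw : u * w = 1) :
    u ∈ normalizedLocalRing P p ∨ w ∈ normalizedLocalRing P p := by
  obtain ⟨k, hk⟩ := Function.ne_iff.mp p.rep_nonzero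
  have hkb : eval p.rep (X k ^ b) ≠ 0 := by simpa using fun h => absurd h hk
  obtain ⟨v, hv⟩ := exists_toFrac_mul_eq_one (toFrac_ne_zero_of_eval_ne_zero hp hkb)
  -- This is `F / X k ^ b`, a nonzero nonunit: `F` vanishes at `p` without being divisible by `P`,
  -- and `X k` does not vanish at `p`.
  set t : FractionRing (CoordRing P) := toFrac P F * v with ht
  have htF : t * toFrac P (X k ^ b) = toFrac P F := by
    rw [ht, mul_assoc, mul_comm v, hv, mul_one]
  have htR : t ∈ localRing P p := ⟨b, F, X k ^ b, hF, isHomogeneous_X_pow k b, hkb, htF⟩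
  have ht0 : t ≠ 0 := by
    intro h0
    rw [h0, zero_mul] at htF
    exact hPF (toFrac_eq_zero_iff.mp htF.symm)
  have htA := localRing_le hp htR
  set τ : normalizedLocalRing P p := ⟨t, htA⟩ with hτ
  have htn : ¬ IsUnit τ := not_isUnit_of_vanishing hp hpF hkb htR htF htA
  have htK := (mem_normalizedLocalRing_iff.mp htA).2
  obtain ⟨n, c, hc, hrel⟩ := exists_algebraic_relation hPd htK hu
  set c' : ℕ → ℕ → ℂ := fun i j =>
    if h : i < n + 1 ∧ j < n + 1 then c (⟨i, h.1⟩, ⟨j, h.2⟩) else 0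
  have hc' : ∀ i j : Fin (n + 1), c' i j = c (i, j) := fun i j => dif_pos ⟨i.2, j.2⟩
  have hc0 : ∀ i j, ¬ (i < n + 1 ∧ j < n + 1) → c' i j = 0 := fun i j h => dif_neg h
  have hex : ∃ i j, c' i j ≠ 0 := by
    obtain ⟨⟨i, j⟩, hij⟩ := Function.ne_iff.mp hc
    exact ⟨i, j, by rwa [hc']⟩
  classical
  -- Dividing the relation by the lowest power of `t` that occurs leaves an equation for `u` with
  -- polynomials in `t` as coefficients. One of them has a nonzero constant term and is therefore a
  -- unit.
  set i0 := Nat.find hex with hi0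
  obtain ⟨j0, hj0⟩ := Nat.find_spec hex
  rw [← hi0] at hj0
  have hi0n : i0 < n + 1 ∧ j0 < n + 1 := by
    by_contra hcon
    exact hj0 (hc0 _ _ hcon)
  have hmin : ∀ i < i0, ∀ j, c' i j = 0 := by
    intro i hi j
    by_contra hcon
    exact Nat.find_min hex hi ⟨j, hcon⟩
  have hrel' : ∑ j ∈ Finset.range (n + 1), ∑ i ∈ Finset.range (n + 1),
      c' i j • (t ^ i * u ^ j) = 0 := by
    rw [← hrel, Fintype.sum_prod_type_right, Finset.sum_range]
    refine Finset.sum_congr rfl fun j _ => ?_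
    rw [Finset.sum_range]
    exact Finset.sum_congr rfl fun i _ => by rw [hc']
  obtain ⟨l, hl⟩ : ∃ l, n + 1 = i0 + (l + 1) := ⟨n - i0, by omega⟩
  set a : ℕ → normalizedLocalRing P p := fun j =>
    ∑ i ∈ Finset.range (l + 1), c' (i0 + i) j • τ ^ i with ha
  refine mem_or_mem_of_unit_coeff _ huw (fun a ha hint => mem_of_isIntegral
    (mul_mem (mem_normalizedLocalRing_iff.mp ha).2 hu) hint) n a ?_ ⟨j0, by omega, ?_⟩
  · refine (mul_eq_zero.mp ?_).resolve_left (pow_ne_zero i0 ht0)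
    rw [← hrel', Finset.mul_sum]
    refine Finset.sum_congr rfl fun j _ => ?_
    rw [hl, Finset.sum_range_add, Finset.sum_eq_zero fun i hi => by
      rw [hmin i (Finset.mem_range.mp hi) j, zero_smul], zero_add, ha]
    simp only [AddSubmonoidClass.coe_finsetSum, SetLike.val_smul, SubmonoidClass.coe_pow, hτ]
    rw [Finset.sum_mul, Finset.mul_sum]
    refine Finset.sum_congr rfl fun i _ => ?_
    rw [smul_mul_assoc, mul_smul_comm, pow_add]
    congr 1
    ring
  · have h1 : a j0 = algebraMap ℂ _ (c' i0 j0) +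
        τ * ∑ i ∈ Finset.range l, c' (i0 + (i + 1)) j0 • τ ^ i := by
      rw [ha]
      simp only
      rw [Finset.sum_range_succ', Finset.mul_sum, add_comm]
      congr 1
      · rw [pow_zero, Algebra.algebraMap_eq_smul_one, add_zero]
      · refine Finset.sum_congr rfl fun i _ => ?_
        rw [mul_smul_comm, pow_succ']
    rw [h1]
    exact isUnit_algebraMap_add_mul hj0 htn _

/-- Two transversal curves generate the ideal of a point locally. -/
theorem exists_combination {v : Fin 3 → ℂ} (hv : v ≠ 0) {F G L : Poly} {m n : ℕ}
    (hF : F.IsHomogeneous (m + 1)) (hG : G.IsHomogeneous (n + 1)) (hL : L.IsHomogeneous 1)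
    (hFv : eval v F = 0) (hGv : eval v G = 0) (hLv : eval v L = 0)
    (hind : LinearIndependent ℂ ![grad F v, grad G v]) :
    ∃ D A B : Poly, D.IsHomogeneous (m + n) ∧ A.IsHomogeneous n ∧ B.IsHomogeneous m ∧
      eval v D ≠ 0 ∧ D * L = A * F + B * G := by
  obtain ⟨M, hM, hMv, hgen⟩ := exists_linear_forms hv
  obtain ⟨f, hf, hFf⟩ := hgen m F hF hFv
  obtain ⟨g, hg, hGg⟩ := hgen n G hG hGv
  obtain ⟨l, hl, hLl⟩ := hgen 0 L hL hLv
  rw [Fin.sum_univ_two] at hFf hGg hLl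
  -- Cramer's rule for expressing `L` through `F` and `G`; independence of the gradients makes the
  -- determinant `D` nonzero at `v`.
  refine ⟨f 0 * g 1 - f 1 * g 0, l 0 * g 1 - l 1 * g 0, l 1 * f 0 - l 0 * f 1,
    ((hf 0).mul (hg 1)).sub ((hf 1).mul (hg 0)), ?_, ?_, ?_, ?_⟩
  · simpa using ((hl 0).mul (hg 1)).sub ((hl 1).mul (hg 0))
  · simpa using ((hl 1).mul (hf 0)).sub ((hl 0).mul (hf 1))
  · intro hD
    rw [map_sub, map_mul, map_mul] at hD
    have h1 : grad F v = eval v (f 0) • grad (M 0) v + eval v (f 1) • grad (M 1) v := by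
      rw [hFf, grad_add, grad_mul_of_eval_eq_zero (hMv 0), grad_mul_of_eval_eq_zero (hMv 1)]
    have h2 : grad G v = eval v (g 0) • grad (M 0) v + eval v (g 1) • grad (M 1) v := by
      rw [hGg, grad_add, grad_mul_of_eval_eq_zero (hMv 0), grad_mul_of_eval_eq_zero (hMv 1)]
    rw [LinearIndependent.pair_iff] at hind
    have k1 := hind (eval v (g 1)) (-eval v (f 1)) (by
      rw [h1, h2]
      ext i
      simp only [Pi.add_apply, Pi.smul_apply, smul_eq_mul, Pi.zero_apply]
      linear_combination grad (M 0) v i * hD)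
    have k2 := hind (eval v (g 0)) (-eval v (f 0)) (by
      rw [h1, h2]
      ext i
      simp only [Pi.add_apply, Pi.smul_apply, smul_eq_mul, Pi.zero_apply]
      linear_combination -grad (M 1) v i * hD)
    have k3 := hind 1 0 (by
      rw [h1, neg_eq_zero.mp k1.2, neg_eq_zero.mp k2.2]
      simp)
    exact one_ne_zero k3.1
  · rw [hFf, hGg, hLl]
    ring

/-- The function `F / L ^ b` is a nonunit of the normalized local ring at `p`, if the curves `F = 0`
and `P = 0` meet in `p` only and the line `L = 0` passes through another point of `P = 0`. -/
theorem exists_nonunit {P : Poly} [hP : Fact (Irreducible P)] {d : ℕ}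
    (hPd : P.IsHomogeneous d) {p q : Plane} (hp : p ∈ zeroLocus P) (hq : q ∈ zeroLocus P)
    (hqp : q ≠ p) [IsLocalRing (normalizedLocalRing P p)] {F L : Poly} {b : ℕ}
    (hF : F.IsHomogeneous b) (hb : 1 ≤ b) (hpF : p ∈ zeroLocus F)
    (hcap : ∀ r ∈ zeroLocus P, r ∈ zeroLocus F → r = p) (hL : L.IsHomogeneous 1)
    (hqL : q ∈ zeroLocus L) (hPL : ¬ P ∣ L) :
    ∃ ψ : normalizedLocalRing P p, ¬ IsUnit ψ ∧ ψ * toFrac P L ^ b = toFrac P F := by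
  have hPF : ¬ P ∣ F := by
    rintro ⟨G, rfl⟩
    refine hqp (hcap q hq ?_)
    rw [zeroLocus, Set.mem_ofPred_eq] at hq ⊢
    simp [hq]
  obtain ⟨w, hw⟩ := exists_toFrac_mul_eq_one (mt toFrac_eq_zero_iff.mp hPF)
  obtain ⟨y, hy⟩ := exists_toFrac_mul_eq_one (mt toFrac_eq_zero_iff.mp hPL)
  set φ := toFrac P L ^ b * w with hφ
  have hφF : φ * toFrac P F = toFrac P (L ^ b) := by
    rw [hφ, mul_assoc, mul_comm w, hw, mul_one, toFrac_pow]
  have hLb : (L ^ b).IsHomogeneous b := by simpa using hL.pow b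
  have hφK : φ ∈ functionField P := ⟨b, L ^ b, F, hLb, hF,
    mem_nonZeroDivisors_of_ne_zero (mt toFrac_eq_zero_iff.mp hPF), hφF⟩
  have hyb : toFrac P L ^ b * y ^ b = 1 := by rw [← mul_pow, hy, one_pow]
  have hφψ : φ * (toFrac P F * y ^ b) = 1 := by
    rw [← mul_assoc, hφF, toFrac_pow, hyb]
  -- Away from `p` the denominator `F` has no zero on the curve. If `φ = L ^ b / F` were integral at
  -- `p` too, it would be constant, and zero because of its value at `q`; but it is invertible.
  have hφA : φ ∉ normalizedLocalRing P p := by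
    intro hA
    obtain ⟨r, hr⟩ := exists_eq_algebraMap_of_forall_isIntegral hPd (φ := φ) fun r hr => by
      by_cases hrp : r = p
      · subst hrp
        exact (mem_normalizedLocalRing_iff.mp hA).1
      · have : φ ∈ localRing P r :=
          ⟨b, L ^ b, F, hLb, hF, fun h0 => hrp (hcap r hr h0), hφF⟩
        exact isIntegral_algebraMap (x := (⟨φ, this⟩ : localRing P r))
    rw [hr, ← toFrac_C, ← toFrac_mul] at hφF
    have h1 := eval_eq_of_toFrac_eq hq hφF
    have h2 : eval q.rep F ≠ 0 := fun h0 => hqp (hcap q hq h0)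
    rw [map_mul, eval_C, map_pow, show eval q.rep L = 0 from hqL, zero_pow (by omega)] at h1
    have h3 : r = 0 := (mul_eq_zero.mp h1).resolve_right h2
    rw [h3, map_zero] at hr
    rw [hr, zero_mul] at hφψ
    exact zero_ne_one hφψ
  have hψA := (mem_or_mem_of_isLocalRing hPd hp hF hpF hPF hφK hφψ).resolve_left hφA
  refine ⟨⟨_, hψA⟩, fun hu => hφA ?_, ?_⟩
  · obtain ⟨s, hs⟩ := hu.exists_right_inv
    have hs' : toFrac P F * y ^ b * s = 1 := congrArg Subtype.val hs
    have : φ = s := by linear_combination (-φ) * hs' + (s : FractionRing (CoordRing P)) * hφψ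
    rw [this]
    exact s.2
  · change toFrac P F * y ^ b * toFrac P L ^ b = toFrac P F
    linear_combination toFrac P F * hyb

/-- If the curve `P = 0` is unibranch at `p` and meets two curves that are transversal at `p` only
there, then it is the line joining `p` to any other of its points. -/
theorem dvd_of_unibranch {P : Poly} [hP : Fact (Irreducible P)] {d : ℕ}
    (hPd : P.IsHomogeneous d) {p q : Plane} (hp : p ∈ zeroLocus P) (hq : q ∈ zeroLocus P)
    (hqp : q ≠ p) [IsLocalRing (normalizedLocalRing P p)] {F G L : Poly} {m n : ℕ}
    (hF : F.IsHomogeneous (m + 1)) (hG : G.IsHomogeneous (n + 1)) (hL : L.IsHomogeneous 1)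
    (hpF : p ∈ zeroLocus F) (hpG : p ∈ zeroLocus G) (hpL : p ∈ zeroLocus L)
    (hqL : q ∈ zeroLocus L)
    (hcapF : ∀ r ∈ zeroLocus P, r ∈ zeroLocus F → r = p)
    (hcapG : ∀ r ∈ zeroLocus P, r ∈ zeroLocus G → r = p)
    (hind : LinearIndependent ℂ ![grad F p.rep, grad G p.rep]) : P ∣ L := by
  by_contra hPL
  obtain ⟨ψ, hψ, hψF⟩ := exists_nonunit hPd hp hq hqp hF (by omega) hpF hcapF hL hqL hPL
  obtain ⟨χ, hχ, hχG⟩ := exists_nonunit hPd hp hq hqp hG (by omega) hpG hcapG hL hqL hPL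
  obtain ⟨D, A, B, hD, hA, hB, hDp, hDL⟩ :=
    exists_combination p.rep_nonzero hF hG hL hpF hpG hpL hind
  obtain ⟨y, hy⟩ := exists_toFrac_mul_eq_one (toFrac_ne_zero_of_eval_ne_zero hp hDp)
  have hL0 : toFrac P L ≠ 0 := mt toFrac_eq_zero_iff.mp hPL
  -- The identity `D * L = A * F + B * G` divided by `L`. After division by `D`, a unit at `p`, it
  -- writes `1` as a combination of the nonunits `ψ` and `χ`.
  have h1 : toFrac P D = toFrac P (A * L ^ m) * ψ + toFrac P (B * L ^ n) * χ := by
    refine mul_right_cancel₀ hL0 ?_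
    rw [← toFrac_mul, hDL, toFrac_add, toFrac_mul, toFrac_mul, ← hψF, ← hχG, toFrac_mul,
      toFrac_mul, toFrac_pow, toFrac_pow]
    ring
  have hLm : ∀ k, (L ^ k).IsHomogeneous k := fun k => by simpa using hL.pow k
  have hα : toFrac P (A * L ^ m) * y ∈ normalizedLocalRing P p := by
    refine localRing_le hp ⟨m + n, A * L ^ m, D, ?_, hD, hDp, ?_⟩
    · rw [add_comm]
      exact hA.mul (hLm m)
    · rw [mul_assoc, mul_comm y, hy, mul_one]
  have hβ : toFrac P (B * L ^ n) * y ∈ normalizedLocalRing P p := by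
    refine localRing_le hp ⟨m + n, B * L ^ n, D, hB.mul (hLm n), hD, hDp, ?_⟩
    rw [mul_assoc, mul_comm y, hy, mul_one]
  have h2 : (⟨_, hα⟩ : normalizedLocalRing P p) * ψ + ⟨_, hβ⟩ * χ = 1 := by
    refine Subtype.ext ?_
    change toFrac P (A * L ^ m) * y * ψ + toFrac P (B * L ^ n) * y * χ = 1
    rw [← hy, h1]
    ring
  refine IsLocalRing.nonunits_add (a := (⟨_, hα⟩ : normalizedLocalRing P p) * ψ)
    (b := ⟨_, hβ⟩ * χ) (fun h => hψ (isUnit_of_mul_isUnit_right h))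
    (fun h => hχ (isUnit_of_mul_isUnit_right h)) ?_
  rw [h2]
  exact isUnit_one

end PlaneCurve
-- Normality of lines, and nodes in terms of gradients
namespace PlaneCurve

theorem isLocalRing_of_subsingleton {P : Poly} [Fact (Irreducible P)] {p : Plane}
    (h : Subsingleton (MaximalSpectrum (normalizedLocalRing P p))) :
    IsLocalRing (normalizedLocalRing P p) :=
  IsLocalRing.of_singleton_maximalSpectrum

/-- The local rings of a line are valuation rings. -/
theorem mem_localRing_or_of_linear {P : Poly} [hP : Fact (Irreducible P)]
    (hP1 : P.IsHomogeneous 1) {p : Plane} (hp : p ∈ zeroLocus P)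
    {z : FractionRing (CoordRing P)} (n : ℕ) :
    ∀ g h : Poly, g.IsHomogeneous n → h.IsHomogeneous n → ¬ P ∣ h → z * toFrac P h = toFrac P g →
      z ∈ localRing P p ∨ ∃ w ∈ localRing P p, z * w = 1 := by
  have key : ∀ g h : Poly, g.IsHomogeneous n → h.IsHomogeneous n → z * toFrac P h = toFrac P g →
      eval p.rep g ≠ 0 ∨ eval p.rep h ≠ 0 →
      z ∈ localRing P p ∨ ∃ w ∈ localRing P p, z * w = 1 := by
    rintro g h hg hh hz (h0 | h0)
    · right
      obtain ⟨y, hy⟩ := exists_toFrac_mul_eq_one (toFrac_ne_zero_of_eval_ne_zero hp h0)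
      refine ⟨toFrac P h * y, ⟨n, h, g, hh, hg, h0, ?_⟩, ?_⟩
      · rw [mul_assoc, mul_comm y, hy, mul_one]
      · rw [← mul_assoc, hz, hy]
    · exact Or.inl ⟨n, g, h, hg, hh, h0, hz⟩
  induction n with
  | zero =>
    intro g h hg hh hPh hz
    refine key g h hg hh hz (Or.inr ?_)
    obtain ⟨r, rfl⟩ := exists_C_of_isHomogeneous_zero hh
    rw [eval_C]
    rintro rfl
    simp at hPh
  | succ n ih =>
    intro g h hg hh hPh hz
    by_cases hgp : eval p.rep g = 0
    · by_cases hhp : eval p.rep h = 0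
      -- If numerator and denominator both vanish at `p`, the local parameter cancels and the degree
      -- drops.
      · obtain ⟨M, hM, hMv, hgen⟩ := exists_local_parameter hP1 hP.out.ne_zero p.rep_nonzero hp
        obtain ⟨g', B, hg', -, rfl⟩ := hgen n g hg hgp
        obtain ⟨h', B', hh', -, rfl⟩ := hgen n h hh hhp
        have hPM : ¬ P ∣ M := fun hd => hPh (dvd_add (hd.mul_left h') (dvd_mul_left P B'))
        have hPh' : ¬ P ∣ h' := fun hd => hPh (dvd_add (hd.mul_right M) (dvd_mul_left P B'))
        have h1 : ∀ g B : Poly, toFrac P (g * M + B * P) = toFrac P g * toFrac P M := by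
          intro g B
          rw [toFrac_add, toFrac_eq_zero_iff.mpr (dvd_mul_left P B), add_zero, toFrac_mul]
        rw [h1, h1, ← mul_assoc] at hz
        have hz' := mul_right_cancel₀ (mt toFrac_eq_zero_iff.mp hPM) hz
        refine ih ?_ g' h' hg' hh' hPh' hz'
        rintro g h hg hh hz (h0 | h0)
        · right
          obtain ⟨y, hy⟩ := exists_toFrac_mul_eq_one (toFrac_ne_zero_of_eval_ne_zero hp h0)
          refine ⟨toFrac P h * y, ⟨n, h, g, hh, hg, h0, ?_⟩, ?_⟩
          · rw [mul_assoc, mul_comm y, hy, mul_one]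
          · rw [← mul_assoc, hz, hy]
        · exact Or.inl ⟨n, g, h, hg, hh, h0, hz⟩
      · exact key g h hg hh hz (Or.inr hhp)
    · exact key g h hg hh hz (Or.inl hgp)

/-- A line has one point of its normalization above each of its points. -/
theorem subsingleton_maximalSpectrum_of_linear {P : Poly} [hP : Fact (Irreducible P)]
    (hP1 : P.IsHomogeneous 1) {p : Plane} (hp : p ∈ zeroLocus P) :
    Subsingleton (MaximalSpectrum (normalizedLocalRing P p)) := by
  -- A valuation ring is integrally closed, so normalization changes nothing on a line.
  have hR : ∀ z ∈ normalizedLocalRing P p, z ∈ localRing P p := by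
    intro z hz
    obtain ⟨hzi, n, g, h, hg, hh, hh0, hzh⟩ := mem_normalizedLocalRing_iff.mp hz
    have hPh : ¬ P ∣ h := mt toFrac_eq_zero_iff.mpr (nonZeroDivisors.ne_zero hh0)
    rcases mem_localRing_or_of_linear hP1 hp n g h hg hh hPh hzh with h1 | ⟨w, hw, hzw⟩
    · exact h1
    · obtain ⟨y, hy, hwy⟩ := exists_mem_mul_eq_one_of_isIntegral hw hzi ((mul_comm w z).trans hzw)
      have : z = y := by linear_combination (-z) * hwy + y * hzw
      rwa [this]
  have hunit : ∀ (z : normalizedLocalRing P p) (n : ℕ) (g h : Poly), g.IsHomogeneous n →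
      h.IsHomogeneous n → eval p.rep g ≠ 0 →
      (z : FractionRing (CoordRing P)) * toFrac P h = toFrac P g → IsUnit z := by
    intro z n g h hg hh h0 hz
    obtain ⟨y, hy⟩ := exists_toFrac_mul_eq_one (toFrac_ne_zero_of_eval_ne_zero hp h0)
    have hw : toFrac P h * y ∈ localRing P p := by
      refine ⟨n, h, g, hh, hg, h0, ?_⟩
      rw [mul_assoc, mul_comm y, hy, mul_one]
    refine IsUnit.of_mul_eq_one ⟨_, localRing_le hp hw⟩ (Subtype.ext ?_)
    change (z : FractionRing (CoordRing P)) * (toFrac P h * y) = 1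
    rw [← mul_assoc, hz, hy]
  have : IsLocalRing (normalizedLocalRing P p) := by
    -- For `a = g / h` with `h` nonzero at `p`, one of `g` and `h - g` is nonzero at `p`.
    refine IsLocalRing.of_isUnit_or_isUnit_one_sub_self fun a => ?_
    obtain ⟨n, g, h, hg, hh, hh0, hz⟩ := hR a a.2
    by_cases hg0 : eval p.rep g = 0
    · refine Or.inr (hunit (1 - a) n (h - g) h (hh.sub hg) hh (by simpa [hg0] using hh0) ?_)
      have : toFrac P (h - g) = toFrac P h - toFrac P g := map_sub (toFracHom P) h g
      rw [this, ← hz]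
      change (1 - (a : FractionRing (CoordRing P))) * toFrac P h = _
      ring
    · exact Or.inl (hunit a n g h hg hh hg0 hz)
  exact ⟨fun I J => MaximalSpectrum.ext ((IsLocalRing.eq_maximalIdeal I.isMaximal).trans
    (IsLocalRing.eq_maximalIdeal J.isMaximal).symm)⟩

/-- The Hessian of a product of two transversal branches and a factor not vanishing at the point. -/
theorem rank_symm_eq_two_iff (h : ℂ) (u v : Fin 3 → ℂ) :
    (Matrix.of fun i j : Fin 3 => h * (u i * v j + u j * v i)).rank = 2 ↔
      h ≠ 0 ∧ LinearIndependent ℂ ![u, v] := by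
  set M := Matrix.of fun i j : Fin 3 => h * (u i * v j + u j * v i) with hM
  constructor
  · intro hr
    have hle : ∀ w w' : Fin 3 → ℂ, M ≠ Matrix.vecMulVec w w' := by
      intro w w' hw
      have := Matrix.rank_vecMulVec_le w w'
      rw [← hw, hr] at this
      omega
    refine ⟨?_, ?_⟩
    · rintro rfl
      refine hle 0 0 ?_
      ext i j
      simp [hM, Matrix.vecMulVec_apply]
    · rw [LinearIndependent.pair_iff]
      intro s t hst
      have hst' : ∀ i, s * u i + t * v i = 0 := fun i => congrFun hst i
      by_contra hcon
      by_cases hs : s = 0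
      · have ht : t ≠ 0 := fun ht => hcon ⟨hs, ht⟩
        refine hle 0 0 ?_
        ext i j
        have hv : ∀ i, v i = 0 := fun i => by simpa [hs, ht] using hst' i
        simp [hM, Matrix.vecMulVec_apply, hv]
      · refine hle ((-(2 * h * (s⁻¹ * t))) • v) v ?_
        have hu : ∀ i, u i = -(s⁻¹ * t) * v i := by
          intro i
          field_simp
          linear_combination hst' i
        ext i j
        simp only [hM, Matrix.of_apply, Matrix.vecMulVec_apply, Pi.smul_apply, smul_eq_mul, hu]
        ring
  · rintro ⟨hh, hind⟩
    refine le_antisymm ?_ ?_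
    · have : M = (Matrix.of ![u, v]).transpose * Matrix.of ![h • v, h • u] := by
        ext i j
        simp [hM, Matrix.mul_apply, Fin.sum_univ_two]
        ring
      rw [this]
      refine (Matrix.rank_mul_le_left _ _).trans ((Matrix.rank_le_width _).trans le_rfl)
    · have hc := crossProduct_ne_zero_iff_linearIndependent.mpr hind
      -- A kernel vector is orthogonal to both `u` and `v`, so the kernel is at most a line and the
      -- rank at least two.
      have hker : LinearMap.ker M.mulVecLin ≤ Submodule.span ℂ {crossProduct u v} := by
        intro x hx
        rw [LinearMap.mem_ker, Matrix.mulVecLin_apply] at hx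
        have h1 : (v ⬝ᵥ x) • u + (u ⬝ᵥ x) • v = 0 := by
          ext i
          have := congrFun hx i
          simp only [hM, Matrix.mulVec, dotProduct, Matrix.of_apply, Fin.sum_univ_three,
            Pi.zero_apply, Pi.add_apply, Pi.smul_apply, smul_eq_mul] at this ⊢
          refine (mul_eq_zero.mp (?_ : h * _ = 0)).resolve_left hh
          linear_combination this
        have h2 := LinearIndependent.pair_iff.mp hind _ _ h1
        obtain ⟨r, rfl⟩ := eq_smul_cross hc (by rw [dotProduct_comm]; exact h2.2)
          (by rw [dotProduct_comm]; exact h2.1)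
        exact Submodule.smul_mem _ _ (Submodule.mem_span_singleton_self _)
      have h3 := LinearMap.finrank_range_add_finrank_ker M.mulVecLin
      have h4 := (Submodule.finrank_mono hker).trans (finrank_span_singleton hc).le
      rw [Module.finrank_fin_fun] at h3
      rw [Matrix.rank]
      omega

/-- At a common zero of `F` and `G`, the Hessian of the product retains only the value of `H` times
the symmetrized product of the two gradients. -/
theorem isNode_mul_iff {F G H : Poly} {p : Plane} (hF : p ∈ zeroLocus F) (hG : p ∈ zeroLocus G) :
    IsNode (F * G * H) p ↔
      eval p.rep H ≠ 0 ∧ LinearIndependent ℂ ![grad F p.rep, grad G p.rep] := by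
  rw [zeroLocus, Set.mem_ofPred_eq] at hF hG
  rw [← rank_symm_eq_two_iff, IsNode, and_iff_right]
  · have : ∀ i j, eval p.rep (pderiv i (pderiv j (F * G * H))) =
        eval p.rep H * (grad F p.rep i * grad G p.rep j + grad F p.rep j * grad G p.rep i) := by
      intro i j
      simp only [Derivation.leibniz, map_add, smul_eq_mul, map_mul, hF, hG, grad]
      ring
    simp only [this]
  · intro i
    simp [Derivation.leibniz, hF, hG]

theorem isNode_prod_iff {c : ℕ} {F : Fin c → Poly} {i j : Fin c} (hij : i ≠ j) {p : Plane}
    (hi : p ∈ zeroLocus (F i)) (hj : p ∈ zeroLocus (F j)) :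
    IsNode (∏ k, F k) p ↔ (∀ k, k ≠ i → k ≠ j → p ∉ zeroLocus (F k)) ∧
      LinearIndependent ℂ ![grad (F i) p.rep, grad (F j) p.rep] := by
  have : ∏ k, F k = F i * F j * ∏ k ∈ (Finset.univ.erase i).erase j, F k := by
    rw [mul_assoc, Finset.mul_prod_erase _ _ (by simp [hij.symm]),
      Finset.mul_prod_erase _ _ (Finset.mem_univ i)]
  rw [this, isNode_mul_iff hi hj, map_prod, Finset.prod_ne_zero_iff]
  refine and_congr_left' ⟨fun h k hki hkj => h k (by simp [hki, hkj]), fun h k hk => ?_⟩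
  simp only [Finset.mem_erase, Finset.mem_univ, and_true] at hk
  exact h k hk.2 hk.1

end PlaneCurve
-- The position of a hyper-bitangent curve
namespace PlaneCurve

theorem eq_or_eq_or_eq_of_card_le_two {α : Type*} (h : ENat.card α ≤ 2) (x y z : α) :
    x = y ∨ x = z ∨ y = z := by
  by_contra! hcon
  have hinj : Function.Injective ![x, y, z] := by
    intro i j hij
    fin_cases i <;> fin_cases j <;> simp_all
  have h3 := (ENat.card_le_card_of_injective hinj).trans h
  rw [ENat.card_eq_coe_fintype_card, Fintype.card_fin] at h3
  exact absurd h3 (by decide)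

instance nonempty_maximalSpectrum (P : Poly) [Fact (Irreducible P)] (p : Plane) :
    Nonempty (MaximalSpectrum (normalizedLocalRing P p)) := inferInstance

variable {c : ℕ} {b : Fin c → ℕ} {F : Fin c → Poly}

theorem IsNodalUnion.notMem (hN : IsNodalUnion b F) {i j k : Fin c} (hij : i ≠ j) (hki : k ≠ i)
    (hkj : k ≠ j) {p : Plane} (hi : p ∈ zeroLocus (F i)) (hj : p ∈ zeroLocus (F j)) :
    p ∉ zeroLocus (F k) :=
  ((isNode_prod_iff hij hi hj).mp (hN.node i j hij p ⟨hi, hj⟩)).1 k hki hkj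

theorem IsNodalUnion.linearIndependent (hN : IsNodalUnion b F) {i j : Fin c} (hij : i ≠ j)
    {p : Plane} (hi : p ∈ zeroLocus (F i)) (hj : p ∈ zeroLocus (F j)) :
    LinearIndependent ℂ ![grad (F i) p.rep, grad (F j) p.rep] :=
  ((isNode_prod_iff hij hi hj).mp (hN.node i j hij p ⟨hi, hj⟩)).2

theorem IsNodalUnion.one_le (hN : IsNodalUnion b F) (i : Fin c) : 1 ≤ b i :=
  one_le_of_irreducible (hN.homogeneous i) (hN.irreducible i)

/-- The position of a hyper-bitangent curve `C` relative to the curves `F i`: the four curves are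
grouped into two pairs, and `C` meets the curves of each pair in a single point. -/
structure Contact (F : Fin c → Poly) (C : Set Plane) (p q : Plane) (i j k l : Fin c) : Prop where
  ne : p ≠ q
  ij : i ≠ j
  kl : k ≠ l
  ik : i ≠ k
  il : i ≠ l
  jk : j ≠ k
  jl : j ≠ l
  pC : p ∈ C
  qC : q ∈ C
  pi : p ∈ zeroLocus (F i)
  pj : p ∈ zeroLocus (F j)
  qk : q ∈ zeroLocus (F k)
  ql : q ∈ zeroLocus (F l)
  capi : ∀ r ∈ C, r ∈ zeroLocus (F i) → r = p
  capj : ∀ r ∈ C, r ∈ zeroLocus (F j) → r = p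
  capk : ∀ r ∈ C, r ∈ zeroLocus (F k) → r = q
  capl : ∀ r ∈ C, r ∈ zeroLocus (F l) → r = q

theorem Contact.symm {C : Set Plane} {p q : Plane} {i j k l : Fin c} (h : Contact F C p q i j k l) :
    Contact F C q p k l i j :=
  ⟨h.ne.symm, h.kl, h.ij, h.ik.symm, h.jk.symm, h.il.symm, h.jl.symm, h.qC, h.pC, h.qk, h.ql, h.pi,
    h.pj, h.capk, h.capl, h.capi, h.capj⟩

theorem Contact.swap {C : Set Plane} {p q : Plane} {i j k l : Fin c} (h : Contact F C p q i j k l) :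
    Contact F C p q j i k l :=
  ⟨h.ne, h.ij.symm, h.kl, h.jk, h.jl, h.ik, h.il, h.pC, h.qC, h.pj, h.pi, h.qk, h.ql, h.capj,
    h.capi, h.capk, h.capl⟩

/-- A counting argument: each component has an intersection point with the curve, there are at most
two such points, and each lies on at most two components. -/
theorem exists_contact (hc : 4 ≤ c) (hN : IsNodalUnion b F) {P : Poly} [hP : Fact (Irreducible P)]
    {d : ℕ} (hPd : P.IsHomogeneous d)
    (hcard : ENat.card {x : NormalizationPoint P // (x.1 : Plane) ∈ union F} ≤ 2) :
    c = 4 ∧ ∃ p q i j k l, Contact F (zeroLocus P) p q i j k l ∧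
      Subsingleton (MaximalSpectrum (normalizedLocalRing P p)) := by
  classical
  have hd := one_le_of_irreducible hPd hP.out
  have hmemU : ∀ {r : Plane} {i : Fin c}, r ∈ zeroLocus (F i) → r ∈ union F :=
    fun hr => Set.mem_iUnion.mpr ⟨_, hr⟩
  have hpts : ∀ x y z : Plane, x ∈ zeroLocus P → y ∈ zeroLocus P → z ∈ zeroLocus P →
      x ∈ union F → y ∈ union F → z ∈ union F → x = y ∨ x = z ∨ y = z := by
    intro x y z hx hy hz hxU hyU hzU
    have hval : ∀ {x y : Plane} (hx : x ∈ zeroLocus P) (hxU : x ∈ union F) (hy : y ∈ zeroLocus P)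
        (hyU : y ∈ union F), (⟨⟨⟨x, hx⟩, Classical.arbitrary _⟩, hxU⟩ :
          {x : NormalizationPoint P // (x.1 : Plane) ∈ union F}) =
          ⟨⟨⟨y, hy⟩, Classical.arbitrary _⟩, hyU⟩ → x = y := fun _ _ _ _ h =>
      congrArg (fun s : {x : NormalizationPoint P // (x.1 : Plane) ∈ union F} =>
        (s.1.1 : Plane)) h
    rcases eq_or_eq_or_eq_of_card_le_two hcard ⟨⟨⟨x, hx⟩, Classical.arbitrary _⟩, hxU⟩
      ⟨⟨⟨y, hy⟩, Classical.arbitrary _⟩, hyU⟩ ⟨⟨⟨z, hz⟩, Classical.arbitrary _⟩, hzU⟩ with h | h | h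
    · exact Or.inl (hval hx hxU hy hyU h)
    · exact Or.inr (Or.inl (hval hx hxU hz hzU h))
    · exact Or.inr (Or.inr (hval hy hyU hz hzU h))
  choose r hrP hrF using fun i =>
    exists_mem_zeroLocus_inter hPd hd (hN.homogeneous i) (hN.one_le i)
  have hrU : ∀ i, r i ∈ union F := fun i => hmemU (hrF i)
  set T := Finset.univ.image r with hT
  have hTcard : T.card ≤ 2 := by
    by_contra! hcon
    obtain ⟨x, y, z, hx, hy, hz, hxy, hxz, hyz⟩ := Finset.two_lt_card_iff.mp hcon
    simp only [hT, Finset.mem_image, Finset.mem_univ, true_and] at hx hy hz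
    obtain ⟨i, rfl⟩ := hx
    obtain ⟨j, rfl⟩ := hy
    obtain ⟨k, rfl⟩ := hz
    rcases hpts _ _ _ (hrP i) (hrP j) (hrP k) (hrU i) (hrU j) (hrU k) with h | h | h
    exacts [hxy h, hxz h, hyz h]
  have hfib : ∀ a : Plane, (Finset.univ.filter fun i => r i = a).card ≤ 2 := by
    intro a
    by_contra! hcon
    obtain ⟨i, j, k, hi, hj, hk, hij, hik, hjk⟩ := Finset.two_lt_card_iff.mp hcon
    simp only [Finset.mem_filter, Finset.mem_univ, true_and] at hi hj hk
    refine hN.notMem hij hik.symm hjk.symm (hi ▸ hrF i) (hj ▸ hrF j) (hk ▸ hrF k)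
  -- The sum is at most `2 * 2`, so `4 ≤ c` forces exactly two points with exactly two components
  -- each.
  have hsum : ∑ a ∈ T, (Finset.univ.filter fun i => r i = a).card = c := by
    rw [← Finset.card_eq_sum_card_image, Finset.card_univ, Fintype.card_fin]
  have hle : ∑ a ∈ T, (Finset.univ.filter fun i => r i = a).card ≤ T.card * 2 :=
    Finset.sum_le_card_nsmul _ _ _ fun a _ => hfib a
  have hT2 : T.card = 2 := by omega
  obtain ⟨p, q, hpq, hTpq⟩ := Finset.card_eq_two.mp hT2
  rw [hTpq, Finset.sum_pair hpq] at hsum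
  have hp2 := hfib p
  have hq2 := hfib q
  obtain ⟨i, j, hij, hfp⟩ := Finset.card_eq_two.mp
    (by omega : (Finset.univ.filter fun i => r i = p).card = 2)
  obtain ⟨k, l, hkl, hfq⟩ := Finset.card_eq_two.mp
    (by omega : (Finset.univ.filter fun i => r i = q).card = 2)
  have hi : r i = p := by simpa using (hfp ▸ Finset.mem_insert_self i {j} : i ∈ Finset.univ.filter fun i => r i = p)
  have hj : r j = p := by
    have : j ∈ Finset.univ.filter fun i => r i = p := by rw [hfp]; simp
    simpa using this
  have hk : r k = q := by
    have : k ∈ Finset.univ.filter fun i => r i = q := by rw [hfq]; simp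
    simpa using this
  have hl : r l = q := by
    have : l ∈ Finset.univ.filter fun i => r i = q := by rw [hfq]; simp
    simpa using this
  have hik : i ≠ k := fun h => hpq (by rw [← hi, h, hk])
  have hil : i ≠ l := fun h => hpq (by rw [← hi, h, hl])
  have hjk : j ≠ k := fun h => hpq (by rw [← hj, h, hk])
  have hjl : j ≠ l := fun h => hpq (by rw [← hj, h, hl])
  have hpP : p ∈ zeroLocus P := hi ▸ hrP i
  have hqP : q ∈ zeroLocus P := hk ▸ hrP k
  have hpi : p ∈ zeroLocus (F i) := hi ▸ hrF i
  have hpj : p ∈ zeroLocus (F j) := hj ▸ hrF j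
  have hqk : q ∈ zeroLocus (F k) := hk ▸ hrF k
  have hql : q ∈ zeroLocus (F l) := hl ▸ hrF l
  have hcap : ∀ s ∈ zeroLocus P, s ∈ union F → s = p ∨ s = q := fun s hs hsU =>
    (hpts s p q hs hpP hqP hsU (hmemU hpi) (hmemU hqk)).imp_right
      fun h => h.resolve_right hpq
  refine ⟨by omega, p, q, i, j, k, l, ⟨hpq, hij, hkl, hik, hil, hjk, hjl, hpP, hqP, hpi, hpj, hqk,
    hql, fun s hs hsF => ?_, fun s hs hsF => ?_, fun s hs hsF => ?_, fun s hs hsF => ?_⟩, ?_⟩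
  · refine (hcap s hs (hmemU hsF)).resolve_right fun h => ?_
    exact hN.notMem hkl hik hil hqk hql (h ▸ hsF)
  · refine (hcap s hs (hmemU hsF)).resolve_right fun h => ?_
    exact hN.notMem hkl hjk hjl hqk hql (h ▸ hsF)
  · refine (hcap s hs (hmemU hsF)).resolve_left fun h => ?_
    exact hN.notMem hij hik.symm hjk.symm hpi hpj (h ▸ hsF)
  · refine (hcap s hs (hmemU hsF)).resolve_left fun h => ?_
    exact hN.notMem hij hil.symm hjl.symm hpi hpj (h ▸ hsF)
  -- Two points of the normalization above `p` and one above `q` would be three.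
  · refine ⟨fun I J => ?_⟩
    rcases eq_or_eq_or_eq_of_card_le_two hcard ⟨⟨⟨p, hpP⟩, I⟩, hmemU hpi⟩ ⟨⟨⟨p, hpP⟩, J⟩, hmemU hpi⟩
      ⟨⟨⟨q, hqP⟩, Classical.arbitrary _⟩, hmemU hqk⟩ with h | h | h
    · exact eq_of_heq (Sigma.mk.inj (congrArg Subtype.val h)).2
    · exact absurd (congrArg (fun s : {x : NormalizationPoint P // (x.1 : Plane) ∈ union F} =>
        (s.1.1 : Plane)) h) hpq
    · exact absurd (congrArg (fun s : {x : NormalizationPoint P // (x.1 : Plane) ∈ union F} =>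
        (s.1.1 : Plane)) h) hpq

/-- A line in contact position meets a line of each of the two pairs. -/
theorem Contact.eq_one_or_eq_one (hN : IsNodalUnion b F) {P : Poly} (hP : P.IsHomogeneous 1)
    (hP0 : P ≠ 0) {p q : Plane} {i j k l : Fin c} (h : Contact F (zeroLocus P) p q i j k l) :
    b i = 1 ∨ b j = 1 := by
  by_contra! hcon
  have hi := hN.one_le i
  have hj := hN.one_le j
  obtain ⟨s, hs⟩ := grad_eq_smul_of_forall_eq hP hP0 (hN.homogeneous i) (by omega) h.pC h.pi h.capi
  obtain ⟨t, ht⟩ := grad_eq_smul_of_forall_eq hP hP0 (hN.homogeneous j) (by omega) h.pC h.pj h.capj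
  have hind := hN.linearIndependent h.ij h.pi h.pj
  -- Both gradients are multiples of the gradient of the line, against transversality.
  rw [LinearIndependent.pair_iff] at hind
  have h1 := hind t (-s) (by rw [hs, ht, smul_smul, smul_smul, neg_mul, neg_smul, mul_comm t s,
    add_neg_cancel])
  rw [neg_eq_zero.mp h1.2, zero_smul] at hs
  exact one_ne_zero (hind 1 0 (by rw [hs]; simp)).1

/-- Hyper-bitangent curves to a nodal union of at least four curves are lines. -/
theorem exists_contact_of_mem_hypDeg (hc : 4 ≤ c) (hN : IsNodalUnion b F) {d : ℕ} {C : Set Plane}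
    (hC : C ∈ hypDeg (union F) d) : c = 4 ∧ d = 1 ∧ ∃ p q i j k l, Contact F C p q i j k l ∧
      C = zeroLocus (lineThrough p q) ∧ b i = 1 ∧ b k = 1 := by
  obtain ⟨P, hP, hPd, rfl, hcard⟩ := hC
  have := Fact.mk hP
  obtain ⟨hc4, p, q, i, j, k, l, h, hsub⟩ := exists_contact hc hN hPd hcard
  have := isLocalRing_of_subsingleton hsub
  have hdvd : P ∣ lineThrough p q := by
    obtain ⟨m, hm⟩ := Nat.exists_eq_add_of_le' (hN.one_le i)
    obtain ⟨n, hn⟩ := Nat.exists_eq_add_of_le' (hN.one_le j)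
    exact dvd_of_unibranch hPd h.pC h.qC h.ne.symm (hm ▸ hN.homogeneous i)
      (hn ▸ hN.homogeneous j) (lineThrough_isHomogeneous p q) h.pi h.pj
      (left_mem_lineThrough p q) (right_mem_lineThrough p q) h.capi h.capj
      (hN.linearIndependent h.ij h.pi h.pj)
  have hL := irreducible_of_isHomogeneous_one (lineThrough_isHomogeneous p q)
    (lineThrough_ne_zero h.ne)
  obtain ⟨u, hu⟩ := (hP.associated_of_dvd hL hdvd).symm
  obtain ⟨s, -, hs⟩ := isUnit_iff_eq_C_of_isReduced.mp u.isUnit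
  have hP1 : P.IsHomogeneous 1 := by
    rw [← hu, hs, mul_comm]
    exact (lineThrough_isHomogeneous p q).C_mul s
  have hloc := zeroLocus_eq_of_linear h.ne hP1 hP.ne_zero h.pC h.qC
  refine ⟨hc4, hPd.inj_right hP1 hP.ne_zero, p, q, ?_⟩
  -- Relabelling within the pairs makes `i` and `k` the indices of components of degree one.
  have key : ∀ {i j}, Contact F (zeroLocus P) p q i j k l → b i = 1 →
      ∃ i j k l, Contact F (zeroLocus P) p q i j k l ∧
        zeroLocus P = zeroLocus (lineThrough p q) ∧ b i = 1 ∧ b k = 1 := by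
    intro i j h hi
    rcases h.symm.eq_one_or_eq_one hN hP1 hP.ne_zero with hk | hl
    · exact ⟨i, j, k, l, h, hloc, hi, hk⟩
    · exact ⟨i, j, l, k, h.symm.swap.symm, hloc, hi, hl⟩
  rcases h.eq_one_or_eq_one hN hP1 hP.ne_zero with hi | hj
  · exact key h hi
  · exact key h.swap hj

theorem hyp_eq_empty (hc : 5 ≤ c) (hN : IsNodalUnion b F) : hyp (union F) = ∅ := by
  refine Set.eq_empty_iff_forall_notMem.mpr ?_
  rintro C ⟨d, hC⟩
  have := (exists_contact_of_mem_hypDeg (by omega) hN hC).1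
  omega

theorem hypDeg_eq_empty (hc : 4 ≤ c) (hN : IsNodalUnion b F) {d : ℕ} (hd : 2 ≤ d) :
    hypDeg (union F) d = ∅ := by
  refine Set.eq_empty_iff_forall_notMem.mpr fun C hC => ?_
  have := (exists_contact_of_mem_hypDeg hc hN hC).2.1
  omega

theorem hypDeg_one_eq_empty (hc : 4 ≤ c) (hN : IsNodalUnion b F)
    (hb : ¬ ∃ i j, i ≠ j ∧ b i = 1 ∧ b j = 1) : hypDeg (union F) 1 = ∅ := by
  refine Set.eq_empty_iff_forall_notMem.mpr fun C hC => ?_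
  obtain ⟨-, -, p, q, i, j, k, l, h, -, hi, hk⟩ := exists_contact_of_mem_hypDeg hc hN hC
  exact hb ⟨i, k, h.ik, hi, hk⟩

/-- The line is determined by `p` and `q`, each of which lies on a component of degree one and on
another component. -/
theorem finite_hypDeg_one (hc : 4 ≤ c) (hN : IsNodalUnion b F) : (hypDeg (union F) 1).Finite := by
  set N : Set Plane := ⋃ i, ⋃ j, {p | i ≠ j ∧ b i = 1 ∧ p ∈ zeroLocus (F i) ∩ zeroLocus (F j)}
    with hNdef
  have hfin : N.Finite := by
    refine Set.finite_iUnion fun i => Set.finite_iUnion fun j => ?_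
    by_cases hij : i ≠ j ∧ b i = 1
    · have hdvd : ¬ F i ∣ F j := fun hd => hN.distinct i j hij.1
        ((hN.irreducible i).associated_of_dvd (hN.irreducible j) hd)
      exact (finite_inter_of_not_dvd (hij.2 ▸ hN.homogeneous i) (hN.irreducible i).ne_zero _ _
        (hN.homogeneous j) hdvd).subset fun p hp => hp.2.2
    · convert Set.finite_empty
      refine Set.eq_empty_iff_forall_notMem.mpr fun p hp => hij ⟨hp.1, hp.2.1⟩
  refine (hfin.image2 (fun p q => zeroLocus (lineThrough p q)) hfin).subset fun C hC => ?_
  obtain ⟨-, -, p, q, i, j, k, l, h, hCl, hi, hk⟩ := exists_contact_of_mem_hypDeg hc hN hC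
  exact ⟨p, Set.mem_iUnion₂.mpr ⟨i, j, h.ij, hi, h.pi, h.pj⟩, q,
    Set.mem_iUnion₂.mpr ⟨k, l, h.kl, hk, h.qk, h.ql⟩, hCl.symm⟩

end PlaneCurve
-- Four lines
namespace PlaneCurve

/-- A line meeting the curve `B` in at most two points is hyper-bitangent to it. -/
theorem mem_hypDeg_one_of_linear {B : Set Plane} {P : Poly} (hP1 : P.IsHomogeneous 1) (hP0 : P ≠ 0)
    {p q : Plane} (h : ∀ r ∈ zeroLocus P, r ∈ B → r = p ∨ r = q) : zeroLocus P ∈ hypDeg B 1 := by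
  have hP := irreducible_of_isHomogeneous_one hP1 hP0
  have := Fact.mk hP
  refine ⟨P, hP, hP1, rfl, ?_⟩
  -- A line has only one point of its normalization above each point, so it suffices to count points
  -- in the plane.
  have hinj : Function.Injective
      (fun x : {x : NormalizationPoint P // (x.1 : Plane) ∈ B} => (⟨x.1.1, h _ x.1.1.2 x.2⟩ :
        ({p, q} : Set Plane))) := by
    rintro ⟨⟨⟨x, hx⟩, I⟩, hxB⟩ ⟨⟨⟨y, hy⟩, J⟩, hyB⟩ hxy
    obtain rfl : x = y := congrArg Subtype.val hxy
    have := subsingleton_maximalSpectrum_of_linear hP1 hx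
    obtain rfl : I = J := Subsingleton.elim _ _
    rfl
  refine (ENat.card_le_card_of_injective hinj).trans ?_
  exact (Set.encard_insert_le _ _).trans (by rw [Set.encard_singleton]; norm_num)

/-- The three partitions of four indices into pairs, distinguished by the partner `j` of `0`. -/
theorem pairing_cases : ∀ j k l : Fin 4, 0 ≠ j → k ≠ l → 0 ≠ k → 0 ≠ l → j ≠ k → j ≠ l →
    (j = 1 ∧ min k l = 2 ∧ max k l = 3) ∨ (j = 2 ∧ min k l = 1 ∧ max k l = 3) ∨
      (j = 3 ∧ min k l = 1 ∧ max k l = 2) := by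
  intro j k l h1 h2 h3 h4 h5 h6
  rcases lt_or_gt_of_ne h2 with h | h
  · rw [min_eq_left h.le, max_eq_right h.le]
    omega
  · rw [min_eq_right h.le, max_eq_left h.le]
    omega

set_option maxHeartbeats 1000000 in

/-- For four lines in general position, exactly three lines are hyper-bitangent. -/
theorem encard_hypDeg_one {b : Fin 4 → ℕ} {F : Fin 4 → Poly} (hN : IsNodalUnion b F)
    (hb : ∀ i, b i = 1) : (hypDeg (union F) 1).encard = 3 := by
  have hlin : ∀ i, (F i).IsHomogeneous 1 := fun i => hb i ▸ hN.homogeneous i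
  have hne : ∀ i, F i ≠ 0 := fun i => (hN.irreducible i).ne_zero
  choose pt hpt1 hpt2 using fun i j =>
    exists_mem_zeroLocus_inter (hlin i) le_rfl (hlin j) le_rfl
  have huniq : ∀ {i j : Fin 4}, i ≠ j → ∀ {r}, r ∈ zeroLocus (F i) → r ∈ zeroLocus (F j) →
      r = pt i j := by
    intro i j hij r hi hj
    by_contra hr
    obtain ⟨s, hs⟩ := eq_C_mul_lineThrough hr (hlin i) hi (hpt1 i j)
    obtain ⟨t, ht⟩ := eq_C_mul_lineThrough hr (hlin j) hj (hpt2 i j)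
    have hs0 : s ≠ 0 := by rintro rfl; simp at hs; exact hne i hs
    refine hN.distinct i j hij ((hN.irreducible i).associated_of_dvd (hN.irreducible j)
      ⟨C (s⁻¹ * t), ?_⟩)
    have h1 : (C s⁻¹ * C s : Poly) = 1 := by rw [← C_mul, inv_mul_cancel₀ hs0, C_1]
    rw [hs, ht, C_mul]
    linear_combination (-C t * lineThrough r (pt i j)) * h1
  set Λ : Fin 4 → Fin 4 → Fin 4 → Fin 4 → Poly := fun i j k l => lineThrough (pt i j) (pt k l)
    with hΛ
  -- A second common point would identify the component with the joining line, which passes through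
  -- `pt k l`, so three components would meet there.
  have hcap : ∀ i j k l : Fin 4, i ≠ j → i ≠ k → i ≠ l → j ≠ k → j ≠ l → k ≠ l →
      ∀ r ∈ zeroLocus (Λ i j k l), r ∈ zeroLocus (F i) ∨ r ∈ zeroLocus (F j) → r = pt i j := by
    intro i j k l hij hik hil hjk hjl hkl r hr hrF
    by_contra hcon
    have key : ∀ m, m ≠ k → m ≠ l → r ∈ zeroLocus (F m) → pt i j ∈ zeroLocus (F m) → False := by
      intro m hmk hml hrm hpm
      have h1 := zeroLocus_eq_of_linear hcon (hlin m) (hne m) hrm hpm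
      have hpq : pt i j ≠ pt k l := fun h => hN.notMem hij hik.symm hjk.symm (hpt1 i j) (hpt2 i j)
        (h ▸ hpt1 k l)
      have h2 := zeroLocus_eq_of_linear hcon (lineThrough_isHomogeneous (pt i j) (pt k l))
        (lineThrough_ne_zero hpq) hr (left_mem_lineThrough _ _)
      refine hN.notMem hkl hmk hml (hpt1 k l) (hpt2 k l) ?_
      rw [h1, ← h2]
      exact right_mem_lineThrough _ _
    rcases hrF with h | h
    · exact key i hik hil h (hpt1 i j)
    · exact key j hjk hjl h (hpt2 i j)
  have hptsymm : ∀ i j : Fin 4, i ≠ j → pt i j = pt j i := fun i j hij =>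
    huniq hij.symm (hpt2 i j) (hpt1 i j)
  have hptne : ∀ i j k l : Fin 4, i ≠ j → i ≠ k → j ≠ k → pt i j ≠ pt k l :=
    fun i j k l hij hik hjk h => hN.notMem hij hik.symm hjk.symm (hpt1 i j) (hpt2 i j)
        (h ▸ hpt1 k l)
  have hΛsymm : ∀ i j k l : Fin 4, i ≠ j → i ≠ k → j ≠ k →
      zeroLocus (Λ i j k l) = zeroLocus (Λ k l i j) := by
    intro i j k l hij hik hjk
    have h := hptne i j k l hij hik hjk
    exact (zeroLocus_eq_of_linear h (lineThrough_isHomogeneous (pt k l) (pt i j))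
      (lineThrough_ne_zero h.symm) (right_mem_lineThrough _ _) (left_mem_lineThrough _ _)).symm
  have hmem : ∀ i j k l : Fin 4, i ≠ j → i ≠ k → i ≠ l → j ≠ k → j ≠ l → k ≠ l →
      zeroLocus (Λ i j k l) ∈ hypDeg (union F) 1 := by
    intro i j k l hij hik hil hjk hjl hkl
    refine mem_hypDeg_one_of_linear (p := pt i j) (q := pt k l) (lineThrough_isHomogeneous _ _)
      (lineThrough_ne_zero (hptne i j k l hij hik hjk)) fun r hr hrU => ?_
    obtain ⟨m, hm⟩ := Set.mem_iUnion.mp hrU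
    have hcases : m = i ∨ m = j ∨ m = k ∨ m = l := by omega
    have hr' := hr
    change r ∈ zeroLocus (Λ i j k l) at hr'
    rw [hΛsymm i j k l hij hik hjk] at hr'
    rcases hcases with rfl | rfl | rfl | rfl
    · exact Or.inl (hcap m j k l hij hik hil hjk hjl hkl r hr (Or.inl hm))
    · exact Or.inl (hcap i m k l hij hik hil hjk hjl hkl r hr (Or.inr hm))
    · exact Or.inr (hcap m l i j hkl hik.symm hjk.symm hil.symm hjl.symm hij r hr' (Or.inl hm))
    · exact Or.inr (hcap k m i j hkl hik.symm hjk.symm hil.symm hjl.symm hij r hr' (Or.inr hm))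
  have hset : hypDeg (union F) 1 =
      {zeroLocus (Λ 0 1 2 3), zeroLocus (Λ 0 2 1 3), zeroLocus (Λ 0 3 1 2)} := by
    refine Set.Subset.antisymm (fun C hC => ?_) ?_
    · obtain ⟨-, -, p, q, i, j, k, l, h, hCl, -, -⟩ := exists_contact_of_mem_hypDeg le_rfl hN hC
      have key : ∀ {p q i j k l}, Contact F C p q i j k l → C = zeroLocus (lineThrough p q) →
          i = 0 → C ∈ ({zeroLocus (Λ 0 1 2 3), zeroLocus (Λ 0 2 1 3), zeroLocus (Λ 0 3 1 2)} :
            Set (Set Plane)) := by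
        rintro p q i j k l h hCl rfl
        obtain ⟨hpq, hij, hkl, hik, hil, hjk, hjl, -, -, hpi, hpj, hqk, hql, -, -, -, -⟩ := h
        have hp := huniq hij hpi hpj
        have hC1 : ∀ k l, k ≠ l → q ∈ zeroLocus (F k) → q ∈ zeroLocus (F l) →
            C = zeroLocus (Λ 0 j k l) := fun k l hkl hk hl => by
          rw [hCl, hp, huniq hkl hk hl]
        have hC2 : C = zeroLocus (Λ 0 j (min k l) (max k l)) := by
          rcases lt_or_gt_of_ne hkl with h | h
          · rw [min_eq_left h.le, max_eq_right h.le]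
            exact hC1 k l hkl hqk hql
          · rw [min_eq_right h.le, max_eq_left h.le]
            exact hC1 l k hkl.symm hql hqk
        have h3 := pairing_cases j k l hij hkl hik hil hjk hjl
        rcases h3 with ⟨rfl, h1, h2⟩ | ⟨rfl, h1, h2⟩ | ⟨rfl, h1, h2⟩ <;> rw [h1, h2] at hC2 <;>
          simp [hC2]
      have hCl' : C = zeroLocus (lineThrough q p) := by
        rw [hCl]
        exact zeroLocus_eq_of_linear h.ne.symm (lineThrough_isHomogeneous p q)
          (lineThrough_ne_zero h.ne) (right_mem_lineThrough _ _) (left_mem_lineThrough _ _)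
      have hcases : i = 0 ∨ j = 0 ∨ k = 0 ∨ l = 0 := by
        have h1 := h.ij; have h2 := h.kl; have h3 := h.ik; have h4 := h.il
        have h5 := h.jk; have h6 := h.jl
        omega
      rcases hcases with h0 | h0 | h0 | h0
      · exact key h hCl h0
      · exact key h.swap hCl h0
      · exact key h.symm hCl' h0
      · exact key h.symm.swap hCl' h0
    · rintro C (rfl | rfl | rfl) <;> exact hmem _ _ _ _ (by decide) (by decide) (by decide)
        (by decide) (by decide) (by decide)
  -- If the two lines agreed, `pt i k` would lie on the first one, hence equal `pt i j` by `hcap`, a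
  -- point on three components.
  have hdist : ∀ i j k l : Fin 4, i ≠ j → i ≠ k → i ≠ l → j ≠ k → j ≠ l → k ≠ l →
      ∀ m n, zeroLocus (Λ i j k l) ≠ zeroLocus (Λ i k m n) := by
    intro i j k l hij hik hil hjk hjl hkl m n h
    have h1 : pt i k ∈ zeroLocus (Λ i j k l) := h ▸ left_mem_lineThrough _ _
    have h2 := hcap i j k l hij hik hil hjk hjl hkl _ h1 (Or.inl (hpt1 i k))
    exact hN.notMem hij hik.symm hjk.symm (hpt1 i j) (hpt2 i j) (h2 ▸ hpt2 i k)
  have hd1 : zeroLocus (Λ 0 1 2 3) ≠ zeroLocus (Λ 0 2 1 3) :=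
    hdist _ _ _ _ (by decide) (by decide) (by decide) (by decide) (by decide) (by decide) _ _
  have hd2 : zeroLocus (Λ 0 1 2 3) ≠ zeroLocus (Λ 0 3 1 2) := by
    -- In `hdist` the third index of the first line is the partner of `i` in the second.
    have : Λ 0 1 2 3 = Λ 0 1 3 2 := by rw [hΛ]; simp only [hptsymm 2 3 (by decide)]
    rw [this]
    exact hdist _ _ _ _ (by decide) (by decide) (by decide) (by decide) (by decide) (by decide) _ _
  have hd3 : zeroLocus (Λ 0 2 1 3) ≠ zeroLocus (Λ 0 3 1 2) := by
    have : Λ 0 2 1 3 = Λ 0 2 3 1 := by rw [hΛ]; simp only [hptsymm 1 3 (by decide)]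
    rw [this]
    exact hdist _ _ _ _ (by decide) (by decide) (by decide) (by decide) (by decide) (by decide) _ _
  rw [hset, Set.encard_insert_of_notMem (by simp [hd1, hd2]), Set.encard_pair hd3]
  norm_num

theorem encard_hypDeg_one_of_sum_eq_four {c : ℕ} (hc : 4 ≤ c) {b : Fin c → ℕ} {F : Fin c → Poly}
    (hN : IsNodalUnion b F) (hb : ∑ i, b i = 4) : (hypDeg (union F) 1).encard = 3 := by
  have h1 : ∑ _i : Fin c, 1 ≤ ∑ i, b i := Finset.sum_le_sum fun i _ => hN.one_le i
  have hc4 : c = 4 := by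
    simp only [Finset.sum_const, Finset.card_univ, Fintype.card_fin, smul_eq_mul, mul_one] at h1
    omega
  subst hc4
  refine encard_hypDeg_one hN fun i => ?_
  have h2 : ∑ i : Fin 4, 1 = ∑ i, b i := by rw [hb]; simp
  exact ((Finset.sum_eq_sum_iff_of_le fun i _ => hN.one_le i).mp h2 i (Finset.mem_univ i)).symm

end PlaneCurve
-- General tuples of forms: counting parameters
namespace PlaneCurve

/-- Fewer parameters than coordinates satisfy a relation. -/
theorem exists_relation_of_card_lt {ι τ : Type*} [Fintype ι] [Fintype τ]
    (h : Fintype.card τ < Fintype.card ι) (f : ι → MvPolynomial τ ℂ) :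
    ∃ Ψ : MvPolynomial ι ℂ, Ψ ≠ 0 ∧ aeval f Ψ = 0 := by
  have hna : ¬ AlgebraicIndependent ℂ f := by
    intro hf
    have := hf.lift_cardinalMk_le_trdeg
    rw [MvPolynomial.trdeg_of_isDomain] at this
    simp only [Cardinal.mk_fintype, Cardinal.lift_natCast, Nat.cast_le] at this
    omega
  rw [algebraicIndependent_iff] at hna
  push Not at hna
  obtain ⟨Ψ, h1, h2⟩ := hna
  exact ⟨Ψ, h2, h1⟩

theorem eval_aeval_eq {σ τ : Type*} (g : τ → MvPolynomial σ ℂ) (t : σ → ℂ) (R : MvPolynomial τ ℂ) :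
    eval (fun s => eval t (g s)) R = eval t (aeval g R) := by
  induction R using MvPolynomial.induction_on with
  | C a => simp
  | add f g hf hg => simp [hf, hg]
  | mul_X f i hf => simp [hf]

/-- Polynomial functions. -/
def IsPoly {σ : Type*} (f : (σ → ℂ) → ℂ) : Prop := ∃ R : MvPolynomial σ ℂ, ∀ x, f x = eval x R

namespace IsPoly
variable {σ : Type*} {f g : (σ → ℂ) → ℂ}

theorem const (a : ℂ) : IsPoly (fun _ : σ → ℂ => a) := ⟨C a, fun x => by simp⟩

theorem coord (s : σ) : IsPoly (fun x : σ → ℂ => x s) := ⟨X s, fun x => by simp⟩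

theorem add (hf : IsPoly f) (hg : IsPoly g) : IsPoly (fun x => f x + g x) := by
  obtain ⟨R, hR⟩ := hf
  obtain ⟨S, hS⟩ := hg
  exact ⟨R + S, fun x => by simp [hR, hS]⟩

theorem mul (hf : IsPoly f) (hg : IsPoly g) : IsPoly (fun x => f x * g x) := by
  obtain ⟨R, hR⟩ := hf
  obtain ⟨S, hS⟩ := hg
  exact ⟨R * S, fun x => by simp [hR, hS]⟩

theorem neg (hf : IsPoly f) : IsPoly (fun x => - f x) := by
  obtain ⟨R, hR⟩ := hf
  exact ⟨-R, fun x => by simp [hR]⟩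

theorem sum {ι : Type*} (s : Finset ι) {f : ι → (σ → ℂ) → ℂ} (hf : ∀ i ∈ s, IsPoly (f i)) :
    IsPoly (fun x => ∑ i ∈ s, f i x) := by
  classical
  induction s using Finset.induction_on with
  | empty => simpa using const 0
  | insert a s ha ih =>
    simp only [Finset.sum_insert ha]
    exact (hf a (Finset.mem_insert_self a s)).add
      (ih fun i hi => hf i (Finset.mem_insert_of_mem hi))

theorem eval {p : Fin 3 → (σ → ℂ) → ℂ} (hp : ∀ l, IsPoly (p l)) (H : Poly) :
    IsPoly (fun x => MvPolynomial.eval (fun l => p l x) H) := by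
  induction H using MvPolynomial.induction_on with
  | C a => simpa using const a
  | add f g hf hg => simpa using hf.add hg
  | mul_X f i hf => simpa using hf.mul (hp i)

end IsPoly

variable {c : ℕ}

/-- The coefficients of a tuple of forms. -/
noncomputable def coeffs (F : Fin c → Poly) (k : Fin c × (Fin 3 →₀ ℕ)) : ℂ := coeff k.2 (F k.1)

/-- The form of degree `n` with given coefficients. -/
noncomputable def toForm (n : ℕ) (x : (Fin 3 →₀ ℕ) → ℂ) : Poly := ∑ m ∈ expts n, monomial m (x m)

theorem toForm_isHomogeneous (n : ℕ) (x : (Fin 3 →₀ ℕ) → ℂ) : (toForm n x).IsHomogeneous n :=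
  IsHomogeneous.sum _ _ _ fun _ hm => isHomogeneous_monomial _ (mem_expts.mp hm)

theorem coeff_toForm (n : ℕ) (x : (Fin 3 →₀ ℕ) → ℂ) (m : Fin 3 →₀ ℕ) :
    coeff m (toForm n x) = if m ∈ expts n then x m else 0 := by
  classical
  simp [toForm, coeff_sum, coeff_monomial]

theorem coeff_eq_zero_of_notMem {F : Poly} {n : ℕ} (hF : F.IsHomogeneous n) {m : Fin 3 →₀ ℕ}
    (hm : m ∉ expts n) : coeff m F = 0 :=
  hF.coeff_eq_zero (fun h => hm (mem_expts.mpr h))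

theorem ForGeneral.mono {b : Fin c → ℕ} {Q R : (Fin c → Poly) → Prop} (hQ : ForGeneral b Q)
    (h : ∀ F, (∀ i, (F i).IsHomogeneous (b i)) → Q F → R F) : ForGeneral b R := by
  obtain ⟨Φ, h1, h2⟩ := hQ
  exact ⟨Φ, h1, fun F hF h0 => h F hF (h2 F hF h0)⟩

/-- Nonempty open subsets of an affine space meet. The map `ρ` restricts to that space by setting to
zero the coefficients of exponents of the wrong degree; without it, nonvanishing of a product could
be witnessed only outside the space of forms. -/
theorem ForGeneral.and {b : Fin c → ℕ} {Q R : (Fin c → Poly) → Prop} (hQ : ForGeneral b Q)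
    (hR : ForGeneral b R) : ForGeneral b (fun F => Q F ∧ R F) := by
  classical
  obtain ⟨Φ, ⟨F, hF, hF0⟩, hΦ⟩ := hQ
  obtain ⟨Ψ, ⟨G, hG, hG0⟩, hΨ⟩ := hR
  refine ⟨Φ * Ψ, ?_, fun H hH h0 => ?_⟩
  · let ρ : MvPolynomial (Fin c × (Fin 3 →₀ ℕ)) ℂ →ₐ[ℂ] MvPolynomial (Fin c × (Fin 3 →₀ ℕ)) ℂ :=
      aeval fun k => if k.2 ∈ expts (b k.1) then X k else 0
    have hρ : ∀ x Φ, eval x (ρ Φ) = eval (fun k => if k.2 ∈ expts (b k.1) then x k else 0) Φ := by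
      intro x Φ
      induction Φ using MvPolynomial.induction_on with
      | C a => simp
      | add f g hf hg => simp [hf, hg]
      | mul_X f i hf => rw [map_mul, map_mul, hf, map_mul, eval_X]; simp [ρ]; split_ifs <;> simp
    have hne : ∀ (Φ : MvPolynomial (Fin c × (Fin 3 →₀ ℕ)) ℂ) (F : Fin c → Poly),
        (∀ i, (F i).IsHomogeneous (b i)) → eval (fun k => coeff k.2 (F k.1)) Φ ≠ 0 → ρ Φ ≠ 0 := by
      intro Φ F hF h h0
      refine h ?_
      have h1 := hρ (fun k => coeff k.2 (F k.1)) Φ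
      rw [h0, map_zero] at h1
      rw [h1]
      congr 2
      funext k
      split_ifs with hk
      · rfl
      · exact coeff_eq_zero_of_notMem (hF k.1) hk
    have h1 : ρ (Φ * Ψ) ≠ 0 := by
      rw [map_mul]
      exact mul_ne_zero (hne Φ F hF hF0) (hne Ψ G hG hG0)
    obtain ⟨x, hx⟩ : ∃ x, eval x (ρ (Φ * Ψ)) ≠ 0 := by
      by_contra! hcon
      exact h1 (MvPolynomial.funext fun x => by rw [hcon, map_zero])
    refine ⟨fun i => toForm (b i) fun m => x (i, m), fun i => toForm_isHomogeneous _ _, ?_⟩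
    rw [hρ] at hx
    simpa only [coeff_toForm] using hx
  · rw [map_mul] at h0
    exact ⟨hΦ H hH (left_ne_zero_of_mul h0), hΨ H hH (right_ne_zero_of_mul h0)⟩

theorem ForGeneral.of_forall {b : Fin c → ℕ} {Q : (Fin c → Poly) → Prop} (h : ∀ F,
    (∀ i, (F i).IsHomogeneous (b i)) → Q F) : ForGeneral b Q :=
  ⟨1, ⟨fun _ => 0, fun _ => isHomogeneous_zero _ _ _, by simp⟩, fun F hF _ => h F hF⟩

theorem ForGeneral.forall_mem {b : Fin c → ℕ} {ι : Type*} (s : Finset ι)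
    {Q : ι → (Fin c → Poly) → Prop} (h : ∀ i ∈ s, ForGeneral b (Q i)) :
    ForGeneral b (fun F => ∀ i ∈ s, Q i F) := by
  classical
  induction s using Finset.induction_on with
  | empty => exact ForGeneral.of_forall fun F _ => by simp
  | insert a s ha ih =>
    refine ((h a (Finset.mem_insert_self a s)).and
      (ih fun i hi => h i (Finset.mem_insert_of_mem hi))).mono fun F _ hF i hi => ?_
    rcases Finset.mem_insert.mp hi with rfl | hi
    · exact hF.1
    · exact hF.2 i hi

theorem ForGeneral.forall {b : Fin c → ℕ} {ι : Type*} [Finite ι]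
    {Q : ι → (Fin c → Poly) → Prop} (h : ∀ i, ForGeneral b (Q i)) :
    ForGeneral b (fun F => ∀ i, Q i F) := by
  have := Fintype.ofFinite ι
  exact (ForGeneral.forall_mem Finset.univ fun i _ => h i).mono fun F _ hF i =>
    hF i (Finset.mem_univ i)

/-- A family of tuples of forms in which more coefficients are determined, polynomially, by the
other ones and parameters than there are parameters, is avoided by a general tuple. -/
theorem ForGeneral.not_of_solvable {b : Fin c → ℕ} (κ : Fin c → Finset (Fin 3 →₀ ℕ))
    (hκ : ∀ i, κ i ⊆ expts (b i)) {τ : Type} [Fintype τ]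
    (hcard : Fintype.card τ < ∑ i, (κ i).card) (Bad : (Fin c → Poly) → (τ → ℂ) → Prop)
    (h : ∀ i, ∀ m ∈ κ i, ∃ r : (τ ⊕ Fin c × (Fin 3 →₀ ℕ) → ℂ) → ℂ, IsPoly r ∧
      ∀ F θ, (∀ i, (F i).IsHomogeneous (b i)) → Bad F θ → coeff m (F i) =
        r (Sum.elim θ fun k => if k.2 ∈ κ k.1 then 0 else coeffs F k)) :
    ForGeneral b (fun F => ∀ θ, ¬ Bad F θ) := by
  classical
  choose r hr hF using h
  choose R hR using hr
  let ι := {k : Fin c × (Fin 3 →₀ ℕ) // k.2 ∈ expts (b k.1)}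
  let e : ι ≃ Σ i : Fin c, expts (b i) :=
    { toFun := fun k => ⟨k.1.1, ⟨k.1.2, k.2⟩⟩
      invFun := fun k => ⟨(k.1, k.2.1), k.2.2⟩
      left_inv := fun _ => rfl
      right_inv := fun _ => rfl }
  let e' : {k : ι // k.1.2 ∈ κ k.1.1} ≃ Σ i : Fin c, κ i :=
    { toFun := fun k => ⟨k.1.1.1, ⟨k.1.1.2, k.2⟩⟩
      invFun := fun k => ⟨⟨(k.1, k.2.1), hκ _ k.2.2⟩, k.2.2⟩
      left_inv := fun _ => rfl
      right_inv := fun _ => rfl }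
  have : Fintype ι := Fintype.ofEquiv _ e.symm
  have hcard' : Fintype.card {k : ι // k.1.2 ∈ κ k.1.1} = ∑ i, (κ i).card := by
    rw [Fintype.card_congr e', Fintype.card_sigma]
    simp
  have hle := Fintype.card_subtype_le fun k : ι => k.1.2 ∈ κ k.1.1
  -- Bad tuples are polynomial images of the parameters and the coefficients outside `κ`. These are
  -- fewer than all coefficients, so the coordinates `f` of the image satisfy a relation `Ψ`, which
  -- defines the open set.
  let σ := τ ⊕ {k : ι // ¬ k.1.2 ∈ κ k.1.1}
  have hlt : Fintype.card σ < Fintype.card ι := by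
    rw [Fintype.card_sum, Fintype.card_subtype_compl]
    omega
  -- Coefficients in `κ` are replaced by zero, matching the argument of `r`, which must not use the
  -- coefficients it solves for.
  let sub : τ ⊕ Fin c × (Fin 3 →₀ ℕ) → MvPolynomial σ ℂ := Sum.elim (fun t => X (Sum.inl t))
    fun k => if hk : k.2 ∈ expts (b k.1) ∧ ¬ k.2 ∈ κ k.1 then X (Sum.inr ⟨⟨k, hk.1⟩, hk.2⟩) else 0
  let f : ι → MvPolynomial σ ℂ := fun k =>
    if hk : k.1.2 ∈ κ k.1.1 then aeval sub (R k.1.1 k.1.2 hk) else X (Sum.inr ⟨k, hk⟩)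
  obtain ⟨Ψ, hΨ, hf⟩ := exists_relation_of_card_lt hlt f
  refine ⟨rename Subtype.val Ψ, ?_, fun F hFh h0 θ hbad => h0 ?_⟩
  · obtain ⟨x, hx⟩ : ∃ x, eval x Ψ ≠ 0 := by
      by_contra! hcon
      exact hΨ (MvPolynomial.funext fun x => by rw [hcon, map_zero])
    refine ⟨fun i => toForm (b i) fun m => if hm : m ∈ expts (b i) then x ⟨(i, m), hm⟩ else 0,
      fun i => toForm_isHomogeneous _ _, ?_⟩
    rw [eval_rename]
    convert hx using 2
    refine congrArg eval (funext fun k => ?_)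
    rw [Function.comp_apply, coeff_toForm, if_pos k.2, dif_pos k.2]
  · rw [eval_rename]
    let t : σ → ℂ := Sum.elim θ fun k => coeffs F k.1.1
    have hsub : (fun s => eval t (sub s)) =
        Sum.elim θ fun k => if k.2 ∈ κ k.1 then 0 else coeffs F k := by
      funext s
      rcases s with s | k
      · simp [sub, t]
      · simp only [sub, Sum.elim_inr]
        by_cases hk : k.2 ∈ κ k.1
        · simp [hk]
        · by_cases hk' : k.2 ∈ expts (b k.1)
          · simp [hk, hk', t]
          · simp only [hk', hk, false_and, dif_neg, not_false_iff, if_false, map_zero]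
            exact (coeff_eq_zero_of_notMem (hFh k.1) hk').symm
    have heq : (fun k => coeff k.2 (F k.1)) ∘ (Subtype.val : ι → Fin c × (Fin 3 →₀ ℕ)) =
        fun k => eval t (f k) := by
      funext k
      simp only [Function.comp_apply, f]
      split_ifs with hk
      · rw [hF k.1.1 k.1.2 hk F θ hFh hbad, hR, ← hsub]
        exact eval_aeval_eq sub t _
      · simp [t, coeffs]
    rw [heq]
    have := congrArg (eval t) hf
    rw [map_zero] at this
    rw [← this]
    exact eval_aeval_eq f t Ψ

end PlaneCurve
-- Incidence and tangency conditions solved for coefficients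
namespace PlaneCurve

variable {c : ℕ}

/-- Evaluating a linear operation on a form is polynomial in the coefficients and the point. -/
theorem IsPoly.eval_toForm {σ : Type*} {p : Fin 3 → (σ → ℂ) → ℂ} (hp : ∀ l, IsPoly (p l))
    (D : Poly →ₗ[ℂ] Poly) (n : ℕ) {y : (Fin 3 →₀ ℕ) → (σ → ℂ) → ℂ} (hy : ∀ m, IsPoly (y m)) :
    IsPoly (fun x => MvPolynomial.eval (fun l => p l x) (D (toForm n fun m => y m x))) := by
  have : ∀ x, MvPolynomial.eval (fun l => p l x) (D (toForm n fun m => y m x)) =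
      ∑ m ∈ expts n, y m x * MvPolynomial.eval (fun l => p l x) (D (monomial m 1)) := by
    intro x
    rw [toForm, map_sum, map_sum]
    refine Finset.sum_congr rfl fun m _ => ?_
    rw [← mul_one (y m x), ← smul_eq_mul, ← smul_monomial, map_smul, smul_eval, smul_eq_mul, mul_one]
  simp only [this]
  exact IsPoly.sum _ fun m _ => (hy m).mul (IsPoly.eval hp _)

/-- A form as the sum of its terms with exponents outside and inside `κ`. -/
theorem eq_toForm_add {F : Poly} {n : ℕ} (hF : F.IsHomogeneous n)
    (κ : Finset (Fin 3 →₀ ℕ)) :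
    F = toForm n (fun m => if m ∈ κ then 0 else coeff m F) + ∑ m ∈ κ, monomial m (coeff m F) := by
  classical
  ext m
  rw [coeff_add, coeff_toForm, coeff_sum]
  simp only [coeff_monomial, Finset.sum_ite_eq']
  by_cases h1 : m ∈ κ
  · simp [h1]
  · by_cases h2 : m ∈ expts n
    · simp [h1, h2]
    · simp [h1, h2, coeff_eq_zero_of_notMem hF h2]

/-- The exponent of `X k ^ n`. -/
noncomputable def exptPow (k : Fin 3) (n : ℕ) : Fin 3 →₀ ℕ := Finsupp.single k n

/-- The exponent of `X l * X k ^ n`. -/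
noncomputable def exptMulPow (l k : Fin 3) (n : ℕ) : Fin 3 →₀ ℕ :=
  Finsupp.single l 1 + Finsupp.single k n

theorem exptPow_mem (k : Fin 3) (n : ℕ) : exptPow k n ∈ expts n := by
  simp [mem_expts, exptPow]

theorem exptMulPow_mem (l k : Fin 3) (n : ℕ) : exptMulPow l k n ∈ expts (n + 1) := by
  simp [mem_expts, exptMulPow, add_comm]

theorem exptPow_ne_exptMulPow {l k : Fin 3} (h : l ≠ k) (n : ℕ) :
    exptPow k (n + 1) ≠ exptMulPow l k n := by
  intro he
  have := DFunLike.congr_fun he l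
  simp [exptPow, exptMulPow, h.symm] at this

theorem monomial_exptPow (k : Fin 3) (n : ℕ) (a : ℂ) :
    (monomial (exptPow k n) a : Poly) = C a * X k ^ n := by
  rw [exptPow, X_pow_eq_monomial, C_mul_monomial, mul_one]

theorem monomial_exptMulPow (l k : Fin 3) (n : ℕ) (a : ℂ) :
    (monomial (exptMulPow l k n) a : Poly) = C a * (X l * X k ^ n) := by
  rw [exptMulPow, X_pow_eq_monomial, X, monomial_mul, C_mul_monomial, mul_one, mul_one]

/-- The derivative in the direction `v`, at the point `p`. -/
theorem dot_grad_monomial_exptPow {k : Fin 3} {v p : Fin 3 → ℂ} (hv : v k = 0) (n : ℕ) (a : ℂ) :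
    ∑ m, v m * eval p (pderiv m (monomial (exptPow k n) a)) = 0 := by
  refine Finset.sum_eq_zero fun m _ => ?_
  rw [monomial_exptPow]
  by_cases h : m = k
  · subst h
    rw [hv, zero_mul]
  · simp [Derivation.leibniz, pderiv_X_of_ne (Ne.symm h), Derivation.leibniz_pow]

theorem dot_grad_monomial_exptMulPow {l k : Fin 3} {v p : Fin 3 → ℂ} (hv : v k = 0)
    (hvl : v l = 1) (hp : p k = 1) (n : ℕ) (a : ℂ) :
    ∑ m, v m * eval p (pderiv m (monomial (exptMulPow l k n) a)) = a := by
  rw [Finset.sum_eq_single l, monomial_exptMulPow, hvl]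
  · have h : l ≠ k := by
      rintro rfl
      exact zero_ne_one (hv.symm.trans hvl)
    simp [Derivation.leibniz, pderiv_X_of_ne (Ne.symm h), Derivation.leibniz_pow, hp]
  · intro m _ hm
    rw [monomial_exptMulPow]
    by_cases h : m = k
    · subst h
      rw [hv, zero_mul]
    · simp [Derivation.leibniz, pderiv_X_of_ne (Ne.symm h), pderiv_X_of_ne (Ne.symm hm),
        Derivation.leibniz_pow]
  · simp

/-- Incidence conditions: the curves in `s₀` touch at `p` the line in direction `v`, those in `s₁`
pass through `p`, those in `s₂` through `q`. -/
theorem ForGeneral.not_incident {b : Fin c → ℕ} (hb : ∀ i, 1 ≤ b i) {k l n : Fin 3} {τ : Type}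
    [Fintype τ] {p v q : Fin 3 → (τ → ℂ) → ℂ}
    (hp : ∀ m, IsPoly (p m)) (hv : ∀ m, IsPoly (v m)) (hq : ∀ m, IsPoly (q m))
    (hpk : ∀ θ, p k θ = 1) (hvk : ∀ θ, v k θ = 0) (hvl : ∀ θ, v l θ = 1) (hqn : ∀ θ, q n θ = 1)
    {s₀ s₁ s₂ : Finset (Fin c)} (h01 : Disjoint s₀ s₁) (h02 : Disjoint s₀ s₂) (h12 : Disjoint s₁ s₂)
    (hcard : Fintype.card τ < 2 * s₀.card + s₁.card + s₂.card) :
    ForGeneral b (fun F => ∀ θ, ¬ ((∀ i ∈ s₀, eval (fun m => p m θ) (F i) = 0 ∧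
        ∑ m, v m θ * grad (F i) (fun m => p m θ) m = 0) ∧
      (∀ i ∈ s₁, eval (fun m => p m θ) (F i) = 0) ∧
      ∀ i ∈ s₂, eval (fun m => q m θ) (F i) = 0)) := by
  classical
  have hlk : l ≠ k := by
    rintro rfl
    exact zero_ne_one ((hvk 0).symm.trans (hvl 0))
  obtain ⟨b', rfl⟩ : ∃ b' : Fin c → ℕ, b = fun i => b' i + 1 :=
    ⟨fun i => b i - 1, funext fun i => (Nat.sub_add_cancel (hb i)).symm⟩
  -- Since `p k = 1`, vanishing at `p` determines the coefficient of the pure power of `X k`;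
  -- likewise `X n` for `q`. Tangency determines that of `X l * X k ^ b' i`, whose derivative along
  -- `v` at `p` is one, while that of the pure power of `X k` is zero.
  set κ : Fin c → Finset (Fin 3 →₀ ℕ) := fun i =>
    if i ∈ s₀ then {exptPow k (b' i + 1), exptMulPow l k (b' i)}
    else if i ∈ s₁ then {exptPow k (b' i + 1)}
    else if i ∈ s₂ then {exptPow n (b' i + 1)} else ∅ with hκdef
  have hκ : ∀ i, κ i ⊆ expts (b' i + 1) := by
    intro i
    simp only [hκdef]
    split_ifs
    · simp [Finset.insert_subset_iff, exptPow_mem, exptMulPow_mem]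
    · simp [exptPow_mem]
    · simp [exptPow_mem]
    · simp
  have hcardκ : ∑ i, (κ i).card = 2 * s₀.card + s₁.card + s₂.card := by
    have h1 : ∀ i, (κ i).card =
        (if i ∈ s₀ then 2 else 0) + (if i ∈ s₁ then 1 else 0) + (if i ∈ s₂ then 1 else 0) := by
      intro i
      simp only [hκdef]
      by_cases h0 : i ∈ s₀
      · simp [h0, Finset.disjoint_left.mp h01 h0, Finset.disjoint_left.mp h02 h0,
          Finset.card_pair (exptPow_ne_exptMulPow hlk _)]
      · by_cases h1 : i ∈ s₁
        · simp [h0, h1, Finset.disjoint_left.mp h12 h1]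
        · by_cases h2 : i ∈ s₂ <;> simp [h0, h1, h2]
    simp only [h1, Finset.sum_add_distrib, Finset.sum_ite_mem, Finset.univ_inter, Finset.sum_const,
      smul_eq_mul, mul_one]
    ring
  have hinl : ∀ {f : (τ → ℂ) → ℂ}, IsPoly f →
      IsPoly (fun x : τ ⊕ Fin c × (Fin 3 →₀ ℕ) → ℂ => f fun t => x (Sum.inl t)) := by
    rintro f ⟨R, hR⟩
    exact ⟨rename Sum.inl R, fun x => by rw [eval_rename]; exact hR _⟩
  have hval : ∀ {a : Fin 3 → (τ → ℂ) → ℂ}, (∀ m, IsPoly (a m)) → ∀ (D : Poly →ₗ[ℂ] Poly) (i : Fin c),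
      IsPoly (fun x : τ ⊕ Fin c × (Fin 3 →₀ ℕ) → ℂ => eval (fun m => a m fun t => x (Sum.inl t))
        (D (toForm (b' i + 1) fun m => x (Sum.inr (i, m))))) := fun ha D i =>
    IsPoly.eval_toForm (fun m => hinl (ha m)) D _ (fun m => IsPoly.coord _)
  refine ForGeneral.not_of_solvable κ hκ (by omega) (fun F θ => (∀ i ∈ s₀,
        eval (fun m => p m θ) (F i) = 0 ∧
        ∑ m, v m θ * grad (F i) (fun m => p m θ) m = 0) ∧
      (∀ i ∈ s₁, eval (fun m => p m θ) (F i) = 0) ∧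
      ∀ i ∈ s₂, eval (fun m => q m θ) (F i) = 0) fun i m hm => ?_
  by_cases h0 : i ∈ s₀
  · have hκi : κ i = {exptPow k (b' i + 1), exptMulPow l k (b' i)} := by simp [hκdef, h0]
    set r : (τ ⊕ Fin c × (Fin 3 →₀ ℕ) → ℂ) → ℂ := fun x =>
      -∑ m, v m (fun t => x (Sum.inl t)) * eval (fun m => p m fun t => x (Sum.inl t))
        ((pderiv m).toLinearMap (toForm (b' i + 1) fun m => x (Sum.inr (i, m)))) with hr
    have hrP : IsPoly r := (IsPoly.sum _ fun m _ => (hinl (hv m)).mul (hval hp _ i)).neg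
    have hsplit : ∀ F : Fin c → Poly, (∀ i, (F i).IsHomogeneous (b' i + 1)) → F i =
        toForm (b' i + 1) (fun m => if m ∈ κ i then 0 else coeff m (F i)) +
        (monomial (exptPow k (b' i + 1)) (coeff (exptPow k (b' i + 1)) (F i)) +
          monomial (exptMulPow l k (b' i)) (coeff (exptMulPow l k (b' i)) (F i))) := by
      intro F hF
      have := eq_toForm_add (hF i) (κ i)
      rwa [hκi, Finset.sum_pair (exptPow_ne_exptMulPow hlk _), ← hκi] at this
    have hl : ∀ F : Fin c → Poly, ∀ θ : τ → ℂ, (∀ i, (F i).IsHomogeneous (b' i + 1)) →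
        ∑ m, v m θ * grad (F i) (fun m => p m θ) m = 0 → coeff (exptMulPow l k (b' i)) (F i) =
        r (Sum.elim θ fun k => if k.2 ∈ κ k.1 then 0 else coeffs F k) := by
      intro F θ hF hbad
      simp only [grad] at hbad
      rw [hsplit F hF] at hbad
      simp only [map_add, mul_add, Finset.sum_add_distrib] at hbad
      rw [dot_grad_monomial_exptPow (v := fun m => v m θ) (hvk θ),
        dot_grad_monomial_exptMulPow (v := fun m => v m θ) (p := fun m => p m θ) (hvk θ) (hvl θ)
          (hpk θ)] at hbad
      simp only [hr, Sum.elim_inl, Sum.elim_inr, coeffs]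
      rw [zero_add] at hbad
      exact eq_neg_of_add_eq_zero_right hbad
    rw [hκi, Finset.mem_insert, Finset.mem_singleton] at hm
    rcases hm with rfl | rfl
    -- The system is triangular: the coefficient `r` found from tangency is inserted into the
    -- equation of vanishing at `p`.
    · refine ⟨fun x => -(eval (fun m => p m fun t => x (Sum.inl t))
        (LinearMap.id (toForm (b' i + 1) fun m => x (Sum.inr (i, m)))) +
        r x * p l fun t => x (Sum.inl t)), ((hval hp LinearMap.id i).add (hrP.mul (hinl (hp l)))).neg,
        fun F θ hF hbad => ?_⟩
      obtain ⟨h1, h2⟩ := hbad.1 i h0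
      show _ = -(_ + r (Sum.elim θ fun k => if k.2 ∈ κ k.1 then 0 else coeffs F k) * _)
      rw [← hl F θ hF h2]
      rw [hsplit F hF, map_add, map_add, monomial_exptPow, monomial_exptMulPow] at h1
      simp only [map_mul, eval_C, map_pow, eval_X, hpk, one_pow, mul_one] at h1
      simp only [Sum.elim_inl, Sum.elim_inr, coeffs, LinearMap.id_apply]
      linear_combination h1
    · exact ⟨r, hrP, fun F θ hF hbad => hl F θ hF (hbad.1 i h0).2⟩
  · have hsingle : ∀ {a : Fin 3 → (τ → ℂ) → ℂ} {j : Fin 3}, (∀ m, IsPoly (a m)) →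
        (∀ θ, a j θ = 1) → κ i = {exptPow j (b' i + 1)} → m = exptPow j (b' i + 1) →
        ∃ r : (τ ⊕ Fin c × (Fin 3 →₀ ℕ) → ℂ) → ℂ, IsPoly r ∧ ∀ (F : Fin c → Poly) (θ : τ → ℂ),
          (∀ i, (F i).IsHomogeneous (b' i + 1)) → eval (fun m => a m θ) (F i) = 0 →
          coeff m (F i) = r (Sum.elim θ fun k => if k.2 ∈ κ k.1 then 0 else coeffs F k) := by
      intro a j ha haj hκi hm
      refine ⟨fun x => -(eval (fun m => a m fun t => x (Sum.inl t))
        (LinearMap.id (toForm (b' i + 1) fun m => x (Sum.inr (i, m))))),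
        (hval ha LinearMap.id i).neg, fun F θ hF h1 => ?_⟩
      have := eq_toForm_add (hF i) (κ i)
      rw [hκi, Finset.sum_singleton, ← hκi, ← hm] at this
      rw [this, map_add, hm, monomial_exptPow, ← hm] at h1
      simp only [map_mul, eval_C, map_pow, eval_X, haj, one_pow, mul_one] at h1
      simp only [Sum.elim_inl, Sum.elim_inr, coeffs, LinearMap.id_apply]
      linear_combination h1
    by_cases h1 : i ∈ s₁
    · have hκi : κ i = {exptPow k (b' i + 1)} := by simp [hκdef, h0, h1]
      obtain ⟨r, hr, hF⟩ := hsingle hp hpk hκi (by simpa [hκi] using hm)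
      exact ⟨r, hr, fun F θ hFh hbad => hF F θ hFh (hbad.2.1 i h1)⟩
    · by_cases h2 : i ∈ s₂
      · have hκi : κ i = {exptPow n (b' i + 1)} := by simp [hκdef, h0, h1, h2]
        obtain ⟨r, hr, hF⟩ := hsingle hq hqn hκi (by simpa [hκi] using hm)
        exact ⟨r, hr, fun F θ hFh hbad => hF F θ hFh (hbad.2.2 i h2)⟩
      · have hκi : κ i = ∅ := by simp [hκdef, h0, h1, h2]
        simp [hκi] at hm

end PlaneCurve
-- Irreducibility of general forms
namespace PlaneCurve

theorem homogeneousComponent_mul_totalDegree (G H : Poly) :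
    homogeneousComponent (G.totalDegree + H.totalDegree) (G * H) =
      homogeneousComponent G.totalDegree G * homogeneousComponent H.totalDegree H := by
  have hsum : G * H = ∑ j ∈ Finset.range (H.totalDegree + 1), G * homogeneousComponent j H := by
    rw [← Finset.mul_sum, sum_homogeneousComponent]
  rw [hsum, map_sum, Finset.sum_eq_single H.totalDegree]
  · exact homogeneousComponent_add_mul (homogeneousComponent_isHomogeneous _ _) _ _
  · intro j hj hne
    have hlt : j < H.totalDegree := by
      rw [Finset.mem_range] at hj
      omega
    obtain ⟨s, hs⟩ : ∃ s, G.totalDegree + H.totalDegree = s + j :=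
      ⟨G.totalDegree + H.totalDegree - j, by omega⟩
    rw [hs, homogeneousComponent_add_mul (homogeneousComponent_isHomogeneous _ _),
      homogeneousComponent_eq_zero _ _ (by omega), zero_mul]
  · simp

/-- A form without decompositions into forms of lower degree is irreducible. -/
theorem irreducible_of_isHomogeneous {F : Poly} {n : ℕ} (hF : F.IsHomogeneous n) (hn : 1 ≤ n)
    (hF0 : F ≠ 0) (h : ∀ e f, 1 ≤ e → 1 ≤ f → e + f = n → ∀ G H : Poly, G.IsHomogeneous e →
      H.IsHomogeneous f → F ≠ G * H) : Irreducible F := by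
  have hdeg := hF.totalDegree hF0
  refine irreducible_iff.mpr ⟨fun hu => ?_, fun {G H} hGH => ?_⟩
  · obtain ⟨r, -, rfl⟩ := isUnit_iff_eq_C_of_isReduced.mp hu
    rw [totalDegree_C] at hdeg
    omega
  · have hG : G ≠ 0 := by rintro rfl; simp [hGH] at hF0
    have hH : H ≠ 0 := by rintro rfl; simp [hGH] at hF0
    rw [hGH, totalDegree_mul_of_isDomain hG hH] at hdeg
    have key : ∀ G : Poly, G ≠ 0 → G.totalDegree = 0 → IsUnit G := by
      intro G hG h
      rw [totalDegree_eq_zero_iff_eq_C] at h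
      rw [h] at hG ⊢
      exact (IsUnit.mk0 _ (by simpa using hG)).map C
    -- The top-degree components of two nonconstant factors would multiply to `F`, a factorization
    -- into forms.
    by_contra! hcon
    refine h _ _ (Nat.one_le_iff_ne_zero.mpr fun h0 => hcon.1 (key G hG h0))
      (Nat.one_le_iff_ne_zero.mpr fun h0 => hcon.2 (key H hH h0)) hdeg _ _
      (homogeneousComponent_isHomogeneous _ G) (homogeneousComponent_isHomogeneous _ H) ?_
    rw [← homogeneousComponent_mul_totalDegree, ← hGH, hdeg, homogeneousComponent_of_mem hF, if_pos rfl]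

variable {c : ℕ} {b : Fin c → ℕ}

theorem ForGeneral.imp {P : Prop} {Q : (Fin c → Poly) → Prop} (h : P → ForGeneral b Q) :
    ForGeneral b (fun F => P → Q F) := by
  by_cases hP : P
  · exact (h hP).mono fun F _ hF _ => hF
  · exact ForGeneral.of_forall fun F _ hP' => absurd hP' hP

/-- The two sides differ by exactly `e * f`; the `- 1` is the coefficient lost by normalizing one
factor. -/
theorem card_expts_add_lt {e f : ℕ} (he : 1 ≤ e) (hf : 1 ≤ f) :
    (expts e).card - 1 + (expts f).card < (expts (e + f)).card := by
  have h1 := two_mul_card_expts e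
  have h2 := two_mul_card_expts f
  have h3 := two_mul_card_expts (e + f)
  have h4 : 1 ≤ e * f := Nat.mul_pos he hf
  have h5 : (e + f + 2) * (e + f + 1) = (e + 2) * (e + 1) + (f + 2) * (f + 1) + 2 * (e * f) - 2 := by
    have : (e + f + 2) * (e + f + 1) + 2 = (e + 2) * (e + 1) + (f + 2) * (f + 1) + 2 * (e * f) := by
      ring
    omega
  have h6 : 2 ≤ (e + 2) * (e + 1) := by nlinarith
  omega

/-- A general form is not a product of two forms of given positive degrees, the first of which has
a coefficient one at a given place. -/
theorem ForGeneral.ne_mul_of_coeff_eq_one (i : Fin c) {e f : ℕ} (he : 1 ≤ e) (hf : 1 ≤ f)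
    (hb : e + f = b i) {m₀ : Fin 3 →₀ ℕ} (hm₀ : m₀ ∈ expts e) :
    ForGeneral b (fun F => ∀ G H : Poly, G.IsHomogeneous e → H.IsHomogeneous f →
      coeff m₀ G = 1 → F i ≠ G * H) := by
  classical
  -- The parameters are the coefficients of both factors except the one at `m₀`, which the default
  -- value in `G` fixes to one.
  let τ := (expts e).erase m₀ ⊕ expts f
  let G : (τ → ℂ) → Poly := fun θ =>
    toForm e fun u => if hu : u ∈ (expts e).erase m₀ then θ (Sum.inl ⟨u, hu⟩) else 1
  let H : (τ → ℂ) → Poly := fun θ =>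
    toForm f fun u => if hu : u ∈ expts f then θ (Sum.inr ⟨u, hu⟩) else 0
  have hG : ∀ u, IsPoly (fun x : τ ⊕ Fin c × (Fin 3 →₀ ℕ) → ℂ =>
      coeff u (G fun t => x (Sum.inl t))) := by
    intro u
    simp only [G, coeff_toForm]
    split_ifs
    exacts [IsPoly.coord _, IsPoly.const 1, IsPoly.const 0]
  have hH : ∀ u, IsPoly (fun x : τ ⊕ Fin c × (Fin 3 →₀ ℕ) → ℂ =>
      coeff u (H fun t => x (Sum.inl t))) := by
    intro u
    simp only [H, coeff_toForm]
    split_ifs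
    exacts [IsPoly.coord _, IsPoly.const 0]
  have hcard : Fintype.card τ < ∑ j, (if j = i then expts (b j) else ∅ : Finset _).card := by
    rw [Finset.sum_eq_single i (fun j _ hj => by simp [hj]) (by simp), if_pos rfl, ← hb]
    simp only [τ, Fintype.card_sum, Fintype.card_coe, Finset.card_erase_of_mem hm₀]
    exact card_expts_add_lt he hf
  refine (ForGeneral.not_of_solvable (fun j => if j = i then expts (b j) else ∅)
    (fun j => by split_ifs <;> simp) hcard (fun F θ => F i = G θ * H θ)
    fun j m hm => ?_).mono fun F _ hF G' H' hG' hH' h1 hmul =>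
      hF (Sum.elim (fun u => coeff u.1 G') fun u => coeff u.1 H') ?_
  · by_cases hj : j = i
    · subst hj
      refine ⟨_, IsPoly.sum (Finset.HasAntidiagonal.antidiagonal m) fun u _ => (hG u.1).mul (hH u.2),
        fun F θ _ hbad => ?_⟩
      rw [hbad, coeff_mul]
      rfl
    · simp [hj] at hm
  · rw [hmul]
    congr 1
    · ext u
      simp only [G, coeff_toForm]
      split_ifs with h2 h3
      · rfl
      · rw [Finset.mem_erase, not_and_or, not_not] at h3
        rcases h3 with rfl | h3
        · exact h1
        · exact absurd h2 h3
      · exact coeff_eq_zero_of_notMem hG' h2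
    · ext u
      simp only [H, coeff_toForm]
      split_ifs with h2
      · rfl
      · exact coeff_eq_zero_of_notMem hH' h2

/-- In a factorization the first factor can be rescaled to have some coefficient one; only finitely
many degrees and places have to be excluded. -/
theorem ForGeneral.irreducible (hb : ∀ i, 1 ≤ b i) (h0 : ForGeneral b fun F => ∀ i, F i ≠ 0) :
    ForGeneral b (fun F => ∀ i, Irreducible (F i)) := by
  have h := ForGeneral.forall (b := b) fun i => ForGeneral.forall_mem (Finset.HasAntidiagonal.antidiagonal (b i))
    fun ef hef => ForGeneral.forall_mem (expts ef.1) fun m₀ hm₀ =>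
      ForGeneral.imp (P := 1 ≤ ef.1 ∧ 1 ≤ ef.2) fun h =>
        ForGeneral.ne_mul_of_coeff_eq_one i h.1 h.2 (Finset.HasAntidiagonal.mem_antidiagonal.mp hef) hm₀
  refine (h0.and h).mono fun F hF hQ i =>
    irreducible_of_isHomogeneous (hF i) (hb i) (hQ.1 i) fun e f he hf hef G H hG hH hmul => ?_
  have hG0 : G ≠ 0 := by
    rintro rfl
    exact hQ.1 i (by rw [hmul, zero_mul])
  obtain ⟨m₀, hm₀⟩ := ne_zero_iff.mp hG0
  have hm : m₀ ∈ expts e := by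
    by_contra hm
    exact hm₀ (coeff_eq_zero_of_notMem hG hm)
  refine hQ.2 i (e, f) (Finset.HasAntidiagonal.mem_antidiagonal.mpr hef) m₀ hm ⟨he, hf⟩ (C (coeff m₀ G)⁻¹ * G)
    (C (coeff m₀ G) * H) (hG.C_mul _) (hH.C_mul _) ?_ ?_
  · rw [coeff_C_mul, inv_mul_cancel₀ hm₀]
  · rw [hmul, mul_mul_mul_comm, ← C_mul, inv_mul_cancel₀ hm₀, C_1, one_mul]

end PlaneCurve
-- Affine charts and general position of curves
namespace PlaneCurve

theorem grad_smul_of_isHomogeneous {F : Poly} {n : ℕ} (hF : F.IsHomogeneous n) (a : ℂ)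
    (v : Fin 3 → ℂ) : grad F (a • v) = a ^ (n - 1) • grad F v :=
  funext fun i => eval_smul_of_isHomogeneous (hF.pderiv (i := i)) a v

theorem dotProduct_grad_self {F : Poly} {n : ℕ} (hF : F.IsHomogeneous n) (v : Fin 3 → ℂ) :
    v ⬝ᵥ grad F v = n * eval v F := by
  have := congrArg (eval v) hF.sum_X_mul_pderiv
  simpa [dotProduct, grad] using this

/-- A point of the affine chart where the `k`-th coordinate is one. -/
def chartPoint (k l : Fin 3) (x y : ℂ) : Fin 3 → ℂ :=
  fun m => if m = k then 1 else if m = l then x else y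

/-- A direction in the affine chart where the `k`-th coordinate is one. -/
def chartDir (k l : Fin 3) (x : ℂ) : Fin 3 → ℂ :=
  fun m => if m = k then 0 else if m = l then 1 else x

theorem isPoly_chartPoint {σ : Type*} (k l : Fin 3) (i j : σ) (m : Fin 3) :
    IsPoly (fun θ : σ → ℂ => chartPoint k l (θ i) (θ j) m) := by
  unfold chartPoint
  split_ifs
  exacts [IsPoly.const 1, IsPoly.coord _, IsPoly.coord _]

theorem isPoly_chartDir {σ : Type*} (k l : Fin 3) (i : σ) (m : Fin 3) :
    IsPoly (fun θ : σ → ℂ => chartDir k l (θ i) m) := by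
  unfold chartDir
  split_ifs
  exacts [IsPoly.const 0, IsPoly.const 1, IsPoly.coord _]

/-- Two independent vectors in terms of an affine chart. -/
theorem exists_chart {p q : Fin 3 → ℂ} (h : LinearIndependent ℂ ![p, q]) :
    ∃ k l, l ≠ k ∧ ∃ x y z r s t : ℂ, r ≠ 0 ∧ t ≠ 0 ∧ p = r • chartPoint k l x y ∧
      q = s • chartPoint k l x y + t • chartDir k l z := by
  rw [LinearIndependent.pair_iff] at h
  have hp : p ≠ 0 := by
    rintro rfl
    simpa using h 1 0
  obtain ⟨k, hk⟩ := Function.ne_iff.mp hp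
  rw [Pi.zero_apply] at hk
  -- Removing the `k`-th coordinate turns `q` into a direction of the chart `p k ≠ 0`, which is then
  -- normalized at a nonzero coordinate `l`.
  set v := q - (q k / p k) • p with hv
  have hvk : v k = 0 := by simp [hv, div_mul_cancel₀ _ hk]
  have hv0 : v ≠ 0 := by
    intro h0
    have := h (-(q k / p k)) 1 (by rw [one_smul, neg_smul, ← h0, hv]; abel)
    exact one_ne_zero this.2
  obtain ⟨l, hl⟩ := Function.ne_iff.mp hv0
  rw [Pi.zero_apply] at hl
  have hlk : l ≠ k := by
    rintro rfl
    exact hl hvk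
  obtain ⟨n, hn⟩ : ∃ n : Fin 3, ∀ m, m ≠ k → m ≠ l → m = n := by
    revert hlk
    clear * -
    revert k l
    decide
  have hpe : p = p k • chartPoint k l (p l / p k) (p n / p k) := by
    funext m
    simp only [chartPoint, Pi.smul_apply, smul_eq_mul]
    split_ifs with h1 h2
    · rw [h1, mul_one]
    · rw [h2, mul_div_cancel₀ _ hk]
    · rw [hn m h1 h2, mul_div_cancel₀ _ hk]
  have hve : v = v l • chartDir k l (v n / v l) := by
    funext m
    simp only [chartDir, Pi.smul_apply, smul_eq_mul]
    split_ifs with h1 h2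
    · rw [h1, mul_zero, hvk]
    · rw [h2, mul_one]
    · rw [hn m h1 h2, mul_div_cancel₀ _ hl]
  refine ⟨k, l, hlk, p l / p k, p n / p k, v n / v l, p k, q k, v l, hk, hl, hpe, ?_⟩
  rw [← hve]
  have : q k • chartPoint k l (p l / p k) (p n / p k) = (q k / p k) • p := calc
    _ = (q k / p k) • (p k • chartPoint k l (p l / p k) (p n / p k)) := by
      rw [smul_smul, div_mul_cancel₀ _ hk]
    _ = _ := by rw [← hpe]
  rw [this, hv]
  abel

theorem eval_eq_zero_of_smul {F : Poly} {n : ℕ} (hF : F.IsHomogeneous n) {r : ℂ} (hr : r ≠ 0)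
    {v : Fin 3 → ℂ} (h : eval (r • v) F = 0) : eval v F = 0 := by
  rw [eval_smul_of_isHomogeneous hF] at h
  exact (mul_eq_zero.mp h).resolve_left (pow_ne_zero _ hr)

/-- By Euler's relation `p` is orthogonal to the gradient at a zero `p`, so only the `v` part of the
direction matters. -/
theorem dotProduct_grad_eq_zero {F : Poly} {n : ℕ} (hF : F.IsHomogeneous n) {r s t : ℂ}
    (hr : r ≠ 0) (ht : t ≠ 0) {p v : Fin 3 → ℂ} (h : eval p F = 0)
    (h' : (s • p + t • v) ⬝ᵥ grad F (r • p) = 0) : v ⬝ᵥ grad F p = 0 := by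
  rw [grad_smul_of_isHomogeneous hF, dotProduct_smul, add_dotProduct, smul_dotProduct,
    smul_dotProduct, dotProduct_grad_self hF, h] at h'
  simpa [hr, ht] using h'

variable {c : ℕ} {b : Fin c → ℕ}

/-- Three general curves have no common point. -/
theorem ForGeneral.no_common_point (hb : ∀ i, 1 ≤ b i) {i j k : Fin c} (hij : i ≠ j) (hik : i ≠ k)
    (hjk : j ≠ k) : ForGeneral b (fun F => ∀ p : Fin 3 → ℂ, p ≠ 0 → eval p (F i) = 0 →
      eval p (F j) = 0 → eval p (F k) ≠ 0) := by
  -- Three conditions on a point with two parameters; `v` and `q` are placeholders, since `s₀` and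
  -- `s₂` are empty.
  refine (ForGeneral.forall fun kl : Fin 3 × Fin 3 => ForGeneral.imp (P := kl.2 ≠ kl.1) fun hkl =>
    ForGeneral.not_incident hb (τ := Fin 2) (k := kl.1) (l := kl.2) (n := kl.1)
      (p := fun m θ => chartPoint kl.1 kl.2 (θ 0) (θ 1) m)
      (v := fun m _ => chartDir kl.1 kl.2 0 m)
      (q := fun m θ => chartPoint kl.1 kl.2 (θ 0) (θ 1) m)
      (isPoly_chartPoint _ _ _ _) (fun _ => IsPoly.const _) (isPoly_chartPoint _ _ _ _)
      (fun _ => if_pos rfl) (fun _ => if_pos rfl) (fun _ => by simp [chartDir, hkl])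
      (fun _ => if_pos rfl)
      (s₀ := ∅) (s₁ := {i, j, k}) (s₂ := ∅) (by simp) (by simp) (by simp)
      (by rw [Finset.card_eq_three.mpr ⟨i, j, k, hij, hik, hjk, rfl⟩]; simp)).mono
    fun F hF hQ p hp hi hj hk => ?_
  obtain ⟨q, hq⟩ := exists_linearIndependent_pair_of_one_lt_finrank (R := ℂ) (by simp) hp
  obtain ⟨k, l, hlk, x, y, -, r, -, -, hr, -, rfl, -⟩ := exists_chart hq
  refine hQ (k, l) hlk ![x, y] ⟨by simp, fun i hi => ?_, by simp⟩
  simp only [Finset.mem_insert, Finset.mem_singleton] at hi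
  rcases hi with rfl | rfl | rfl <;> exact eval_eq_zero_of_smul (hF _) hr ‹_›

/-- Two general curves are not tangent. -/
theorem ForGeneral.not_tangent (hb : ∀ i, 1 ≤ b i) {i j : Fin c} (hij : i ≠ j) :
    ForGeneral b (fun F => ∀ p v : Fin 3 → ℂ, LinearIndependent ℂ ![p, v] → eval p (F i) = 0 →
      eval p (F j) = 0 → v ⬝ᵥ grad (F i) p = 0 → v ⬝ᵥ grad (F j) p ≠ 0) := by
  -- Four conditions on a point and a direction, which have three parameters.
  refine (ForGeneral.forall fun kl : Fin 3 × Fin 3 => ForGeneral.imp (P := kl.2 ≠ kl.1) fun hkl =>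
    ForGeneral.not_incident hb (τ := Fin 3) (k := kl.1) (l := kl.2) (n := kl.1)
      (p := fun m θ => chartPoint kl.1 kl.2 (θ 0) (θ 1) m)
      (v := fun m θ => chartDir kl.1 kl.2 (θ 2) m)
      (q := fun m θ => chartPoint kl.1 kl.2 (θ 0) (θ 1) m)
      (isPoly_chartPoint _ _ _ _) (isPoly_chartDir _ _ _) (isPoly_chartPoint _ _ _ _)
      (fun _ => if_pos rfl) (fun _ => if_pos rfl) (fun _ => by simp [chartDir, hkl])
      (fun _ => if_pos rfl)
      (s₀ := {i, j}) (s₁ := ∅) (s₂ := ∅) (by simp) (by simp) (by simp)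
      (by rw [Finset.card_pair hij]; simp)).mono
    fun F hF hQ p v hpv hi hj hvi hvj => ?_
  obtain ⟨k, l, hlk, x, y, z, r, s, t, hr, ht, rfl, rfl⟩ := exists_chart hpv
  refine hQ (k, l) hlk ![x, y, z] ⟨fun i hi => ?_, by simp, by simp⟩
  simp only [Finset.mem_insert, Finset.mem_singleton] at hi
  rcases hi with rfl | rfl
  · have h := eval_eq_zero_of_smul (hF _) hr hi
    exact ⟨h, dotProduct_grad_eq_zero (hF _) hr ht h hvi⟩
  · have h := eval_eq_zero_of_smul (hF _) hr hj
    exact ⟨h, dotProduct_grad_eq_zero (hF _) hr ht h hvj⟩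

/-- For four general curves, the line joining an intersection point of the first two to an
intersection point of the last two is not tangent to the first one. -/
theorem ForGeneral.not_tangent_join (hb : ∀ i, 1 ≤ b i) {i j k l : Fin c} (hij : i ≠ j)
    (hik : i ≠ k) (hil : i ≠ l) (hjk : j ≠ k) (hjl : j ≠ l) (hkl : k ≠ l) :
    ForGeneral b (fun F => ∀ p q : Fin 3 → ℂ, LinearIndependent ℂ ![p, q] → eval p (F i) = 0 →
      eval p (F j) = 0 → eval q (F k) = 0 → eval q (F l) = 0 → q ⬝ᵥ grad (F i) p ≠ 0) := by
  have h01 : Disjoint ({i} : Finset (Fin c)) {j} := by simpa using hij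
  have h02 : Disjoint ({i} : Finset (Fin c)) {k, l} := by simp [hik, hil]
  have h12 : Disjoint ({j} : Finset (Fin c)) {k, l} := by simp [hjk, hjl]
  have hcard : Fintype.card (Fin 4) <
      2 * ({i} : Finset (Fin c)).card + ({j} : Finset (Fin c)).card + ({k, l} : Finset _).card := by
    rw [Finset.card_pair hkl]
    simp
  -- Five conditions against four parameters: a point, a direction, and the position of `q` on the
  -- resulting line. The second family treats `q` at infinity in the chart, where the fourth
  -- parameter is idle.
  refine ((ForGeneral.forall fun mn : Fin 3 × Fin 3 => ForGeneral.imp (P := mn.2 ≠ mn.1) fun hmn =>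
    ForGeneral.not_incident hb (τ := Fin 4) (k := mn.1) (l := mn.2) (n := mn.1)
      (p := fun m θ => chartPoint mn.1 mn.2 (θ 0) (θ 1) m)
      (v := fun m θ => chartDir mn.1 mn.2 (θ 2) m)
      (q := fun m θ => chartPoint mn.1 mn.2 (θ 0) (θ 1) m + θ 3 * chartDir mn.1 mn.2 (θ 2) m)
      (isPoly_chartPoint _ _ _ _) (isPoly_chartDir _ _ _)
      (fun m => (isPoly_chartPoint _ _ _ _ m).add ((IsPoly.coord _).mul (isPoly_chartDir _ _ _ m)))
      (fun _ => if_pos rfl) (fun _ => if_pos rfl) (fun _ => by simp [chartDir, hmn])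
      (fun _ => by simp [chartPoint, chartDir]) h01 h02 h12 hcard).and
    (ForGeneral.forall fun mn : Fin 3 × Fin 3 => ForGeneral.imp (P := mn.2 ≠ mn.1) fun hmn =>
    ForGeneral.not_incident hb (τ := Fin 4) (k := mn.1) (l := mn.2) (n := mn.2)
      (p := fun m θ => chartPoint mn.1 mn.2 (θ 0) (θ 1) m)
      (v := fun m θ => chartDir mn.1 mn.2 (θ 2) m)
      (q := fun m θ => chartDir mn.1 mn.2 (θ 2) m)
      (isPoly_chartPoint _ _ _ _) (isPoly_chartDir _ _ _) (isPoly_chartDir _ _ _)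
      (fun _ => if_pos rfl) (fun _ => if_pos rfl) (fun _ => by simp [chartDir, hmn])
      (fun _ => by simp [chartDir, hmn]) h01 h02 h12 hcard)).mono
    fun F hF hQ p q hpq hi hj hk hl hqi => ?_
  obtain ⟨m, n, hmn, x, y, z, r, s, t, hr, ht, rfl, rfl⟩ := exists_chart hpq
  have hi' := eval_eq_zero_of_smul (hF _) hr hi
  have hj' := eval_eq_zero_of_smul (hF _) hr hj
  have hv := dotProduct_grad_eq_zero (hF _) hr ht hi' hqi
  by_cases hs : s = 0
  · rw [hs, zero_smul, zero_add] at hk hl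
    have hk' := eval_eq_zero_of_smul (hF _) ht hk
    have hl' := eval_eq_zero_of_smul (hF _) ht hl
    refine hQ.2 (m, n) hmn ![x, y, z, 0] ⟨?_, ?_, ?_⟩ <;>
      simp only [Finset.mem_insert, Finset.mem_singleton, forall_eq_or_imp, forall_eq]
    exacts [⟨hi', hv⟩, hj', ⟨hk', hl'⟩]
  · have he : s • chartPoint m n x y + t • chartDir m n z =
        s • (fun o => chartPoint m n x y o + t / s * chartDir m n z o) := by
      funext o
      simp only [Pi.add_apply, Pi.smul_apply, smul_eq_mul]
      field_simp
    rw [he] at hk hl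
    have hk' := eval_eq_zero_of_smul (hF _) hs hk
    have hl' := eval_eq_zero_of_smul (hF _) hs hl
    refine hQ.1 (m, n) hmn ![x, y, z, t / s] ⟨?_, ?_, ?_⟩ <;>
      simp only [Finset.mem_insert, Finset.mem_singleton, forall_eq_or_imp, forall_eq]
    exacts [⟨hi', hv⟩, hj', ⟨hk', hl'⟩]

end PlaneCurve
-- General unions are nodal and have no hyper-bitangent lines
namespace PlaneCurve

/-- The orthogonal space of `w` has dimension at least two, so it is not contained in the span of
`p`. -/
theorem exists_linearIndependent_dotProduct_eq_zero {p : Fin 3 → ℂ} (hp : p ≠ 0) (w : Fin 3 → ℂ) :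
    ∃ v, LinearIndependent ℂ ![p, v] ∧ v ⬝ᵥ w = 0 := by
  by_contra! hcon
  let f : (Fin 3 → ℂ) →ₗ[ℂ] ℂ := dotProductBilin ℂ ℂ w
  have hle : LinearMap.ker f ≤ Submodule.span ℂ {p} := by
    intro v hv
    by_contra hmem
    refine hcon v ((LinearIndependent.pair_iff' hp).mpr fun a ha => hmem ?_) ?_
    · exact Submodule.mem_span_singleton.mpr ⟨a, ha⟩
    · rw [dotProduct_comm]
      exact hv
  have h1 := (Submodule.finrank_mono hle).trans_eq (finrank_span_singleton hp)
  have h2 := f.finrank_range_add_finrank_ker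
  have h3 := (Submodule.finrank_le (LinearMap.range f)).trans_eq (Module.finrank_self ℂ)
  rw [Module.finrank_fin_fun] at h2
  omega

theorem exists_ne_ne {c : ℕ} (hc : 3 ≤ c) (i j : Fin c) : ∃ k, k ≠ i ∧ k ≠ j := by
  have h : ({i, j} : Finset (Fin c)).card < (Finset.univ : Finset (Fin c)).card := by
    have := Finset.card_le_two (a := i) (b := j)
    rw [Finset.card_univ, Fintype.card_fin]
    omega
  obtain ⟨k, -, hk⟩ := Finset.exists_mem_notMem_of_card_lt_card h
  exact ⟨k, by simpa using hk⟩

variable {c : ℕ} {b : Fin c → ℕ}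

/-- A general union of curves is nodal. -/
theorem ForGeneral.isNodalUnion (hc : 3 ≤ c) (hb : ∀ i, 1 ≤ b i) :
    ForGeneral b (IsNodalUnion b) := by
  have hT : ForGeneral b fun F => ∀ i j k : Fin c, i ≠ j → i ≠ k → j ≠ k →
      ∀ p : Plane, p ∈ zeroLocus (F i) → p ∈ zeroLocus (F j) → p ∉ zeroLocus (F k) :=
    (ForGeneral.forall fun i => ForGeneral.forall fun j => ForGeneral.forall fun k =>
      ForGeneral.imp fun hij => ForGeneral.imp fun hik => ForGeneral.imp fun hjk =>
        ForGeneral.no_common_point hb hij hik hjk).mono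
      fun F _ hQ i j k hij hik hjk p => hQ i j k hij hik hjk p.rep p.rep_nonzero
  -- A zero form would vanish at an intersection point of two other curves, against `hT`.
  have h0 : ForGeneral b fun F => ∀ i, F i ≠ 0 := by
    refine hT.mono fun F hF hQ i hi => ?_
    obtain ⟨j, hji, -⟩ := exists_ne_ne hc i i
    obtain ⟨k, hki, hkj⟩ := exists_ne_ne hc i j
    obtain ⟨p, hpj, hpk⟩ := exists_mem_zeroLocus_inter (hF j) (hb j) (hF k) (hb k)
    exact hQ j k i hkj.symm hji hki p hpj hpk (by simp [hi, zeroLocus])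
  have hD := ForGeneral.forall (b := b) fun i => ForGeneral.forall fun j =>
    ForGeneral.imp fun hij : i ≠ j => ForGeneral.not_tangent hb hij
  refine ((hT.and (ForGeneral.irreducible hb h0)).and hD).mono fun F hF hQ => ?_
  obtain ⟨⟨hT, hI⟩, hD⟩ := hQ
  refine ⟨hI, hF, fun i j hij hass => ?_, fun i j hij p hp => ?_⟩
  · obtain ⟨k, hki, hkj⟩ := exists_ne_ne hc i j
    obtain ⟨p, hpi, hpk⟩ := exists_mem_zeroLocus_inter (hF i) (hb i) (hF k) (hb k)
    refine hT i k j hki.symm hij hkj p hpi hpk ?_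
    obtain ⟨G, hG⟩ := hass.dvd
    rw [zeroLocus, Set.mem_ofPred_eq] at hpi ⊢
    rw [hG, map_mul, hpi, zero_mul]
  · rw [isNode_prod_iff hij hp.1 hp.2]
    refine ⟨fun k hki hkj => hT i j k hij hki.symm hkj.symm p hp.1 hp.2, ?_⟩
    rw [LinearIndependent.pair_iff]
    by_contra! hcon
    obtain ⟨s, t, hst, hne⟩ := hcon
    -- Dependent gradients are multiples of one vector `w`; a direction orthogonal to `w` and
    -- independent of `p` is then tangent to both curves.
    obtain ⟨w, ⟨r, hr⟩, ⟨r', hr'⟩⟩ : ∃ w : Fin 3 → ℂ, (∃ r : ℂ, grad (F i) p.rep = r • w) ∧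
        ∃ r : ℂ, grad (F j) p.rep = r • w := by
      by_cases hs : s = 0
      · refine ⟨grad (F i) p.rep, ⟨1, (one_smul _ _).symm⟩, 0, ?_⟩
        rw [hs, zero_smul, zero_add] at hst
        rw [zero_smul]
        exact (smul_eq_zero.mp hst).resolve_left (hne hs)
      · refine ⟨grad (F j) p.rep, ⟨-(s⁻¹ * t), ?_⟩, 1, (one_smul _ _).symm⟩
        rw [neg_smul, mul_smul, ← smul_neg, ← eq_neg_of_add_eq_zero_left hst, smul_smul,
          inv_mul_cancel₀ hs, one_smul]
    obtain ⟨v, hv, hvw⟩ := exists_linearIndependent_dotProduct_eq_zero p.rep_nonzero w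
    exact hD i j hij p.rep v hv hp.1 hp.2 (by rw [hr, dotProduct_smul, hvw, smul_zero])
      (by rw [hr', dotProduct_smul, hvw, smul_zero])

/-- A general nodal union of degree at least five has no hyper-bitangent lines. -/
theorem ForGeneral.hypDeg_one_eq_empty (hc : 4 ≤ c) (hb : ∀ i, 1 ≤ b i) (hb5 : 5 ≤ ∑ i, b i) :
    ForGeneral b (fun F => IsNodalUnion b F ∧ hypDeg (union F) 1 = ∅) := by
  have hE := ForGeneral.forall (b := b) fun i => ForGeneral.forall fun j => ForGeneral.forall fun k =>
    ForGeneral.forall fun l => ForGeneral.imp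
      (P := i ≠ j ∧ i ≠ k ∧ i ≠ l ∧ j ≠ k ∧ j ≠ l ∧ k ≠ l) fun h =>
        ForGeneral.not_tangent_join hb h.1 h.2.1 h.2.2.1 h.2.2.2.1 h.2.2.2.2.1 h.2.2.2.2.2
  refine ((ForGeneral.isNodalUnion (by omega) hb).and hE).mono fun F hF hQ => ?_
  obtain ⟨hN, hE⟩ := hQ
  refine ⟨hN, Set.eq_empty_of_forall_notMem fun C hC => ?_⟩
  obtain ⟨hc4, -, p, q, i, j, k, l, h, hCl, -, -⟩ := exists_contact_of_mem_hypDeg hc hN hC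
  -- A component of degree at least two would be tangent at `p` to the line joining `p` and `q`,
  -- which `hE` excludes.
  have key : ∀ {p q : Plane} {i j k l : Fin c}, Contact F C p q i j k l →
      C = zeroLocus (lineThrough p q) → ¬ 2 ≤ b i := by
    intro p q i j k l h hCl hbi
    obtain ⟨r, hr⟩ := grad_eq_smul_of_forall_eq (lineThrough_isHomogeneous p q)
      (lineThrough_ne_zero h.ne) (hF i) hbi (left_mem_lineThrough p q) h.pi
      fun x hx hxF => h.capi x (hCl ▸ hx) hxF
    refine hE i j k l ⟨h.ij, h.ik, h.il, h.jk, h.jl, h.kl⟩ p.rep q.rep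
      (crossProduct_ne_zero_iff_linearIndependent.mp (cross_ne_zero h.ne)) h.pi h.pj h.qk h.ql ?_
    have hg : grad (lineThrough p q) p.rep = crossProduct p.rep q.rep := by
      funext m
      rw [grad, lineThrough, pderiv_linForm, eval_C]
    rw [hr, hg, dotProduct_smul, dot_cross_self, smul_zero]
  have hCl' : C = zeroLocus (lineThrough q p) := by
    rw [hCl]
    exact zeroLocus_eq_of_linear h.ne.symm (lineThrough_isHomogeneous p q)
      (lineThrough_ne_zero h.ne) (right_mem_lineThrough _ _) (left_mem_lineThrough _ _)
  obtain ⟨m, hm⟩ : ∃ m, 2 ≤ b m := by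
    by_contra! hcon
    have : ∑ i, b i ≤ ∑ _i : Fin c, 1 := Finset.sum_le_sum fun i _ => Nat.le_of_lt_succ (hcon i)
    rw [Finset.sum_const, Finset.card_univ, Fintype.card_fin, smul_eq_mul] at this
    omega
  have hcases : m = i ∨ m = j ∨ m = k ∨ m = l := by
    subst hc4
    have h1 := h.ij; have h2 := h.kl; have h3 := h.ik; have h4 := h.il
    have h5 := h.jk; have h6 := h.jl
    omega
  rcases hcases with rfl | rfl | rfl | rfl
  · exact key h hCl hm
  · exact key h.swap hCl hm
  · exact key h.symm hCl' hm
  · exact key h.symm.swap hCl' hm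

end PlaneCurve

theorem proposition4p1 (c : ℕ) (hc : 4 ≤ c) :
    (∀ (b : Fin c → ℕ) (F : Fin c → PlaneCurve.Poly), PlaneCurve.IsNodalUnion b F →
      (5 ≤ c → PlaneCurve.hyp (PlaneCurve.union F) = ∅) ∧
      (PlaneCurve.hypDeg (PlaneCurve.union F) 1).Finite ∧
      (∑ i, b i = 4 → (PlaneCurve.hypDeg (PlaneCurve.union F) 1).encard = 3) ∧
      ((¬ ∃ i j, i ≠ j ∧ b i = 1 ∧ b j = 1) →
        PlaneCurve.hypDeg (PlaneCurve.union F) 1 = ∅) ∧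
      (∀ d, 2 ≤ d → PlaneCurve.hypDeg (PlaneCurve.union F) d = ∅)) ∧
    (∀ b : Fin c → ℕ, (∀ i, 1 ≤ b i) → 5 ≤ ∑ i, b i →
      PlaneCurve.ForGeneral b (fun F =>
        PlaneCurve.IsNodalUnion b F ∧
        PlaneCurve.hypDeg (PlaneCurve.union F) 1 = ∅)) :=
  ⟨fun _ _ hN => ⟨fun h5 => PlaneCurve.hyp_eq_empty h5 hN, PlaneCurve.finite_hypDeg_one hc hN,
    fun hb => PlaneCurve.encard_hypDeg_one_of_sum_eq_four hc hN hb,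
    fun hb => PlaneCurve.hypDeg_one_eq_empty hc hN hb,
    fun _ hd => PlaneCurve.hypDeg_eq_empty hc hN hd⟩,
    fun _ hb hb5 => PlaneCurve.ForGeneral.hypDeg_one_eq_empty hc hb hb5⟩
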